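/- Let $0<s<1$. For a nondegenerate closed tetrahedron $t\subset\mathbb R^3$ with labelled vertices $a_t,b_t,c_t,d_t$ put $M_t=[\,b_t-a_t,\;c_t-b_t,\;d_t-b_t\,]$ and $\chi_t(\tilde x)=M_t\tilde x+a_t$ for $\tilde x\in\mathbb R^3$; $\chi_t$ maps the unit tetrahedron $\{0\le \tilde x_3\le \tilde x_1-\tilde x_2,\;0\le\tilde x_2\le\tilde x_1,\;0\le \tilde x_1\le 1\}$ onto $t$. Let $t_1,t_2$ be two such tetrahedra and let $\varphi,\psi:\mathbb R^3\to\mathbb R$ coincide on $t_\nu$ with affine functions $\varphi_\nu,\psi_\nu$ of $\mathbb R^3$, $\nu=1,2$ (for example two nodal basis functions of continuous piecewise linear finite elements). Put $$k_1(x,y)=\frac{[\varphi(x)-\varphi(y)]\,[\psi(x)-\psi(y)]}{|x-y|^{3+2s}},\qquad I_{t_1,t_2}=\int_{t_1}\int_{t_2}k_1(x,y)\,dy\,dx,$$ $$\tilde k_1(\tilde x,\tilde y)=\frac{[\varphi_1(\chi_{t_1}(\tilde x))-\varphi_2(\chi_{t_2}(\tilde y))]\,[\psi_1(\chi_{t_1}(\tilde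 x))-\psi_2(\chi_{t_2}(\tilde y))]}{|\chi_{t_1}(\tilde x)-\chi_{t_2}(\tilde y)|^{3+2s}}\,|\det M_{t_1}|\,|\det M_{t_2}|,\qquad \tilde x,\tilde y\in\mathbb R^3.$$ For $D=(D^1,D^2)\in\mathbb R^3\times\mathbb R^3$ write $D^T=(D^2,D^1)$. In each of the following four cases, $k_1$ is integrable on the product of the two tetrahedra, the stated formulas for $I$ hold, and the reduced integrand ($\tilde k_{1,V}$, $\tilde k_{1,E}$, $\tilde k_{1,F}$, $\tilde k_{1,T}$ respectively) is real analytic on a neighbourhood of the closed unit cube over which it is integrated. **Common vertex** ($a_{t_1}=a_{t_2}$ and $t_1\cap t_2=\{a_{t_1}\}$). With $J(\eta)=\eta_1\eta_3^2\eta_4$ and $$D_1(\eta)=\bigl((1,\eta_1\eta_2,\eta_1(1-\eta_2)),\,(\eta_3,\eta_3\eta_4\eta_5,\eta_3\eta_4(1-\eta_5))\bigr),\qquad D_2=D_1^T,$$ $$I_{t_1,t_2}=\int_0^1\!\int_{[0,1]^5}\sum_{m=1}^2\tilde k_1(\xi D_m(\eta))\,\xi^5J(\eta)\,d\eta\,d\xi=\frac1{5-2s}\int_{[0,1]^5}\tilde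 k_{1,V}(\eta)\,d\eta,\qquad \tilde k_{1,V}=[\tilde k_1(D_1)+\tilde k_1(D_2)]\,J .$$ **Common edge** ($a_{t_1}=a_{t_2}$, $b_{t_1}=b_{t_2}$ and $t_1\cap t_2$ is the segment $[a_{t_1},b_{t_1}]$). With $$D_1(\eta)=\bigl((0,\eta_1,1-\eta_1),\,(-\eta_2\eta_3\eta_4,\eta_2\eta_3(1-\eta_4),\eta_2(1-\eta_3))\bigr),$$ $$D_2(\eta)=\bigl((0,\eta_3\eta_4,\eta_3(1-\eta_4)),\,(-\eta_1\eta_2,\eta_1(1-\eta_2),1-\eta_1)\bigr),$$ $D_3=D_1^T$, $D_4=D_2^T$, $J_1=J_3=\eta_2^2\eta_3$, $J_2=J_4=\eta_1\eta_3$, $$I_{t_1,t_2}=\int_{[0,1]^2}\!\int_{[0,1]^4}\sum_{m=1}^4\tilde k_1\bigl(\xi_1(e_1,e_1)+\xi_1\xi_2D_m(\eta)\bigr)\,\xi_1^5\xi_2^4J_m(\eta)\,d\eta\,d\xi=\frac1{5-2s}\,\frac1{4-2s}\int_{[0,1]^4}\tilde k_{1,E}(\eta)\,d\eta,\qquad \tilde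 k_{1,E}=\sum_{m=1}^4\tilde k_1(D_m)\,J_m .$$ **Common face** ($a_{t_1}=a_{t_2}$, $b_{t_1}=b_{t_2}$, $c_{t_1}=c_{t_2}$ and $t_1\cap t_2$ is the triangle with vertices $a_{t_1},b_{t_1},c_{t_1}$). With $$\begin{aligned} D_1&=((0,\eta_1,1-\eta_1),(-\eta_1\eta_2\eta_3,0,\eta_1\eta_2(1-\eta_3))), & D_2&=((0,\eta_1\eta_2,\eta_1(1-\eta_2)),(-\eta_1\eta_2\eta_3,0,1-\eta_1\eta_2\eta_3)),\\ D_3&=((0,\eta_1\eta_2,1-\eta_1\eta_2),(-\eta_1\eta_2\eta_3,0,\eta_1(1-\eta_2\eta_3))), & D_4&=((0,\eta_1\eta_2\eta_3,\eta_1\eta_2(1-\eta_3)),(-\eta_1,0,1-\eta_1)),\\ D_5&=((0,\eta_1\eta_2\eta_3,\eta_1(1-\eta_2\eta_3)),(-\eta_1\eta_2,0,1-\eta_1\eta_2)), & D_6&=((0,\eta_1\eta_2\eta_3,1-\eta_1\eta_2\eta_3),(-\eta_1\eta_2,0,\eta_1(1-\eta_2))),\\ D_7&=((0,0,1),(-\eta_1\eta_2\eta_3,\eta_1\eta_2(1-\eta_3),\eta_1(1-\eta_2))),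 & D_{15}&=((-\eta_1\eta_2\eta_3,\eta_1\eta_2(1-\eta_3),1-\eta_1\eta_2),(0,0,\eta_1)),\\ D_{16}&=((0,0,\eta_3),(-\eta_1\eta_2,\eta_1(1-\eta_2),1-\eta_1)), & D_{17}&=((-\eta_1\eta_2,\eta_1(1-\eta_2),1-\eta_1),(0,0,\eta_1\eta_3)), \end{aligned}$$ $D_{7+i}=D_i^T$ for $1\le i\le 7$, $J_m=\eta_1^2\eta_2$ for $m\le 15$, $J_{16}=\eta_1$, $J_{17}=\eta_1^2$, $$I_{t_1,t_2}=\int_{[0,1]^3}\!\int_{[0,1]^3}\sum_{m=1}^{17}\tilde k_1\bigl(\xi_1(e_1,e_1)+\xi_1(1-\xi_2)(e_2,e_2)+\xi_1\xi_2\xi_3D_m(\eta)\bigr)\,\xi_1^5\xi_2^4\xi_3^3J_m(\eta)\,d\eta\,d\xi$$ $$=\prod_{j=0}^2\frac1{5-j-2s}\int_{[0,1]^3}\tilde k_{1,F}(\eta)\,d\eta,\qquad \tilde k_{1,F}=\sum_{m=1}^{17}\tilde k_1(D_m)\,J_m .$$ **Identical tetrahedra** ($t_1=t_2=t$, $\varphi_1=\varphi_2$,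 $\psi_1=\psi_2$). With $$\begin{aligned} D_1&=((0,\eta_1,-\eta_1),(-\eta_1\eta_2,0,-1)), & D_2&=((0,1,0),(-\eta_1\eta_2,0,\eta_1(1-\eta_2))),\\ D_3&=((0,\eta_1,-1),(-\eta_1\eta_2,0,-\eta_1\eta_2)), & D_4&=((0,\eta_1\eta_2,-\eta_1\eta_2),(-\eta_1,0,-1)),\\ D_5&=((0,\eta_1\eta_2,\eta_1(1-\eta_2)),(-1,0,0)), & D_6&=((0,\eta_1\eta_2,-1),(-\eta_1,0,-\eta_1)),\\ D_7&=((0,0,0),(-\eta_1\eta_2,\eta_1(1-\eta_2),-1)), & D_8&=((0,0,-1),(-\eta_1\eta_2,\eta_1(1-\eta_2),-\eta_1)),\\ D_9&=((0,0,\eta_1),(-\eta_2,1-\eta_2,0)), && \end{aligned}$$ $D_{m+9}=D_m^T$ for $1\le m\le 9$, $J_m=J_{m+9}=\eta_1$ for $m\le 8$, $J_9=J_{18}=1$, $$I_{t,t}=\int_{[0,1]^4}\!\int_{[0,1]^2}\sum_{m=1}^{18}\tilde k_1\bigl(\xi_1\xi_2\xi_3\xi_4D_m(\eta)\bigr)\,\xi_1^5\xi_2^4\xi_3^3\xi_4^2J_m(\eta)\,d\eta\,d\xi$$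 $$=2\prod_{l=0}^3\frac1{5-l-2s}\int_{[0,1]^2}\tilde k_{1,T}(\eta)\,d\eta,\qquad \tilde k_{1,T}=\sum_{m=1}^{9}\tilde k_1(D_m)\,J_m .$$ -/

import Mathlib

open MeasureTheory Set

/-- Physical space `ℝ³` with the Euclidean norm. -/
abbrev E3 : Type := EuclideanSpace ℝ (Fin 3)

/-- Reference coordinates `x̃ ∈ ℝ³`; the index `0` stands for `x̃₁` -/
abbrev Ref : Type := Fin 3 → ℝ

/-- A nondegenerate tetrahedron with labelled vertices
`a = points 0`, `b = points 1`, `c = points 2`, `d = points 3`. -/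
abbrev Tet : Type := Affine.Simplex ℝ E3 3

/-- The closed solid tetrahedron. -/
def Tet.body (t : Tet) : Set E3 := convexHull ℝ (range t.points)

/-- The matrix `M_t = [b - a, c - b, d - b]`, given by its columns. -/
def Tet.matrix (t : Tet) : Matrix (Fin 3) (Fin 3) ℝ :=
  Matrix.of fun i j =>
    ![(t.points 1 - t.points 0) i, (t.points 2 - t.points 1) i, (t.points 3 - t.points 1) i] j

/-- The affine map `χ_t(x̃) = M_t x̃ + a_t`, on all of `ℝ³`. It maps the unit tetrahedron
`{0 ≤ x̃₃ ≤ x̃₁ - x̃₂, 0 ≤ x̃₂ ≤ x̃₁, 0 ≤ x̃₁ ≤ 1}` onto `t`. -/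
noncomputable def Tet.chi (t : Tet) (x : Ref) : E3 :=
  WithLp.toLp 2 (t.matrix.mulVec x) + t.points 0

/-- The kernel `k₁(x, y) = [φ(x) - φ(y)] [ψ(x) - ψ(y)] / |x - y|^(3 + 2s)`. -/
noncomputable def k1 (s : ℝ) (φ ψ : E3 → ℝ) (x y : E3) : ℝ :=
  (φ x - φ y) * (ψ x - ψ y) / ‖x - y‖ ^ (3 + 2 * s)

/-- The singular integral `I_{t₁,t₂} = ∫_{t₁} ∫_{t₂} k₁(x, y) dy dx`. -/
noncomputable def singularIntegral (s : ℝ) (φ ψ : E3 → ℝ) (t₁ t₂ : Tet) : ℝ :=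
  ∫ x in t₁.body, ∫ y in t₂.body, k1 s φ ψ x y

/-- The pulled back kernel `k̃₁(x̃, ỹ) = k₁(χ_{t₁}(x̃), χ_{t₂}(ỹ)) |det M_{t₁}| |det M_{t₂}|`, where on
`t_ν` the basis functions are given by their affine representations `φ_ν`, `ψ_ν`. As `φ_ν` and `ψ_ν`
are defined on all of `ℝ³`, so is `k̃₁`, off the unit tetrahedron as well. -/
noncomputable def kTilde (s : ℝ) (φ₁ φ₂ ψ₁ ψ₂ : E3 →ᵃ[ℝ] ℝ) (t₁ t₂ : Tet) (p : Ref × Ref) : ℝ :=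
  (φ₁ (t₁.chi p.1) - φ₂ (t₂.chi p.2)) * (ψ₁ (t₁.chi p.1) - ψ₂ (t₂.chi p.2))
    / ‖t₁.chi p.1 - t₂.chi p.2‖ ^ (3 + 2 * s) * |t₁.matrix.det| * |t₂.matrix.det|

/-! In all the maps below, the index `0` stands for the first variable: `η 0 = η₁`, `ξ 0 = ξ₁`,
and the index `m : Fin n` stands for the sub-domain number `m + 1`. -/

/-- The pair `(e₁, e₁)`. -/
def pairE1 : Ref × Ref := (![1, 0, 0], ![1, 0, 0])

/-- The pair `(e₂, e₂)`. -/
def pairE2 : Ref × Ref := (![0, 1, 0], ![0, 1, 0])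

/-! ### Common vertex -/

/-- `𝒟₁(η)`, `𝒟₂(η)` for a common vertex. -/
def vertexMap (η : Fin 5 → ℝ) : Fin 2 → Ref × Ref :=
  ![(![1, η 0 * η 1, η 0 * (1 - η 1)],
      ![η 2, η 2 * η 3 * η 4, η 2 * η 3 * (1 - η 4)]),
    (![η 2, η 2 * η 3 * η 4, η 2 * η 3 * (1 - η 4)],
      ![1, η 0 * η 1, η 0 * (1 - η 1)])]

/-- `det 𝒥(η) = η₁ η₃² η₄`. -/
def vertexJac (η : Fin 5 → ℝ) : ℝ := η 0 * η 2 ^ 2 * η 3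

/-- `𝒟_m(ξ, η) = ξ 𝒟_m(η)`. -/
def vertexMapFull (ξ : ℝ) (η : Fin 5 → ℝ) (m : Fin 2) : Ref × Ref := ξ • vertexMap η m

/-- `det 𝒥(ξ, η) = ξ⁵ det 𝒥(η)`. -/
def vertexJacFull (ξ : ℝ) (η : Fin 5 → ℝ) : ℝ := ξ ^ 5 * vertexJac η

/-- The reduced integrand `k̃_{1,V}` built from `k = k̃₁`. -/
def kV (k : Ref × Ref → ℝ) (η : Fin 5 → ℝ) : ℝ :=
  (k (vertexMap η 0) + k (vertexMap η 1)) * vertexJac η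

/-! ### Common edge -/

/-- `𝒟₁(η)`, `𝒟₂(η)` for a common edge. -/
def edgeHalf (η : Fin 4 → ℝ) : Fin 2 → Ref × Ref :=
  ![(![0, η 0, 1 - η 0],
      ![-(η 1 * η 2 * η 3), η 1 * η 2 * (1 - η 3), η 1 * (1 - η 2)]),
    (![0, η 2 * η 3, η 2 * (1 - η 3)],
      ![-(η 0 * η 1), η 0 * (1 - η 1), 1 - η 0])]

/-- `𝒟₁(η), …, 𝒟₄(η)` with `𝒟₃ = 𝒟₁ᵀ`, `𝒟₄ = 𝒟₂ᵀ`. -/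
def edgeMap (η : Fin 4 → ℝ) : Fin 4 → Ref × Ref :=
  ![edgeHalf η 0, edgeHalf η 1, (edgeHalf η 0).swap, (edgeHalf η 1).swap]

/-- `det 𝒥_m(η)`: `η₂² η₃` for `m = 1, 3` and `η₁ η₃` for `m = 2, 4`. -/
def edgeJac (η : Fin 4 → ℝ) : Fin 4 → ℝ :=
  ![η 1 ^ 2 * η 2, η 0 * η 2, η 1 ^ 2 * η 2, η 0 * η 2]

/-- `𝒟_m(ξ, η) = ξ₁ (e₁, e₁) + ξ₁ ξ₂ 𝒟_m(η)`. -/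
def edgeMapFull (ξ : Fin 2 → ℝ) (η : Fin 4 → ℝ) (m : Fin 4) : Ref × Ref :=
  ξ 0 • pairE1 + (ξ 0 * ξ 1) • edgeMap η m

/-- `det 𝒥_m(ξ, η) = ξ₁⁵ ξ₂⁴ det 𝒥_m(η)`. -/
def edgeJacFull (ξ : Fin 2 → ℝ) (η : Fin 4 → ℝ) (m : Fin 4) : ℝ :=
  ξ 0 ^ 5 * ξ 1 ^ 4 * edgeJac η m

/-- The reduced integrand `k̃_{1,E}` built from `k = k̃₁`. -/
def kE (k : Ref × Ref → ℝ) (η : Fin 4 → ℝ) : ℝ :=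
  ∑ m : Fin 4, k (edgeMap η m) * edgeJac η m

/-! ### Common face -/

/-- `𝒟₁(η), …, 𝒟₇(η)` for a common face. -/
def faceHalf (η : Fin 3 → ℝ) : Fin 7 → Ref × Ref :=
  ![(![0, η 0, 1 - η 0],
      ![-(η 0 * η 1 * η 2), 0, η 0 * η 1 * (1 - η 2)]),
    (![0, η 0 * η 1, η 0 * (1 - η 1)],
      ![-(η 0 * η 1 * η 2), 0, 1 - η 0 * η 1 * η 2]),
    (![0, η 0 * η 1, 1 - η 0 * η 1],
      ![-(η 0 * η 1 * η 2), 0, η 0 * (1 - η 1 * η 2)]),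
    (![0, η 0 * η 1 * η 2, η 0 * η 1 * (1 - η 2)],
      ![-(η 0), 0, 1 - η 0]),
    (![0, η 0 * η 1 * η 2, η 0 * (1 - η 1 * η 2)],
      ![-(η 0 * η 1), 0, 1 - η 0 * η 1]),
    (![0, η 0 * η 1 * η 2, 1 - η 0 * η 1 * η 2],
      ![-(η 0 * η 1), 0, η 0 * (1 - η 1)]),
    (![0, 0, 1],
      ![-(η 0 * η 1 * η 2), η 0 * η 1 * (1 - η 2), η 0 * (1 - η 1)])]

/-- `𝒟₁(η), …, 𝒟₁₇(η)` with `𝒟_{7+i} = 𝒟_iᵀ` for `i = 1, …, 7`. -/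
def faceMap (η : Fin 3 → ℝ) : Fin 17 → Ref × Ref :=
  ![faceHalf η 0, faceHalf η 1, faceHalf η 2, faceHalf η 3, faceHalf η 4, faceHalf η 5,
    faceHalf η 6,
    (faceHalf η 0).swap, (faceHalf η 1).swap, (faceHalf η 2).swap, (faceHalf η 3).swap,
    (faceHalf η 4).swap, (faceHalf η 5).swap, (faceHalf η 6).swap,
    (![-(η 0 * η 1 * η 2), η 0 * η 1 * (1 - η 2), 1 - η 0 * η 1], ![0, 0, η 0]),
    (![0, 0, η 2], ![-(η 0 * η 1), η 0 * (1 - η 1), 1 - η 0]),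
    (![-(η 0 * η 1), η 0 * (1 - η 1), 1 - η 0], ![0, 0, η 0 * η 2])]

/-- `det 𝒥_m(η)`: `η₁² η₂` for `m ≤ 15`, `η₁` for `m = 16`, `η₁²` for `m = 17`. -/
def faceJac (η : Fin 3 → ℝ) (m : Fin 17) : ℝ :=
  if m = 15 then η 0 else if m = 16 then η 0 ^ 2 else η 0 ^ 2 * η 1

/-- `𝒟_m(ξ, η) = ξ₁ (e₁, e₁) + ξ₁ (1 - ξ₂) (e₂, e₂) + ξ₁ ξ₂ ξ₃ 𝒟_m(η)`. -/
def faceMapFull (ξ : Fin 3 → ℝ) (η : Fin 3 → ℝ) (m : Fin 17) : Ref × Ref :=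
  ξ 0 • pairE1 + (ξ 0 * (1 - ξ 1)) • pairE2 + (ξ 0 * ξ 1 * ξ 2) • faceMap η m

/-- `det 𝒥_m(ξ, η) = ξ₁⁵ ξ₂⁴ ξ₃³ det 𝒥_m(η)`. -/
def faceJacFull (ξ : Fin 3 → ℝ) (η : Fin 3 → ℝ) (m : Fin 17) : ℝ :=
  ξ 0 ^ 5 * ξ 1 ^ 4 * ξ 2 ^ 3 * faceJac η m

/-- The reduced integrand `k̃_{1,F}` built from `k = k̃₁`. -/
def kF (k : Ref × Ref → ℝ) (η : Fin 3 → ℝ) : ℝ :=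
  ∑ m : Fin 17, k (faceMap η m) * faceJac η m

/-! ### Identical tetrahedra -/

/-- `𝒟₁(η), …, 𝒟₉(η)` for identical tetrahedra. -/
def tetraHalf (η : Fin 2 → ℝ) : Fin 9 → Ref × Ref :=
  ![(![0, η 0, -(η 0)], ![-(η 0 * η 1), 0, -1]),
    (![0, 1, 0], ![-(η 0 * η 1), 0, η 0 * (1 - η 1)]),
    (![0, η 0, -1], ![-(η 0 * η 1), 0, -(η 0 * η 1)]),
    (![0, η 0 * η 1, -(η 0 * η 1)], ![-(η 0), 0, -1]),
    (![0, η 0 * η 1, η 0 * (1 - η 1)], ![-1, 0, 0]),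
    (![0, η 0 * η 1, -1], ![-(η 0), 0, -(η 0)]),
    (![0, 0, 0], ![-(η 0 * η 1), η 0 * (1 - η 1), -1]),
    (![0, 0, -1], ![-(η 0 * η 1), η 0 * (1 - η 1), -(η 0)]),
    (![0, 0, η 0], ![-(η 1), 1 - η 1, 0])]

/-- `𝒟₁(η), …, 𝒟₁₈(η)`, indexed by `(false, m)` for `𝒟_m` and `(true, m)` for `𝒟_{m+9} = 𝒟_mᵀ`,
`m = 1, …, 9`. -/
def tetraMap (η : Fin 2 → ℝ) (i : Bool × Fin 9) : Ref × Ref :=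
  if i.1 then (tetraHalf η i.2).swap else tetraHalf η i.2

/-- `det 𝒥_m(η) = det 𝒥_{m+9}(η)`: `η₁` for `m ≤ 8` and `1` for `m = 9`. -/
def tetraJac (η : Fin 2 → ℝ) (m : Fin 9) : ℝ := if m = 8 then 1 else η 0

/-- `𝒟_m(ξ, η) = ξ₁ ξ₂ ξ₃ ξ₄ 𝒟_m(η)`. The translation common to both components is left out,
`k̃₁` being invariant under it when `t₁ = t₂`. -/
def tetraMapFull (ξ : Fin 4 → ℝ) (η : Fin 2 → ℝ) (i : Bool × Fin 9) : Ref × Ref :=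
  (ξ 0 * ξ 1 * ξ 2 * ξ 3) • tetraMap η i

/-- `det 𝒥_m(ξ, η) = ξ₁⁵ ξ₂⁴ ξ₃³ ξ₄² det 𝒥_m(η)`. -/
def tetraJacFull (ξ : Fin 4 → ℝ) (η : Fin 2 → ℝ) (i : Bool × Fin 9) : ℝ :=
  ξ 0 ^ 5 * ξ 1 ^ 4 * ξ 2 ^ 3 * ξ 3 ^ 2 * tetraJac η i.2

/-- The reduced integrand `k̃_{1,T}` built from `k = k̃₁`. -/
def kT (k : Ref × Ref → ℝ) (η : Fin 2 → ℝ) : ℝ :=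
  ∑ m : Fin 9, k (tetraHalf η m) * tetraJac η m

/-! After the affine substitution `Tet.chi` in both arguments, the integral lives on `refTet ×ˢ
refTet`, a polytope of volume `1/36` in dimension six. In every configuration this polytope is cut
into pieces. Each piece is the image of the unit cube under a monomial (Duffy) map attached to a
rooted tree, followed by a unimodular integer matrix.

Neither injectivity of these maps nor disjointness of the pieces is proved. The push-forward of the
Jacobian density under each map dominates Lebesgue measure on the image, so for a covering the sum
of the push-forwards dominates Lebesgue measure on the polytope. The Jacobians are monomials, whose
integrals are reciprocals of integers; their sum is `1/36`, which does not exceed the volume. A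
finite measure that is dominated by another and has at least its mass equals it
(`restrict_eq_sum_map_withDensity`). What remains is that the pieces cover, a case distinction on
linear inequalities between the coordinates of the two points, and the sum of the volumes
(`integrableOn_and_setIntegral_of_pieces`).

On a piece the variables separate. If the first vertices agree, `kTilde` is a product of two linear
forms divided by the norm of a linear map to the power `3 + 2s`, hence homogeneous of degree `-1 -
2s` (`Compatible.kTilde_smul`). It is invariant under simultaneous translation of both points along
the common simplex (`Compatible.kTilde_add`). With the Jacobian this leaves a product of the powers
`ξ_j ^ (4 - j - 2s)`, `j` counted from `0`, times the reduced integrand in `η`. The powers integrate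
to `1 / (5 - j - 2s)`; the extreme exponent `1 - 2s` exceeds `-1` exactly when `s < 1`.

The reduced integrand is analytic because its denominator has no zero on the closed cube. For two
tetrahedra meeting in a common simplex, a zero would give a pair of reference points with the same
image, hence a coinciding pair in the common simplex, and the explicit maps exclude this
(`Separated.diffMap_ne_zero`). For a single tetrahedron it suffices that the two points differ. -/

/-! ### Change of variables by a covering of the right total mass -/

section Covering

variable {E : Type*} [NormedAddCommGroup E] [NormedSpace ℝ E] [FiniteDimensional ℝ E]
  [MeasurableSpace E] [BorelSpace E] (μ : Measure E) [μ.IsAddHaarMeasure]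

/-- The push-forward under `F` of `|det F'| μ` on `s` dominates `μ` on the image `F '' s`;
injectivity of `F` is not needed. -/
theorem restrict_image_le_map_withDensity {F : E → E} {F' : E → E →L[ℝ] E} {s : Set E}
    (hs : MeasurableSet s) (hF : ∀ x, HasFDerivAt F (F' x) x) :
    μ.restrict (F '' s) ≤
      ((μ.restrict s).withDensity fun x => ENNReal.ofReal |(F' x).det|).map F := by
  have hFm : Measurable F :=
    (continuous_iff_continuousAt.2 fun x => (hF x).continuousAt).measurable
  refine Measure.le_iff.2 fun B hB => ?_
  rw [Measure.restrict_apply hB, Measure.map_apply hFm hB, withDensity_apply _ (hFm hB),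
    Measure.restrict_restrict (hFm hB)]
  have h : B ∩ F '' s = F '' (F ⁻¹' B ∩ s) := by
    rw [inter_comm, inter_comm _ s, image_inter_preimage]
  rw [h]
  -- The bound of the measure of an image by the integral of the Jacobian holds with multiplicity,
  -- so overlaps of `F` only help.
  exact addHaar_image_le_lintegral_abs_det_fderiv μ ((hFm hB).inter hs)
    fun x _ => (hF x).hasFDerivWithinAt

/-- If the images of `s` under finitely many maps cover `S`, and the total mass of the Jacobians
is at most the measure of `S`, then the pieces reproduce the measure on `S`. -/
theorem restrict_eq_sum_map_withDensity {ι : Type*} [Fintype ι] {F : ι → E → E}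
    {F' : ι → E → E →L[ℝ] E} {s S : Set E} (hs : MeasurableSet s)
    (hF : ∀ i x, HasFDerivAt (F i) (F' i x) x) (hS : μ S ≠ ⊤)
    (hcover : S ⊆ ⋃ i, F i '' s)
    (hmass : ∑ i, ∫⁻ x in s, ENNReal.ofReal |(F' i x).det| ∂μ ≤ μ S) :
    μ.restrict S =
      ∑ i, ((μ.restrict s).withDensity fun x => ENNReal.ofReal |(F' i x).det|).map (F i) := by
  have hFm (i : ι) : Measurable (F i) :=
    (continuous_iff_continuousAt.2 fun x => (hF i x).continuousAt).measurable
  have : IsFiniteMeasure (μ.restrict S) := ⟨by simpa using hS.lt_top⟩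
  have hle : μ.restrict S ≤
      ∑ i, ((μ.restrict s).withDensity fun x => ENNReal.ofReal |(F' i x).det|).map (F i) := by
    refine (Measure.restrict_mono hcover le_rfl).trans ?_
    refine (Measure.restrict_iUnion_le).trans ?_
    rw [Measure.sum_fintype]
    exact Finset.sum_le_sum fun i _ => restrict_image_le_map_withDensity μ hs (hF i)
  -- One measure dominates the other and the masses agree. Overlaps, and parts of the images outside
  -- `S`, are therefore null a posteriori.
  refine Measure.eq_of_le_of_measure_univ_eq hle (le_antisymm (hle univ) ?_)
  rw [Measure.finsetSum_apply, Measure.restrict_apply_univ]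
  refine le_trans (le_of_eq (Finset.sum_congr rfl fun i _ => ?_)) hmass
  rw [Measure.map_apply (hFm i) .univ, preimage_univ, withDensity_apply _ .univ,
    Measure.restrict_univ]

/-- Change of variables for integrals, read off from the identity of measures. `J` is a formula for
the Jacobian that need only be right on `s`; outside, it may even be negative, which is why
`toNNReal` appears in the density. -/
theorem integrableOn_and_setIntegral_eq_sum {ι : Type*} [Fintype ι] {F : ι → E → E}
    {F' : ι → E → E →L[ℝ] E} {s S : Set E} {J : ι → E → ℝ} (hs : MeasurableSet s)
    (hF : ∀ i x, HasFDerivAt (F i) (F' i x) x) (hS : μ S ≠ ⊤)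
    (hcover : S ⊆ ⋃ i, F i '' s)
    (hmass : ∑ i, ∫⁻ x in s, ENNReal.ofReal |(F' i x).det| ∂μ ≤ μ S)
    (hJ : ∀ i, ∀ x ∈ s, |(F' i x).det| = J i x) (hJm : ∀ i, Measurable (J i))
    {f : E → ℝ} (hf : Measurable f) (hint : ∀ i, IntegrableOn (fun x => f (F i x) * J i x) s μ) :
    IntegrableOn f S μ ∧ ∫ x in S, f x ∂μ = ∑ i, ∫ x in s, f (F i x) * J i x ∂μ := by
  have hFm (i : ι) : Measurable (F i) :=
    (continuous_iff_continuousAt.2 fun x => (hF i x).continuousAt).measurable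
  have hd (i : ι) : (μ.restrict s).withDensity (fun x => ENNReal.ofReal |(F' i x).det|) =
      (μ.restrict s).withDensity (fun x => ((J i x).toNNReal : ENNReal)) := by
    refine withDensity_congr_ae ?_
    filter_upwards [ae_restrict_mem hs] with x hx
    rw [hJ i x hx]; rfl
  have hJn (i : ι) : Measurable fun x => (J i x).toNNReal := (hJm i).real_toNNReal
  have heq : (fun i => fun x => (J i x).toNNReal • f (F i x)) =
      fun i => fun x => ((J i x).toNNReal : ℝ) * f (F i x) := rfl
  have hae (i : ι) : (fun x => (J i x).toNNReal • f (F i x)) =ᵐ[μ.restrict s]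
      fun x => f (F i x) * J i x := by
    filter_upwards [ae_restrict_mem hs] with x hx
    have h0 : 0 ≤ J i x := by rw [← hJ i x hx]; positivity
    rw [NNReal.smul_def, Real.coe_toNNReal _ h0, smul_eq_mul, mul_comm]
  have hi (i : ι) : Integrable f
      (((μ.restrict s).withDensity fun x => ENNReal.ofReal |(F' i x).det|).map (F i)) := by
    rw [integrable_map_measure hf.aestronglyMeasurable (hFm i).aemeasurable, hd i,
      integrable_withDensity_iff_integrable_smul (hJn i)]
    exact (integrable_congr (hae i)).2 (hint i)
  rw [IntegrableOn, restrict_eq_sum_map_withDensity μ hs hF hS hcover hmass]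
  refine ⟨integrable_finsetSum_measure.2 fun i _ => hi i, ?_⟩
  rw [integral_finsetSum_measure fun i _ => hi i]
  refine Finset.sum_congr rfl fun i _ => ?_
  rw [integral_map (hFm i).aemeasurable hf.aestronglyMeasurable, hd i,
    integral_withDensity_eq_integral_smul (hJn i)]
  exact integral_congr_ae (hae i)

end Covering

/-! ### Monomial maps along a tree -/

/-- A rooted tree on `Fin n` with root `0` in which every vertex is larger than its parent:
`parent` gives the parent of a vertex, `anc` the set of its strict ancestors. -/
structure DuffyTree (n : ℕ) [NeZero n] where
  parent : Fin n → Fin n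
  anc : Fin n → Finset (Fin n)
  parent_lt : ∀ i, i ≠ 0 → parent i < i
  anc_zero : anc 0 = ∅
  anc_eq : ∀ i, i ≠ 0 → anc i = insert (parent i) (anc (parent i))
  anc_lt : ∀ i, ∀ j ∈ anc i, j < i

namespace DuffyTree

variable {n : ℕ} [NeZero n] (τ : DuffyTree n)

/-- The Duffy map `t ↦ (t_i ∏_{j ancestor of i} t_j)_i`. -/
def map (t : Fin n → ℝ) (i : Fin n) : ℝ := t i * ∏ j ∈ τ.anc i, t j

/-- The Jacobian of the Duffy map. -/
def jac (t : Fin n → ℝ) : ℝ := ∏ i, ∏ j ∈ τ.anc i, t j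

/-- The exponent of `t_j` in the Jacobian: the number of strict descendants of `j`. -/
def expo (j : Fin n) : ℕ := (Finset.univ.filter fun i => j ∈ τ.anc i).card

/-- The image of the unit cube: every coordinate is at most the one of its parent. -/
def region : Set (Fin n → ℝ) := {w | w 0 ≤ 1 ∧ (∀ i, 0 ≤ w i) ∧ ∀ i, i ≠ 0 → w i ≤ w (τ.parent i)}

/-- Double counting of the pairs (vertex, strict ancestor). -/
theorem jac_eq_prod_pow (t : Fin n → ℝ) : τ.jac t = ∏ j, t j ^ τ.expo j := by
  simp only [jac, expo, ← Finset.prod_const, Finset.prod_filter]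
  rw [Finset.prod_comm]
  refine Finset.prod_congr rfl fun i _ => ?_
  rw [← Finset.prod_filter]
  simp

theorem map_of_ne_zero (t : Fin n → ℝ) {i : Fin n} (hi : i ≠ 0) :
    τ.map t i = t i * τ.map t (τ.parent i) := by
  have h : τ.parent i ∉ τ.anc (τ.parent i) := fun h => lt_irrefl _ (τ.anc_lt _ _ h)
  rw [map, τ.anc_eq i hi, Finset.prod_insert h, map]

theorem map_zero (t : Fin n → ℝ) : τ.map t 0 = t 0 := by simp [map, τ.anc_zero]

theorem region_subset : τ.region ⊆ τ.map '' Icc 0 1 := by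
  rintro w ⟨h1, h0, hw⟩
  -- The preimage consists of the ratios of each coordinate to that of its parent.
  refine ⟨fun i => if i = 0 then w 0 else w i / w (τ.parent i), ⟨fun i => ?_, fun i => ?_⟩, ?_⟩
  · dsimp only [Pi.zero_apply]
    split_ifs
    exacts [h0 0, div_nonneg (h0 _) (h0 _)]
  · dsimp only [Pi.one_apply]
    split_ifs with hi
    exacts [h1, div_le_one_of_le₀ (hw i hi) (h0 _)]
  · ext i
    induction i using WellFoundedLT.induction with
    | ind i ih =>
      by_cases hi : i = 0
      · subst hi; simp [map_zero]
      · rw [map_of_ne_zero _ _ hi, ih _ (τ.parent_lt i hi), if_neg hi]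
        -- Where the parent vanishes the ratio is meaningless, but `w i` is squeezed to zero as
        -- well, so any value would do.
        rcases eq_or_ne (w (τ.parent i)) 0 with h | h
        · rw [h, mul_zero]
          exact (le_antisymm (h ▸ hw i hi) (h0 i)).symm
        · field_simp

/-- The matrix of the derivative of the Duffy map. -/
def derivMatrix (t : Fin n → ℝ) : Matrix (Fin n) (Fin n) ℝ :=
  Matrix.of fun i j => if j ∈ insert i (τ.anc i) then ∏ k ∈ (insert i (τ.anc i)).erase j, t k else 0

theorem hasFDerivAt_map (t : Fin n → ℝ) :
    HasFDerivAt τ.map (LinearMap.toContinuousLinearMap (Matrix.toLin' (τ.derivMatrix t))) t := by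
  rw [hasFDerivAt_pi']
  intro i
  have hi : i ∉ τ.anc i := fun h => lt_irrefl _ (τ.anc_lt _ _ h)
  have h := hasFDerivAt_finsetProd (𝕜 := ℝ) (u := insert i (τ.anc i)) (x := t)
  have he : (fun x => τ.map x i) = fun x => ∏ k ∈ insert i (τ.anc i), x k := by
    ext x
    rw [Finset.prod_insert hi, map]
  rw [he]
  refine h.congr_fderiv ?_
  ext v
  simp [derivMatrix, Matrix.mulVec, dotProduct,
    -Finset.mem_insert]

/-- Ancestors have smaller index, so the matrix is lower triangular; its diagonal entry at `i` is
the product of the variables over the strict ancestors of `i`. -/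
theorem det_derivMatrix (t : Fin n → ℝ) : (τ.derivMatrix t).det = τ.jac t := by
  rw [Matrix.det_of_isLowerTriangular]
  · refine Finset.prod_congr rfl fun i _ => ?_
    have hi : i ∉ τ.anc i := fun h => lt_irrefl _ (τ.anc_lt _ _ h)
    simp [derivMatrix, Finset.erase_insert hi]
  · intro i j hij
    have hij : i < j := hij
    simp only [derivMatrix, Matrix.of_apply, Finset.mem_insert]
    rw [if_neg]
    rintro (h | h)
    exacts [hij.ne' h, lt_asymm hij (τ.anc_lt _ _ h)]

theorem jac_nonneg {t : Fin n → ℝ} (ht : t ∈ Icc 0 1) : 0 ≤ τ.jac t :=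
  Finset.prod_nonneg fun _ _ => Finset.prod_nonneg fun j _ => ht.1 j

theorem continuous_jac : Continuous τ.jac := by
  unfold jac; fun_prop

end DuffyTree

/-! ### Integrals of products of powers over the unit cube -/

theorem volume_restrict_Icc_pi {n : ℕ} :
    (volume : Measure (Fin n → ℝ)).restrict (Icc 0 1) =
      Measure.pi fun _ => (volume : Measure ℝ).restrict (Icc 0 1) := by
  rw [← pi_univ_Icc, volume_pi]
  exact Measure.restrict_pi_pi _ _

theorem integrableOn_rpow_Icc {c : ℝ} (hc : -1 < c) :
    IntegrableOn (fun x : ℝ => x ^ c) (Icc 0 1) := by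
  rw [integrableOn_Icc_iff_integrableOn_Ioc, ← intervalIntegrable_iff_integrableOn_Ioc_of_le
    zero_le_one]
  exact intervalIntegral.intervalIntegrable_rpow' hc

theorem setIntegral_rpow_Icc {c : ℝ} (hc : -1 < c) :
    ∫ x in Icc (0 : ℝ) 1, x ^ c = 1 / (c + 1) := by
  rw [integral_Icc_eq_integral_Ioc, ← intervalIntegral.integral_of_le zero_le_one,
    integral_rpow (Or.inl hc), Real.one_rpow, Real.zero_rpow (by linarith), sub_zero]

theorem integrableOn_prod_rpow {n : ℕ} {c : Fin n → ℝ} (hc : ∀ i, -1 < c i) :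
    IntegrableOn (fun x : Fin n → ℝ => ∏ i, x i ^ c i) (Icc 0 1) := by
  rw [IntegrableOn, volume_restrict_Icc_pi]
  exact Integrable.fintype_prod (f := fun i x => x ^ c i) fun i => integrableOn_rpow_Icc (hc i)

theorem setIntegral_prod_rpow {n : ℕ} {c : Fin n → ℝ} (hc : ∀ i, -1 < c i) :
    ∫ x in Icc (0 : Fin n → ℝ) 1, ∏ i, x i ^ c i = ∏ i, 1 / (c i + 1) := by
  rw [volume_restrict_Icc_pi, integral_fintype_prod_eq_prod fun i (x : ℝ) => x ^ c i]
  exact Finset.prod_congr rfl fun i _ => setIntegral_rpow_Icc (hc i)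

/-- The volume of a piece, counted with multiplicity. It depends only on the numbers of descendants,
and unimodular matrices do not change it. -/
theorem DuffyTree.lintegral_jac {n : ℕ} [NeZero n] (τ : DuffyTree n) :
    ∫⁻ t in Icc (0 : Fin n → ℝ) 1, ENNReal.ofReal (τ.jac t) =
      ENNReal.ofReal (1 / ∏ j, ((τ.expo j : ℝ) + 1)) := by
  have hc (i : Fin n) : (-1 : ℝ) < τ.expo i := by
    have : (0 : ℝ) ≤ τ.expo i := by positivity
    linarith
  rw [← ofReal_integral_eq_lintegral_ofReal
    (τ.continuous_jac.continuousOn.integrableOn_compact isCompact_Icc)]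
  · congr 1
    simp only [jac_eq_prod_pow, ← Real.rpow_natCast]
    rw [setIntegral_prod_rpow hc]
    simp [Finset.prod_inv_distrib]
  · filter_upwards [ae_restrict_mem measurableSet_Icc] with t ht using τ.jac_nonneg ht

/-! ### Concatenation of coordinates -/

/-- Concatenation of coordinate vectors as a measurable equivalence. -/
def appendMeasurableEquiv (m n : ℕ) : (Fin m → ℝ) × (Fin n → ℝ) ≃ᵐ (Fin (m + n) → ℝ) where
  toEquiv := Fin.appendEquiv m n
  measurable_toFun := by
    refine measurable_pi_lambda _ fun i => ?_
    refine Fin.addCases (fun j => ?_) (fun j => ?_) i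
    · simpa [Fin.appendEquiv] using measurable_pi_iff.1 measurable_fst j
    · simpa [Fin.appendEquiv] using measurable_pi_iff.1 measurable_snd j
  measurable_invFun := by
    refine Measurable.prodMk ?_ ?_ <;>
    exact measurable_pi_lambda _ fun i => measurable_pi_apply _

theorem appendMeasurableEquiv_apply (m n : ℕ) (p : (Fin m → ℝ) × (Fin n → ℝ)) :
    appendMeasurableEquiv m n p = Fin.append p.1 p.2 := rfl

theorem measurePreserving_append (m n : ℕ) : MeasurePreserving (appendMeasurableEquiv m n) := by
  refine ⟨(appendMeasurableEquiv m n).measurable, (Measure.pi_eq fun s _ => ?_).symm⟩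
  rw [(appendMeasurableEquiv m n).map_apply]
  have h : appendMeasurableEquiv m n ⁻¹' univ.pi s =
      (univ.pi fun i => s (Fin.castAdd n i)) ×ˢ (univ.pi fun i => s (Fin.natAdd m i)) := by
    ext p
    simp [appendMeasurableEquiv_apply, Fin.forall_fin_add]
  rw [h, Measure.volume_eq_prod, Measure.prod_prod, volume_pi, volume_pi, Measure.pi_pi,
    Measure.pi_pi, Fin.prod_univ_add]

theorem append_preimage_Icc (m n : ℕ) :
    appendMeasurableEquiv m n ⁻¹' Icc 0 1 = Icc (0 : Fin m → ℝ) 1 ×ˢ Icc (0 : Fin n → ℝ) 1 := by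
  ext p
  simp only [mem_preimage, mem_prod, mem_Icc, Pi.le_def, Fin.forall_fin_add,
    appendMeasurableEquiv_apply, Fin.append_left, Fin.append_right, Pi.zero_apply, Pi.one_apply]
  tauto

/-! ### The reference tetrahedron -/

/-- The closed reference tetrahedron. -/
def refTet : Set Ref := {x | 0 ≤ x 1 ∧ 0 ≤ x 2 ∧ x 1 + x 2 ≤ x 0 ∧ x 0 ≤ 1}

theorem refTet_subset_Icc : refTet ⊆ Icc 0 1 := by
  rintro x ⟨h1, h2, h3, h4⟩
  constructor <;> intro i <;> fin_cases i <;> simp <;> linarith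

theorem isClosed_refTet : IsClosed refTet := by
  refine (isClosed_le continuous_const (continuous_apply 1)).inter
    ((isClosed_le continuous_const (continuous_apply 2)).inter
    ((isClosed_le ?_ (continuous_apply 0)).inter (isClosed_le (continuous_apply 0) ?_))) <;>
  fun_prop

/-- The six coordinate permutations of the ordered simplex cover the cube. Only this lower bound is
needed, so nothing is said about overlaps. -/
theorem one_le_six_mul_volume_monotone :
    1 ≤ 6 * volume {u : Fin 3 → ℝ | u ∈ Icc 0 1 ∧ Monotone u} := by
  set O := {u : Fin 3 → ℝ | u ∈ Icc 0 1 ∧ Monotone u}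
  have hcov : Icc (0 : Fin 3 → ℝ) 1 ⊆
      ⋃ σ : Equiv.Perm (Fin 3), MeasurableEquiv.piCongrLeft (fun _ => ℝ) σ ⁻¹' O := by
    intro p hp
    -- The permutation that sorts the coordinates brings `p` into the ordered simplex.
    refine mem_iUnion.2 ⟨(Tuple.sort p).symm, ?_⟩
    have h : MeasurableEquiv.piCongrLeft (fun _ => ℝ) (Tuple.sort p).symm p =
        p ∘ Tuple.sort p := by
      ext i
      rw [MeasurableEquiv.coe_piCongrLeft, Equiv.piCongrLeft_apply]
      simp
    rw [mem_preimage, h]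
    exact ⟨⟨fun i => hp.1 (Tuple.sort p i), fun i => hp.2 (Tuple.sort p i)⟩, Tuple.monotone_sort p⟩
  calc (1 : ENNReal) = volume (Icc (0 : Fin 3 → ℝ) 1) := by
        rw [← pi_univ_Icc, volume_pi_pi]; simp
    _ ≤ ∑ σ : Equiv.Perm (Fin 3), volume (MeasurableEquiv.piCongrLeft (fun _ => ℝ) σ ⁻¹' O) :=
        (measure_mono hcov).trans (measure_iUnion_fintype_le _ _)
    _ = ∑ σ : Equiv.Perm (Fin 3), volume O := by
        refine Finset.sum_congr rfl fun σ _ => ?_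
        exact (volume_measurePreserving_piCongrLeft (fun _ => ℝ) σ).measure_preimage_equiv O
    _ = 6 * volume O := by
        rw [Finset.sum_const, Finset.card_univ, Fintype.card_perm]
        simp [Nat.factorial]

/-- The map `u ↦ (u₂, u₀, u₁ - u₀)`, indices from `0`, has determinant one and sends the ordered
simplex into `refTet`. -/
theorem one_le_six_mul_volume_refTet : 1 ≤ 6 * volume refTet := by
  refine one_le_six_mul_volume_monotone.trans (mul_le_mul' le_rfl ?_)
  let L : Matrix (Fin 3) (Fin 3) ℝ := !![0, 0, 1; 1, 0, 0; -1, 1, 0]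
  have hdet : L.det = 1 := by simp [L, Matrix.det_fin_three]
  have h := Measure.addHaar_image_linearMap volume (Matrix.toLin' L)
    {u : Fin 3 → ℝ | u ∈ Icc 0 1 ∧ Monotone u}
  rw [LinearMap.det_toLin', hdet, abs_one, ENNReal.ofReal_one, one_mul] at h
  rw [← h]
  refine measure_mono ?_
  rintro _ ⟨u, ⟨⟨h0, h1⟩, hm⟩, rfl⟩
  have h01 := hm (show (0 : Fin 3) ≤ 1 by decide)
  have h12 := hm (show (1 : Fin 3) ≤ 2 by decide)
  have := h0 0
  have := h1 2
  simp only [Pi.zero_apply, Pi.one_apply] at *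
  simp only [refTet, L, Matrix.toLin'_apply, mem_ofPred_eq, Matrix.mulVec, dotProduct,
    Fin.sum_univ_three, Matrix.of_apply, Matrix.cons_val_zero, Matrix.cons_val_one,
    Matrix.cons_val]
  refine ⟨?_, ?_, ?_, ?_⟩ <;> linarith

/-- The product of two reference tetrahedra, in concatenated coordinates. -/
def refTetProd : Set (Fin 6 → ℝ) := (appendMeasurableEquiv 3 3).symm ⁻¹' (refTet ×ˢ refTet)

theorem volume_refTetProd : volume refTetProd = volume refTet * volume refTet := by
  rw [refTetProd, (measurePreserving_append 3 3).symm.measure_preimage_equiv,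
    Measure.volume_eq_prod, Measure.prod_prod]

theorem volume_refTetProd_ne_top : volume refTetProd ≠ ⊤ := by
  have h : volume refTet ≠ ⊤ :=
    ((measure_mono refTet_subset_Icc).trans_lt isCompact_Icc.measure_lt_top).ne
  rw [volume_refTetProd]
  exact ENNReal.mul_ne_top h h

/-- The covering argument needs only this side of the volume: the mass of the pieces must not exceed
that of the product. -/
theorem ofReal_le_volume_refTetProd : ENNReal.ofReal (1 / 36) ≤ volume refTetProd := by
  have h6 : ENNReal.ofReal (1 / 6) ≤ volume refTet := by
    have h := one_le_six_mul_volume_refTet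
    rw [one_div, ENNReal.ofReal_inv_of_pos (by norm_num)]
    rw [ENNReal.inv_le_iff_le_mul (by simp) (by simp)]
    simpa [mul_comm] using h
  rw [volume_refTetProd, show (1 / 36 : ℝ) = 1 / 6 * (1 / 6) by norm_num,
    ENNReal.ofReal_mul (by norm_num)]
  gcongr

/-! ### Pieces: unimodular images of Duffy maps -/

/-- A Duffy map in dimension six followed by an integer matrix `A` with inverse `B`. -/
structure DuffyPiece where
  tree : DuffyTree 6
  A : Matrix (Fin 6) (Fin 6) ℤ
  B : Matrix (Fin 6) (Fin 6) ℤ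
  mul_eq_one : A * B = 1

namespace DuffyPiece

variable (P : DuffyPiece)

/-- The parametrization of the piece by the unit cube, in concatenated coordinates. -/
def map (t : Fin 6 → ℝ) : Fin 6 → ℝ := (P.A.map (Int.castRingHom ℝ)).mulVec (P.tree.map t)

/-- The parametrization of the piece by the unit cube, with values in pairs of points. -/
def toRef (t : Fin 6 → ℝ) : Ref × Ref := (appendMeasurableEquiv 3 3).symm (P.map t)

/-- The piece with the roles of the two points exchanged. -/
def swap : DuffyPiece where
  tree := P.tree
  -- Addition of `3` modulo `6` exchanges the two blocks of three coordinates.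
  A := P.A.submatrix (Equiv.addRight 3) id
  B := P.B.submatrix id (Equiv.addRight 3)
  mul_eq_one := by
    rw [← Matrix.submatrix_mul P.A P.B (Equiv.addRight 3) id (Equiv.addRight 3)
      Function.bijective_id, P.mul_eq_one, Matrix.submatrix_one_equiv]

theorem swap_toRef (t : Fin 6 → ℝ) : P.swap.toRef t = (P.toRef t).swap := by
  refine Prod.ext ?_ ?_ <;> ext i <;> fin_cases i <;> rfl

/-- An integer matrix with an integer inverse has a unit of `ℤ` as determinant. -/
theorem abs_det : |(P.A.map (Int.castRingHom ℝ)).det| = 1 := by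
  have h : IsUnit P.A.det :=
    IsUnit.of_mul_eq_one P.B.det (by rw [← Matrix.det_mul, P.mul_eq_one, Matrix.det_one])
  rw [← RingHom.mapMatrix_apply, ← RingHom.map_det]
  rcases Int.isUnit_iff.1 h with h | h <;> simp [h]

/-- The derivative of the parametrization. -/
noncomputable def deriv (t : Fin 6 → ℝ) : (Fin 6 → ℝ) →L[ℝ] (Fin 6 → ℝ) :=
  LinearMap.toContinuousLinearMap
    (Matrix.toLin' (P.A.map (Int.castRingHom ℝ) * P.tree.derivMatrix t))

theorem hasFDerivAt_map (t : Fin 6 → ℝ) : HasFDerivAt P.map (P.deriv t) t := by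
  have h := (LinearMap.toContinuousLinearMap
    (Matrix.toLin' (P.A.map (Int.castRingHom ℝ)))).hasFDerivAt.comp t (P.tree.hasFDerivAt_map t)
  have e : P.deriv t = (LinearMap.toContinuousLinearMap
      (Matrix.toLin' (P.A.map (Int.castRingHom ℝ)))).comp
      (LinearMap.toContinuousLinearMap (Matrix.toLin' (P.tree.derivMatrix t))) := by
    rw [deriv, Matrix.toLin'_mul]; rfl
  rw [e]
  exact h

theorem abs_det_deriv {t : Fin 6 → ℝ} (ht : t ∈ Icc 0 1) :
    |(P.deriv t).det| = P.tree.jac t := by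
  rw [deriv, LinearMap.det_toContinuousLinearMap, LinearMap.det_toLin', Matrix.det_mul, abs_mul,
    P.abs_det, one_mul, P.tree.det_derivMatrix, abs_of_nonneg (P.tree.jac_nonneg ht)]

/-- The points whose tree coordinates lie in the region of the tree. -/
def region : Set (Fin 6 → ℝ) :=
  {p | (P.B.map (Int.castRingHom ℝ)).mulVec p ∈ P.tree.region}

/-- This turns a covering by images of cubes into linear algebra: membership means linear
inequalities on `B p`, and `A * B = 1` recovers `p` from its tree coordinates. -/
theorem region_subset : P.region ⊆ P.map '' Icc 0 1 := by
  intro p hp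
  obtain ⟨t, ht, h⟩ := P.tree.region_subset hp
  refine ⟨t, ht, ?_⟩
  rw [map, h, Matrix.mulVec_mulVec, ← Matrix.map_mul, P.mul_eq_one]
  simp

end DuffyPiece

/-- If the pieces cover the product of the reference tetrahedra and have the right total volume,
and if in each piece the pulled back integrand splits as `g(ξ) h_i(η)`, then the integral is
`∫ g · ∑ ∫ h_i`. -/
theorem integrableOn_and_setIntegral_of_pieces {ι : Type*} [Fintype ι] (P : ι → DuffyPiece)
    (hcover : ∀ x ∈ refTet, ∀ y ∈ refTet, ∃ i, appendMeasurableEquiv 3 3 (x, y) ∈ (P i).region)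
    (hmass : ∑ i, 1 / ∏ j, (((P i).tree.expo j : ℝ) + 1) = 1 / 36)
    {X Y : Type*} [MeasureSpace X] [MeasureSpace Y] [SFinite (volume : Measure X)]
    [SFinite (volume : Measure Y)] (e : X × Y ≃ᵐ (Fin 6 → ℝ)) (he : MeasurePreserving e)
    {U : Set X} {V : Set Y} (hUV : e ⁻¹' Icc 0 1 = U ×ˢ V) (hV : MeasurableSet V)
    {f : Ref × Ref → ℝ} (hf : Measurable f) {g : X → ℝ} {h : ι → Y → ℝ}
    (hg : IntegrableOn g U) (hh : ∀ i, IntegrableOn (h i) V)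
    (heq : ∀ᵐ ξ ∂(volume.restrict U), ∀ i, ∀ η ∈ V,
      f ((P i).toRef (e (ξ, η))) * (P i).tree.jac (e (ξ, η)) = g ξ * h i η) :
    IntegrableOn f (refTet ×ˢ refTet) ∧
      ∫ p in refTet ×ˢ refTet, f p = (∫ ξ in U, g ξ) * ∑ i, ∫ η in V, h i η := by
  have hrestr : (volume : Measure (X × Y)).restrict (U ×ˢ V) =
      (volume.restrict U).prod (volume.restrict V) := by
    rw [Measure.volume_eq_prod, Measure.prod_restrict]
  have hae (i : ι) : (fun p : X × Y => f ((P i).toRef (e p)) * (P i).tree.jac (e p))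
      =ᵐ[(volume.restrict U).prod (volume.restrict V)] fun p => g p.1 * h i p.2 := by
    have h1 : ∀ᵐ p ∂((volume.restrict U).prod (volume.restrict V)), ∀ i, ∀ η ∈ V,
        f ((P i).toRef (e (p.1, η))) * (P i).tree.jac (e (p.1, η)) = g p.1 * h i η :=
      Measure.quasiMeasurePreserving_fst.ae heq
    have h2 : ∀ᵐ p ∂((volume.restrict U).prod (volume.restrict V)), p.2 ∈ V :=
      Measure.quasiMeasurePreserving_snd.ae (ae_restrict_mem hV)
    filter_upwards [h1, h2] with p hp hp2 using hp i p.2 hp2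
  -- The separated form makes integrability a product statement: integrability of `g` on `U` and of
  -- `h i` on `V` suffices.
  have hint (i : ι) : IntegrableOn
      (fun t => f ((appendMeasurableEquiv 3 3).symm ((P i).map t)) * (P i).tree.jac t)
      (Icc 0 1) := by
    rw [← he.integrableOn_comp_preimage e.measurableEmbedding, hUV, IntegrableOn, hrestr]
    exact (integrable_congr (hae i)).2 (hg.mul_prod (hh i))
  have hval (i : ι) : ∫ t in Icc (0 : Fin 6 → ℝ) 1,
      f ((appendMeasurableEquiv 3 3).symm ((P i).map t)) * (P i).tree.jac t =
      (∫ ξ in U, g ξ) * ∫ η in V, h i η := by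
    rw [← he.setIntegral_preimage_emb e.measurableEmbedding, hUV, hrestr]
    exact (integral_congr_ae (hae i)).trans (integral_prod_mul _ _)
  have key := integrableOn_and_setIntegral_eq_sum (volume : Measure (Fin 6 → ℝ))
    (F := fun i => (P i).map) (F' := fun i => (P i).deriv) (s := Icc 0 1) (S := refTetProd)
    (J := fun i => (P i).tree.jac) measurableSet_Icc (fun i => (P i).hasFDerivAt_map)
    volume_refTetProd_ne_top ?_ ?_ (fun i t ht => (P i).abs_det_deriv ht)
    (fun i => (P i).tree.continuous_jac.measurable)
    (f := fun p => f ((appendMeasurableEquiv 3 3).symm p))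
    (hf.comp (appendMeasurableEquiv 3 3).symm.measurable) hint
  · have hs := (measurePreserving_append 3 3).symm
    have hemb := (appendMeasurableEquiv 3 3).symm.measurableEmbedding
    rw [refTetProd] at key
    rw [← hs.integrableOn_comp_preimage hemb, ← hs.setIntegral_preimage_emb hemb]
    refine ⟨key.1, key.2.trans ?_⟩
    rw [Finset.mul_sum]
    exact Finset.sum_congr rfl fun i _ => hval i
  · intro p hp
    obtain ⟨i, hi⟩ := hcover _ hp.1 _ hp.2
    refine mem_iUnion.2 ⟨i, (P i).region_subset ?_⟩
    simpa using hi
  -- The sum of the volumes of the pieces equals `1/36`, which meets the lower bound for the volume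
  -- of the product.
  · refine le_trans (le_of_eq ?_) ofReal_le_volume_refTetProd
    rw [← hmass, ENNReal.ofReal_sum_of_nonneg fun i _ => by positivity]
    refine Finset.sum_congr rfl fun i _ => ?_
    rw [← DuffyTree.lintegral_jac]
    exact setLIntegral_congr_fun measurableSet_Icc fun t ht => by
      rw [(P i).abs_det_deriv ht]

/-! ### The pieces -/

/-- The chain `0 - 1 - 2 - 3 - 4 - 5`. -/
def chainTree : DuffyTree 6 where
  parent := ![0, 0, 1, 2, 3, 4]
  anc := ![∅, {0}, {0, 1}, {0, 1, 2}, {0, 1, 2, 3}, {0, 1, 2, 3, 4}]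
  parent_lt := by decide
  anc_zero := rfl
  anc_eq := by decide
  anc_lt := by decide

/-- Two chains `1 - 2` and `3 - 4 - 5` below the root. -/
def vertexTree : DuffyTree 6 where
  parent := ![0, 0, 1, 0, 3, 4]
  anc := ![∅, {0}, {0, 1}, {0}, {0, 3}, {0, 3, 4}]
  parent_lt := by decide
  anc_zero := rfl
  anc_eq := by decide
  anc_lt := by decide

/-- A leaf `2` and a chain `3 - 4 - 5` below the chain `0 - 1`. -/
def edgeTree₁ : DuffyTree 6 where
  parent := ![0, 0, 1, 1, 3, 4]
  anc := ![∅, {0}, {0, 1}, {0, 1}, {0, 1, 3}, {0, 1, 3, 4}]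
  parent_lt := by decide
  anc_zero := rfl
  anc_eq := by decide
  anc_lt := by decide

/-- Two chains `2 - 3` and `4 - 5` below the chain `0 - 1`. -/
def edgeTree₂ : DuffyTree 6 where
  parent := ![0, 0, 1, 2, 1, 4]
  anc := ![∅, {0}, {0, 1}, {0, 1, 2}, {0, 1}, {0, 1, 4}]
  parent_lt := by decide
  anc_zero := rfl
  anc_eq := by decide
  anc_lt := by decide

/-- A chain `3 - 4` and a leaf `5` below the chain `0 - 1 - 2`. -/
def faceTree : DuffyTree 6 where
  parent := ![0, 0, 1, 2, 3, 2]
  anc := ![∅, {0}, {0, 1}, {0, 1, 2}, {0, 1, 2, 3}, {0, 1, 2}]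
  parent_lt := by decide
  anc_zero := rfl
  anc_eq := by decide
  anc_lt := by decide

/-- Two leaves `4` and `5` below the chain `0 - 1 - 2 - 3`. -/
def forkTree : DuffyTree 6 where
  parent := ![0, 0, 1, 2, 3, 3]
  anc := ![∅, {0}, {0, 1}, {0, 1, 2}, {0, 1, 2, 3}, {0, 1, 2, 3}]
  parent_lt := by decide
  anc_zero := rfl
  anc_eq := by decide
  anc_lt := by decide

/-! ### Exponents, Jacobians and coordinates of the six trees -/

theorem chainTree_expo : chainTree.expo = ![5, 4, 3, 2, 1, 0] := by decide

theorem chainTree_prod_expo : ∏ j, ((chainTree.expo j : ℝ) + 1) = 720 := by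
  rw [chainTree_expo]
  norm_num [Fin.prod_univ_succ]

theorem chainTree_jac (t : Fin 6 → ℝ) :
    chainTree.jac t = t 0 ^ 5 * t 1 ^ 4 * t 2 ^ 3 * t 3 ^ 2 * t 4 := by
  rw [chainTree.jac_eq_prod_pow, chainTree_expo]
  simp [Fin.prod_univ_six]

theorem chainTree_map (t : Fin 6 → ℝ) :
    chainTree.map t = ![t 0, t 0 * t 1, t 0 * t 1 * t 2, t 0 * t 1 * t 2 * t 3,
      t 0 * t 1 * t 2 * t 3 * t 4, t 0 * t 1 * t 2 * t 3 * t 4 * t 5] := by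
  ext i
  fin_cases i <;> simp [DuffyTree.map, chainTree] <;> ring

theorem vertexTree_expo : vertexTree.expo = ![5, 1, 0, 2, 1, 0] := by decide

theorem vertexTree_prod_expo : ∏ j, ((vertexTree.expo j : ℝ) + 1) = 72 := by
  rw [vertexTree_expo]
  norm_num [Fin.prod_univ_succ]

theorem vertexTree_jac (t : Fin 6 → ℝ) : vertexTree.jac t = t 0 ^ 5 * t 1 * t 3 ^ 2 * t 4 := by
  rw [vertexTree.jac_eq_prod_pow, vertexTree_expo]
  simp [Fin.prod_univ_six]

theorem vertexTree_map (t : Fin 6 → ℝ) :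
    vertexTree.map t = ![t 0, t 0 * t 1, t 0 * t 1 * t 2, t 0 * t 3,
      t 0 * t 3 * t 4, t 0 * t 3 * t 4 * t 5] := by
  ext i
  fin_cases i <;> simp [DuffyTree.map, vertexTree] <;> ring

theorem edgeTree₁_expo : edgeTree₁.expo = ![5, 4, 0, 2, 1, 0] := by decide

theorem edgeTree₁_prod_expo : ∏ j, ((edgeTree₁.expo j : ℝ) + 1) = 180 := by
  rw [edgeTree₁_expo]
  norm_num [Fin.prod_univ_succ]

theorem edgeTree₁_jac (t : Fin 6 → ℝ) : edgeTree₁.jac t = t 0 ^ 5 * t 1 ^ 4 * t 3 ^ 2 * t 4 := by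
  rw [edgeTree₁.jac_eq_prod_pow, edgeTree₁_expo]
  simp [Fin.prod_univ_six]

theorem edgeTree₁_map (t : Fin 6 → ℝ) :
    edgeTree₁.map t = ![t 0, t 0 * t 1, t 0 * t 1 * t 2, t 0 * t 1 * t 3,
      t 0 * t 1 * t 3 * t 4, t 0 * t 1 * t 3 * t 4 * t 5] := by
  ext i
  fin_cases i <;> simp [DuffyTree.map, edgeTree₁] <;> ring

theorem edgeTree₂_expo : edgeTree₂.expo = ![5, 4, 1, 0, 1, 0] := by decide

theorem edgeTree₂_prod_expo : ∏ j, ((edgeTree₂.expo j : ℝ) + 1) = 120 := by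
  rw [edgeTree₂_expo]
  norm_num [Fin.prod_univ_succ]

theorem edgeTree₂_jac (t : Fin 6 → ℝ) : edgeTree₂.jac t = t 0 ^ 5 * t 1 ^ 4 * t 2 * t 4 := by
  rw [edgeTree₂.jac_eq_prod_pow, edgeTree₂_expo]
  simp [Fin.prod_univ_six]

theorem edgeTree₂_map (t : Fin 6 → ℝ) :
    edgeTree₂.map t = ![t 0, t 0 * t 1, t 0 * t 1 * t 2, t 0 * t 1 * t 2 * t 3,
      t 0 * t 1 * t 4, t 0 * t 1 * t 4 * t 5] := by
  ext i
  fin_cases i <;> simp [DuffyTree.map, edgeTree₂] <;> ring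

theorem faceTree_expo : faceTree.expo = ![5, 4, 3, 1, 0, 0] := by decide

theorem faceTree_prod_expo : ∏ j, ((faceTree.expo j : ℝ) + 1) = 240 := by
  rw [faceTree_expo]
  norm_num [Fin.prod_univ_succ]

theorem faceTree_jac (t : Fin 6 → ℝ) : faceTree.jac t = t 0 ^ 5 * t 1 ^ 4 * t 2 ^ 3 * t 3 := by
  rw [faceTree.jac_eq_prod_pow, faceTree_expo]
  simp [Fin.prod_univ_six]

theorem faceTree_map (t : Fin 6 → ℝ) :
    faceTree.map t = ![t 0, t 0 * t 1, t 0 * t 1 * t 2, t 0 * t 1 * t 2 * t 3,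
      t 0 * t 1 * t 2 * t 3 * t 4, t 0 * t 1 * t 2 * t 5] := by
  ext i
  fin_cases i <;> simp [DuffyTree.map, faceTree] <;> ring

theorem forkTree_expo : forkTree.expo = ![5, 4, 3, 2, 0, 0] := by decide

theorem forkTree_prod_expo : ∏ j, ((forkTree.expo j : ℝ) + 1) = 360 := by
  rw [forkTree_expo]
  norm_num [Fin.prod_univ_succ]

theorem forkTree_jac (t : Fin 6 → ℝ) : forkTree.jac t = t 0 ^ 5 * t 1 ^ 4 * t 2 ^ 3 * t 3 ^ 2 := by
  rw [forkTree.jac_eq_prod_pow, forkTree_expo]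
  simp [Fin.prod_univ_six]

theorem forkTree_map (t : Fin 6 → ℝ) :
    forkTree.map t = ![t 0, t 0 * t 1, t 0 * t 1 * t 2, t 0 * t 1 * t 2 * t 3,
      t 0 * t 1 * t 2 * t 3 * t 4, t 0 * t 1 * t 2 * t 3 * t 5] := by
  ext i
  fin_cases i <;> simp [DuffyTree.map, forkTree] <;> ring

/-! ### Unimodular matrices of the pieces -/

/-- The piece belonging to `𝒟₁` for a common vertex. -/
def vertexPiece₁ : DuffyPiece where
  tree := vertexTree
  A := !![1, 0, 0, 0, 0, 0;
      0, 0, 1, 0, 0, 0;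
      0, 1, -1, 0, 0, 0;
      0, 0, 0, 1, 0, 0;
      0, 0, 0, 0, 0, 1;
      0, 0, 0, 0, 1, -1]
  -- The rows of `B` are the tree coordinates as linear forms in the two points, here `x₀, x₁ + x₂,
  -- x₁, y₀, y₁ + y₂, y₁`. In each piece those ordered along the edges of the tree are differences
  -- or partial sums of coordinates.
  B := !![1, 0, 0, 0, 0, 0;
      0, 1, 1, 0, 0, 0;
      0, 1, 0, 0, 0, 0;
      0, 0, 0, 1, 0, 0;
      0, 0, 0, 0, 1, 1;
      0, 0, 0, 0, 1, 0]
  mul_eq_one := by decide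

/-- The piece belonging to `𝒟₁` for a common edge. -/
def edgePiece₁ : DuffyPiece where
  tree := edgeTree₁
  A := !![1, 0, 0, 0, 0, 0;
      0, 0, 1, 0, 0, 0;
      0, 1, -1, 0, 0, 0;
      1, 0, 0, 0, 0, -1;
      0, 0, 0, 0, 1, -1;
      0, 0, 0, 1, -1, 0]
  -- Tree coordinates `x₀, x₁ + x₂, x₁, x₀ - y₀ + y₁ + y₂, x₀ - y₀ + y₁, x₀ - y₀`. The root is the
  -- common translation along the edge, and `w₃ ≤ w₁` compares the barycentric coordinates at the
  -- vertex `b`.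
  B := !![1, 0, 0, 0, 0, 0;
      0, 1, 1, 0, 0, 0;
      0, 1, 0, 0, 0, 0;
      1, 0, 0, -1, 1, 1;
      1, 0, 0, -1, 1, 0;
      1, 0, 0, -1, 0, 0]
  mul_eq_one := by decide

/-- The piece belonging to `𝒟₂` for a common edge. -/
def edgePiece₂ : DuffyPiece where
  tree := edgeTree₂
  A := !![1, 0, 0, 0, 0, 0;
      0, 0, 0, 0, 0, 1;
      0, 0, 0, 0, 1, -1;
      1, 0, 0, -1, 0, 0;
      0, 0, 1, -1, 0, 0;
      0, 1, -1, 0, 0, 0]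
  B := !![1, 0, 0, 0, 0, 0;
      1, 0, 0, -1, 1, 1;
      1, 0, 0, -1, 1, 0;
      1, 0, 0, -1, 0, 0;
      0, 1, 1, 0, 0, 0;
      0, 1, 0, 0, 0, 0]
  mul_eq_one := by decide

/-- The piece belonging to `𝒟₁` for a common face. -/
def facePiece₁ : DuffyPiece where
  tree := chainTree
  A := !![1, 0, 0, 0, 0, 0;
      1, -1, 0, 1, 0, 0;
      0, 0, 1, -1, 0, 0;
      1, 0, 0, 0, 0, -1;
      1, -1, 0, 0, 0, 0;
      0, 0, 0, 0, 1, -1]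
  -- In every face piece `w₀` is the larger of `x₀, y₀` and `w₀ - w₁` the smaller of `x₁, y₁`, so
  -- that `w₀ e₁ + (w₀ - w₁) e₂` is the common translation in the plane of the face.
  B := !![1, 0, 0, 0, 0, 0;
      1, 0, 0, 0, -1, 0;
      0, 1, 1, 0, -1, 0;
      0, 1, 0, 0, -1, 0;
      1, 0, 0, -1, 0, 1;
      1, 0, 0, -1, 0, 0]
  mul_eq_one := by decide

/-- The piece belonging to `𝒟₂` for a common face. -/
def facePiece₂ : DuffyPiece where
  tree := chainTree
  A := !![1, 0, 0, 0, 0, 0;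
      1, -1, 0, 0, 1, 0;
      0, 0, 0, 1, -1, 0;
      1, 0, 0, 0, 0, -1;
      1, -1, 0, 0, 0, 0;
      0, 0, 1, 0, 0, -1]
  B := !![1, 0, 0, 0, 0, 0;
      1, 0, 0, 0, -1, 0;
      1, 0, 0, -1, 0, 1;
      0, 1, 1, 0, -1, 0;
      0, 1, 0, 0, -1, 0;
      1, 0, 0, -1, 0, 0]
  mul_eq_one := by decide

/-- The piece belonging to `𝒟₃` for a common face. -/
def facePiece₃ : DuffyPiece where
  tree := chainTree
  A := !![1, 0, 0, 0, 0, 0;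
      1, -1, 0, 0, 1, 0;
      0, 0, 1, 0, -1, 0;
      1, 0, 0, 0, 0, -1;
      1, -1, 0, 0, 0, 0;
      0, 0, 0, 1, 0, -1]
  B := !![1, 0, 0, 0, 0, 0;
      1, 0, 0, 0, -1, 0;
      0, 1, 1, 0, -1, 0;
      1, 0, 0, -1, 0, 1;
      0, 1, 0, 0, -1, 0;
      1, 0, 0, -1, 0, 0]
  mul_eq_one := by decide

/-- The piece belonging to `𝒟₄` for a common face. -/
def facePiece₄ : DuffyPiece where
  tree := chainTree
  A := !![1, 0, 0, 0, 0, 0;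
      1, -1, 0, 0, 0, 1;
      0, 0, 0, 0, 1, -1;
      1, 0, 0, -1, 0, 0;
      1, -1, 0, 0, 0, 0;
      0, 0, 1, -1, 0, 0]
  B := !![1, 0, 0, 0, 0, 0;
      1, 0, 0, 0, -1, 0;
      1, 0, 0, -1, 0, 1;
      1, 0, 0, -1, 0, 0;
      0, 1, 1, 0, -1, 0;
      0, 1, 0, 0, -1, 0]
  mul_eq_one := by decide

/-- The piece belonging to `𝒟₅` for a common face. -/
def facePiece₅ : DuffyPiece where
  tree := chainTree
  A := !![1, 0, 0, 0, 0, 0;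
      1, -1, 0, 0, 0, 1;
      0, 0, 0, 1, 0, -1;
      1, 0, 0, 0, -1, 0;
      1, -1, 0, 0, 0, 0;
      0, 0, 1, 0, -1, 0]
  B := !![1, 0, 0, 0, 0, 0;
      1, 0, 0, 0, -1, 0;
      1, 0, 0, -1, 0, 1;
      0, 1, 1, 0, -1, 0;
      1, 0, 0, -1, 0, 0;
      0, 1, 0, 0, -1, 0]
  mul_eq_one := by decide

/-- The piece belonging to `𝒟₆` for a common face. -/
def facePiece₆ : DuffyPiece where
  tree := chainTree
  A := !![1, 0, 0, 0, 0, 0;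
      1, -1, 0, 0, 0, 1;
      0, 0, 1, 0, 0, -1;
      1, 0, 0, 0, -1, 0;
      1, -1, 0, 0, 0, 0;
      0, 0, 0, 1, -1, 0]
  B := !![1, 0, 0, 0, 0, 0;
      1, 0, 0, 0, -1, 0;
      0, 1, 1, 0, -1, 0;
      1, 0, 0, -1, 0, 1;
      1, 0, 0, -1, 0, 0;
      0, 1, 0, 0, -1, 0]
  mul_eq_one := by decide

/-- The piece belonging to `𝒟₇` for a common face. -/
def facePiece₇ : DuffyPiece where
  tree := chainTree
  A := !![1, 0, 0, 0, 0, 0;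
      1, -1, 0, 0, 0, 0;
      0, 0, 1, 0, 0, 0;
      1, 0, 0, 0, 0, -1;
      1, -1, 0, 0, 1, -1;
      0, 0, 0, 1, -1, 0]
  B := !![1, 0, 0, 0, 0, 0;
      1, -1, 0, 0, 0, 0;
      0, 0, 1, 0, 0, 0;
      1, -1, 0, -1, 1, 1;
      1, -1, 0, -1, 1, 0;
      1, 0, 0, -1, 0, 0]
  mul_eq_one := by decide

/-- The piece belonging to `𝒟₁₅` for a common face. -/
def facePiece₁₅ : DuffyPiece where
  tree := chainTree
  A := !![1, 0, 0, 0, 0, -1;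
      1, -1, 0, 0, 1, -1;
      0, 0, 1, 0, -1, 0;
      1, 0, 0, 0, 0, 0;
      1, -1, 0, 0, 0, 0;
      0, 0, 0, 1, 0, 0]
  B := !![0, 0, 0, 1, 0, 0;
      0, 0, 0, 1, -1, 0;
      -1, 1, 1, 1, -1, 0;
      0, 0, 0, 0, 0, 1;
      -1, 1, 0, 1, -1, 0;
      -1, 0, 0, 1, 0, 0]
  mul_eq_one := by decide

/-- The piece belonging to `𝒟₁₆` for a common face. -/
def facePiece₁₆ : DuffyPiece where
  tree := faceTree
  A := !![1, 0, 0, 0, 0, 0;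
      1, -1, 0, 0, 0, 0;
      0, 0, 0, 0, 0, 1;
      1, 0, 0, 0, -1, 0;
      1, -1, 0, 1, -1, 0;
      0, 0, 1, -1, 0, 0]
  B := !![1, 0, 0, 0, 0, 0;
      1, -1, 0, 0, 0, 0;
      1, -1, 0, -1, 1, 1;
      1, -1, 0, -1, 1, 0;
      1, 0, 0, -1, 0, 0;
      0, 0, 1, 0, 0, 0]
  mul_eq_one := by decide

/-- The piece belonging to `𝒟₁₇` for a common face. -/
def facePiece₁₇ : DuffyPiece where
  tree := forkTree
  A := !![1, 0, 0, 0, -1, 0;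
      1, -1, 0, 1, -1, 0;
      0, 0, 1, -1, 0, 0;
      1, 0, 0, 0, 0, 0;
      1, -1, 0, 0, 0, 0;
      0, 0, 0, 0, 0, 1]
  B := !![0, 0, 0, 1, 0, 0;
      0, 0, 0, 1, -1, 0;
      -1, 1, 1, 1, -1, 0;
      -1, 1, 0, 1, -1, 0;
      -1, 0, 0, 1, 0, 0;
      0, 0, 0, 0, 0, 1]
  mul_eq_one := by decide

/-- The piece belonging to `𝒟₁` for identical tetrahedra. -/
def tetraPiece₁ : DuffyPiece where
  tree := chainTree
  A := !![1, 0, 0, 0, 0, 0;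
      1, -1, 0, 0, 1, 0;
      0, 0, 1, 0, -1, 0;
      1, 0, 0, 0, 0, -1;
      1, -1, 0, 0, 0, 0;
      0, 0, 1, -1, 0, 0]
  B := !![1, 0, 0, 0, 0, 0;
      1, 0, 0, 0, -1, 0;
      0, 1, 1, 0, -1, 0;
      0, 1, 1, 0, -1, -1;
      0, 1, 0, 0, -1, 0;
      1, 0, 0, -1, 0, 0]
  mul_eq_one := by decide

/-- The piece belonging to `𝒟₂` for identical tetrahedra. -/
def tetraPiece₂ : DuffyPiece where
  tree := chainTree
  A := !![1, 0, 0, 0, 0, 0;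
      1, -1, 0, 1, 0, 0;
      0, 0, 1, -1, 0, 0;
      1, 0, 0, 0, 0, -1;
      1, -1, 0, 0, 0, 0;
      0, 0, 1, -1, 1, -1]
  B := !![1, 0, 0, 0, 0, 0;
      1, 0, 0, 0, -1, 0;
      0, 1, 1, 0, -1, 0;
      0, 1, 0, 0, -1, 0;
      1, 0, -1, -1, 0, 1;
      1, 0, 0, -1, 0, 0]
  mul_eq_one := by decide

/-- The piece belonging to `𝒟₃` for identical tetrahedra. -/
def tetraPiece₃ : DuffyPiece where
  tree := chainTree
  A := !![1, 0, 0, 0, 0, 0;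
      1, -1, 0, 0, 1, 0;
      0, 0, 1, -1, 0, 0;
      1, 0, 0, 0, 0, -1;
      1, -1, 0, 0, 0, 0;
      0, 0, 1, 0, 0, -1]
  B := !![1, 0, 0, 0, 0, 0;
      1, 0, 0, 0, -1, 0;
      1, 0, 0, -1, 0, 1;
      1, 0, -1, -1, 0, 1;
      0, 1, 0, 0, -1, 0;
      1, 0, 0, -1, 0, 0]
  mul_eq_one := by decide

/-- The piece belonging to `𝒟₄` for identical tetrahedra. -/
def tetraPiece₄ : DuffyPiece where
  tree := chainTree
  A := !![1, 0, 0, 0, 0, 0;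
      1, -1, 0, 0, 0, 1;
      0, 0, 1, 0, 0, -1;
      1, 0, 0, 0, -1, 0;
      1, -1, 0, 0, 0, 0;
      0, 0, 1, -1, 0, 0]
  B := !![1, 0, 0, 0, 0, 0;
      1, 0, 0, 0, -1, 0;
      0, 1, 1, 0, -1, 0;
      0, 1, 1, 0, -1, -1;
      1, 0, 0, -1, 0, 0;
      0, 1, 0, 0, -1, 0]
  mul_eq_one := by decide

/-- The piece belonging to `𝒟₅` for identical tetrahedra. -/
def tetraPiece₅ : DuffyPiece where
  tree := chainTree
  A := !![1, 0, 0, 0, 0, 0;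
      1, -1, 0, 0, 0, 1;
      0, 0, 1, -1, 1, -1;
      1, 0, 0, -1, 0, 0;
      1, -1, 0, 0, 0, 0;
      0, 0, 1, -1, 0, 0]
  B := !![1, 0, 0, 0, 0, 0;
      1, 0, 0, 0, -1, 0;
      1, 0, 0, -1, 0, 1;
      1, 0, 0, -1, 0, 0;
      0, 1, 1, 0, -1, -1;
      0, 1, 0, 0, -1, 0]
  mul_eq_one := by decide

/-- The piece belonging to `𝒟₆` for identical tetrahedra. -/
def tetraPiece₆ : DuffyPiece where
  tree := chainTree
  A := !![1, 0, 0, 0, 0, 0;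
      1, -1, 0, 0, 0, 1;
      0, 0, 1, -1, 0, 0;
      1, 0, 0, 0, -1, 0;
      1, -1, 0, 0, 0, 0;
      0, 0, 1, 0, -1, 0]
  B := !![1, 0, 0, 0, 0, 0;
      1, 0, 0, 0, -1, 0;
      1, 0, 0, -1, 0, 1;
      1, 0, -1, -1, 0, 1;
      1, 0, 0, -1, 0, 0;
      0, 1, 0, 0, -1, 0]
  mul_eq_one := by decide

/-- The piece belonging to `𝒟₇` for identical tetrahedra. -/
def tetraPiece₇ : DuffyPiece where
  tree := chainTree
  A := !![1, 0, 0, 0, 0, 0;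
      1, -1, 0, 0, 0, 0;
      0, 0, 1, 0, 0, 0;
      1, 0, 0, 0, 0, -1;
      1, -1, 0, 0, 1, -1;
      0, 0, 1, -1, 0, 0]
  B := !![1, 0, 0, 0, 0, 0;
      1, -1, 0, 0, 0, 0;
      0, 0, 1, 0, 0, 0;
      0, 0, 1, 0, 0, -1;
      1, -1, 0, -1, 1, 0;
      1, 0, 0, -1, 0, 0]
  mul_eq_one := by decide

/-- The piece belonging to `𝒟₈` for identical tetrahedra. -/
def tetraPiece₈ : DuffyPiece where
  tree := chainTree
  A := !![1, 0, 0, 0, 0, 0;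
      1, -1, 0, 0, 0, 0;
      0, 0, 1, -1, 0, 0;
      1, 0, 0, 0, 0, -1;
      1, -1, 0, 0, 1, -1;
      0, 0, 1, 0, -1, 0]
  B := !![1, 0, 0, 0, 0, 0;
      1, -1, 0, 0, 0, 0;
      1, -1, 0, -1, 1, 1;
      1, -1, -1, -1, 1, 1;
      1, -1, 0, -1, 1, 0;
      1, 0, 0, -1, 0, 0]
  mul_eq_one := by decide

/-- The piece belonging to `𝒟₉` for identical tetrahedra. -/
def tetraPiece₉ : DuffyPiece where
  tree := forkTree
  A := !![1, 0, 0, 0, 0, 0;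
      1, -1, 0, 0, 0, 0;
      0, 0, 1, -1, 1, 0;
      1, 0, 0, 0, 0, -1;
      1, -1, 0, 1, 0, -1;
      0, 0, 1, -1, 0, 0]
  B := !![1, 0, 0, 0, 0, 0;
      1, -1, 0, 0, 0, 0;
      1, -1, 0, -1, 1, 1;
      1, -1, 0, -1, 1, 0;
      0, 0, 1, 0, 0, -1;
      1, 0, 0, -1, 0, 0]
  mul_eq_one := by decide

/-- The pieces for a common vertex. -/
def vertexPiece : Fin 2 → DuffyPiece := ![vertexPiece₁, vertexPiece₁.swap]

/-- The pieces for a common edge. -/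
def edgePiece : Fin 4 → DuffyPiece :=
  ![edgePiece₁, edgePiece₂, edgePiece₁.swap, edgePiece₂.swap]

/-- The pieces for a common face. -/
def facePiece : Fin 17 → DuffyPiece :=
  ![facePiece₁, facePiece₂, facePiece₃, facePiece₄, facePiece₅, facePiece₆, facePiece₇,
    facePiece₁.swap, facePiece₂.swap, facePiece₃.swap, facePiece₄.swap, facePiece₅.swap,
    facePiece₆.swap, facePiece₇.swap, facePiece₁₅, facePiece₁₆, facePiece₁₇]

/-- The first half of the pieces for identical tetrahedra. -/
def tetraHalfPiece : Fin 9 → DuffyPiece :=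
  ![tetraPiece₁, tetraPiece₂, tetraPiece₃, tetraPiece₄, tetraPiece₅, tetraPiece₆, tetraPiece₇,
    tetraPiece₈, tetraPiece₉]

/-- The pieces for identical tetrahedra. -/
def tetraPiece (i : Bool × Fin 9) : DuffyPiece :=
  if i.1 then (tetraHalfPiece i.2).swap else tetraHalfPiece i.2

/-! ### The pieces are the parametrizations `𝒟_m(ξ, η)` -/

theorem DuffyPiece.toRef_eq (P : DuffyPiece) (t : Fin 6 → ℝ) :
    P.toRef t =
      (fun i => ∑ j, P.A (Fin.castAdd 3 i) j * P.tree.map t j,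
        fun i => ∑ j, P.A (Fin.natAdd 3 i) j * P.tree.map t j) := rfl

theorem vertexPiece_toRef (t : Fin 6 → ℝ) (m : Fin 2) :
    (vertexPiece m).toRef t = vertexMapFull (t 0) ![t 1, t 2, t 3, t 4, t 5] m := by
  have h₁ : vertexPiece₁.toRef t = vertexMapFull (t 0) ![t 1, t 2, t 3, t 4, t 5] 0 := by
    rw [DuffyPiece.toRef_eq]
    refine Prod.ext ?_ ?_ <;> ext i <;> fin_cases i <;>
    simp [Fin.sum_univ_six, vertexPiece₁, vertexTree_map, vertexMapFull, vertexMap] <;> ring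
  fin_cases m
  · exact h₁
  · exact (vertexPiece₁.swap_toRef t).trans (congrArg Prod.swap h₁)

theorem vertexPiece_jac (t : Fin 6 → ℝ) (m : Fin 2) :
    (vertexPiece m).tree.jac t = vertexJacFull (t 0) ![t 1, t 2, t 3, t 4, t 5] := by
  have h : vertexTree.jac t = vertexJacFull (t 0) ![t 1, t 2, t 3, t 4, t 5] := by
    simp [vertexTree_jac, vertexJacFull, vertexJac]; ring
  fin_cases m <;> exact h

theorem edgePiece_toRef (t : Fin 6 → ℝ) (m : Fin 4) :
    (edgePiece m).toRef t = edgeMapFull ![t 0, t 1] ![t 2, t 3, t 4, t 5] m := by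
  have h₁ : edgePiece₁.toRef t = edgeMapFull ![t 0, t 1] ![t 2, t 3, t 4, t 5] 0 := by
    rw [DuffyPiece.toRef_eq]
    refine Prod.ext ?_ ?_ <;> ext i <;> fin_cases i <;>
    simp [Fin.sum_univ_six, edgePiece₁, edgeTree₁_map, edgeMapFull, edgeMap,
      edgeHalf, pairE1] <;> ring
  have h₂ : edgePiece₂.toRef t = edgeMapFull ![t 0, t 1] ![t 2, t 3, t 4, t 5] 1 := by
    rw [DuffyPiece.toRef_eq]
    refine Prod.ext ?_ ?_ <;> ext i <;> fin_cases i <;>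
    simp [Fin.sum_univ_six, edgePiece₂, edgeTree₂_map, edgeMapFull, edgeMap,
      edgeHalf, pairE1] <;> ring
  fin_cases m
  · exact h₁
  · exact h₂
  · exact (edgePiece₁.swap_toRef t).trans (congrArg Prod.swap h₁)
  · exact (edgePiece₂.swap_toRef t).trans (congrArg Prod.swap h₂)

theorem edgePiece_jac (t : Fin 6 → ℝ) (m : Fin 4) :
    (edgePiece m).tree.jac t = edgeJacFull ![t 0, t 1] ![t 2, t 3, t 4, t 5] m := by
  have h₁ : edgeTree₁.jac t = edgeJacFull ![t 0, t 1] ![t 2, t 3, t 4, t 5] 0 := by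
    simp [edgeTree₁_jac, edgeJacFull, edgeJac]; ring
  have h₂ : edgeTree₂.jac t = edgeJacFull ![t 0, t 1] ![t 2, t 3, t 4, t 5] 1 := by
    simp [edgeTree₂_jac, edgeJacFull, edgeJac]; ring
  fin_cases m
  exacts [h₁, h₂, h₁, h₂]

theorem facePiece_toRef (t : Fin 6 → ℝ) (m : Fin 17) :
    (facePiece m).toRef t = faceMapFull ![t 0, t 1, t 2] ![t 3, t 4, t 5] m := by
  obtain ⟨h₁, h₂, h₃, h₄, h₅, h₆, h₇, h₁₅, h₁₆, h₁₇⟩ :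
      facePiece₁.toRef t = faceMapFull ![t 0, t 1, t 2] ![t 3, t 4, t 5] 0 ∧
      facePiece₂.toRef t = faceMapFull ![t 0, t 1, t 2] ![t 3, t 4, t 5] 1 ∧
      facePiece₃.toRef t = faceMapFull ![t 0, t 1, t 2] ![t 3, t 4, t 5] 2 ∧
      facePiece₄.toRef t = faceMapFull ![t 0, t 1, t 2] ![t 3, t 4, t 5] 3 ∧
      facePiece₅.toRef t = faceMapFull ![t 0, t 1, t 2] ![t 3, t 4, t 5] 4 ∧
      facePiece₆.toRef t = faceMapFull ![t 0, t 1, t 2] ![t 3, t 4, t 5] 5 ∧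
      facePiece₇.toRef t = faceMapFull ![t 0, t 1, t 2] ![t 3, t 4, t 5] 6 ∧
      facePiece₁₅.toRef t = faceMapFull ![t 0, t 1, t 2] ![t 3, t 4, t 5] 14 ∧
      facePiece₁₆.toRef t = faceMapFull ![t 0, t 1, t 2] ![t 3, t 4, t 5] 15 ∧
      facePiece₁₇.toRef t = faceMapFull ![t 0, t 1, t 2] ![t 3, t 4, t 5] 16 := by
    refine ⟨?_, ?_, ?_, ?_, ?_, ?_, ?_, ?_, ?_, ?_⟩ <;>
    · rw [DuffyPiece.toRef_eq]
      refine Prod.ext ?_ ?_ <;> ext i <;> fin_cases i <;>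
      simp [Fin.sum_univ_six, chainTree_map, faceTree_map, forkTree_map, faceMapFull, faceMap,
        faceHalf, pairE1, pairE2, facePiece₁, facePiece₂, facePiece₃,
        facePiece₄, facePiece₅, facePiece₆, facePiece₇, facePiece₁₅, facePiece₁₆, facePiece₁₇] <;>
      ring
  fin_cases m
  · exact h₁
  · exact h₂
  · exact h₃
  · exact h₄
  · exact h₅
  · exact h₆
  · exact h₇
  · exact (facePiece₁.swap_toRef t).trans (congrArg Prod.swap h₁)
  · exact (facePiece₂.swap_toRef t).trans (congrArg Prod.swap h₂)
  · exact (facePiece₃.swap_toRef t).trans (congrArg Prod.swap h₃)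
  · exact (facePiece₄.swap_toRef t).trans (congrArg Prod.swap h₄)
  · exact (facePiece₅.swap_toRef t).trans (congrArg Prod.swap h₅)
  · exact (facePiece₆.swap_toRef t).trans (congrArg Prod.swap h₆)
  · exact (facePiece₇.swap_toRef t).trans (congrArg Prod.swap h₇)
  · exact h₁₅
  · exact h₁₆
  · exact h₁₇

theorem facePiece_jac (t : Fin 6 → ℝ) (m : Fin 17) :
    (facePiece m).tree.jac t = faceJacFull ![t 0, t 1, t 2] ![t 3, t 4, t 5] m := by
  have h : chainTree.jac t = t 0 ^ 5 * t 1 ^ 4 * t 2 ^ 3 * (t 3 ^ 2 * t 4) := by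
    rw [chainTree_jac]; ring
  have h₁₆ : faceTree.jac t = t 0 ^ 5 * t 1 ^ 4 * t 2 ^ 3 * t 3 := by
    rw [faceTree_jac]
  have h₁₇ : forkTree.jac t = t 0 ^ 5 * t 1 ^ 4 * t 2 ^ 3 * t 3 ^ 2 := by
    rw [forkTree_jac]
  fin_cases m
  any_goals exact h
  exacts [h₁₆, h₁₇]

/-- The parametrization of the piece differs from `tetraMapFull` by a translation of both points, to
which the kernel of a single tetrahedron is blind; hence the existential. -/
theorem tetraHalfPiece_toRef (t : Fin 6 → ℝ) (m : Fin 9) :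
    ∃ v : Ref, (tetraHalfPiece m).toRef t =
      (v, v) + tetraMapFull ![t 0, t 1, t 2, t 3] ![t 4, t 5] (false, m) := by
  -- There are two kinds of omitted translation; `w`, lower in the last coordinate, belongs to the
  -- pieces `2`, `5` and `9`.
  let v : Ref := ![t 0, t 0 * (1 - t 1), t 0 * t 1 * t 2]
  let w : Ref := ![t 0, t 0 * (1 - t 1), t 0 * t 1 * t 2 * (1 - t 3)]
  obtain ⟨h₁, h₂, h₃, h₄, h₅, h₆, h₇, h₈, h₉⟩ :
      tetraPiece₁.toRef t = (v, v) + tetraMapFull ![t 0, t 1, t 2, t 3] ![t 4, t 5] (false, 0) ∧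
      tetraPiece₂.toRef t = (w, w) + tetraMapFull ![t 0, t 1, t 2, t 3] ![t 4, t 5] (false, 1) ∧
      tetraPiece₃.toRef t = (v, v) + tetraMapFull ![t 0, t 1, t 2, t 3] ![t 4, t 5] (false, 2) ∧
      tetraPiece₄.toRef t = (v, v) + tetraMapFull ![t 0, t 1, t 2, t 3] ![t 4, t 5] (false, 3) ∧
      tetraPiece₅.toRef t = (w, w) + tetraMapFull ![t 0, t 1, t 2, t 3] ![t 4, t 5] (false, 4) ∧
      tetraPiece₆.toRef t = (v, v) + tetraMapFull ![t 0, t 1, t 2, t 3] ![t 4, t 5] (false, 5) ∧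
      tetraPiece₇.toRef t = (v, v) + tetraMapFull ![t 0, t 1, t 2, t 3] ![t 4, t 5] (false, 6) ∧
      tetraPiece₈.toRef t = (v, v) + tetraMapFull ![t 0, t 1, t 2, t 3] ![t 4, t 5] (false, 7) ∧
      tetraPiece₉.toRef t = (w, w) + tetraMapFull ![t 0, t 1, t 2, t 3] ![t 4, t 5] (false, 8) := by
    refine ⟨?_, ?_, ?_, ?_, ?_, ?_, ?_, ?_, ?_⟩ <;>
    · rw [DuffyPiece.toRef_eq]
      refine Prod.ext ?_ ?_ <;> ext i <;> fin_cases i <;>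
      simp [Fin.sum_univ_six, chainTree_map, forkTree_map, tetraMapFull, tetraMap, tetraHalf, v, w,
        tetraPiece₁, tetraPiece₂, tetraPiece₃, tetraPiece₄, tetraPiece₅,
        tetraPiece₆, tetraPiece₇, tetraPiece₈, tetraPiece₉] <;>
      ring
  fin_cases m
  · exact ⟨_, h₁⟩
  · exact ⟨_, h₂⟩
  · exact ⟨_, h₃⟩
  · exact ⟨_, h₄⟩
  · exact ⟨_, h₅⟩
  · exact ⟨_, h₆⟩
  · exact ⟨_, h₇⟩
  · exact ⟨_, h₈⟩
  · exact ⟨_, h₉⟩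

theorem tetraPiece_toRef (t : Fin 6 → ℝ) (i : Bool × Fin 9) :
    ∃ v : Ref, (tetraPiece i).toRef t =
      (v, v) + tetraMapFull ![t 0, t 1, t 2, t 3] ![t 4, t 5] i := by
  obtain ⟨b, m⟩ := i
  obtain ⟨v, hv⟩ := tetraHalfPiece_toRef t m
  cases b
  · exact ⟨v, hv⟩
  · exact ⟨v, ((tetraHalfPiece m).swap_toRef t).trans (congrArg Prod.swap hv)⟩

theorem tetraPiece_jac (t : Fin 6 → ℝ) (i : Bool × Fin 9) :
    (tetraPiece i).tree.jac t = tetraJacFull ![t 0, t 1, t 2, t 3] ![t 4, t 5] i := by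
  have h : chainTree.jac t = t 0 ^ 5 * t 1 ^ 4 * t 2 ^ 3 * t 3 ^ 2 * t 4 := by
    rw [chainTree_jac]
  have h₉ : forkTree.jac t = t 0 ^ 5 * t 1 ^ 4 * t 2 ^ 3 * t 3 ^ 2 * 1 := by
    rw [forkTree_jac, mul_one]
  obtain ⟨b, m⟩ := i
  cases b <;> fin_cases m
  any_goals exact h
  all_goals exact h₉

/-! ### Total volumes -/

/-- `2/72 = 1/36`. -/
theorem vertexPiece_volume :
    ∑ m, 1 / ∏ j, (((vertexPiece m).tree.expo j : ℝ) + 1) = 1 / 36 := by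
  have h (m : Fin 2) : (vertexPiece m).tree = vertexTree := by fin_cases m <;> rfl
  simp only [h, vertexTree_prod_expo]
  norm_num

/-- `2/180 + 2/120 = 1/36`. -/
theorem edgePiece_volume :
    ∑ m, 1 / ∏ j, (((edgePiece m).tree.expo j : ℝ) + 1) = 1 / 36 := by
  have h : (fun m => (edgePiece m).tree) = ![edgeTree₁, edgeTree₂, edgeTree₁, edgeTree₂] := by
    ext1 m; fin_cases m <;> rfl
  simp only [congrFun h, Fin.sum_univ_four, Matrix.cons_val]
  rw [edgeTree₁_prod_expo, edgeTree₂_prod_expo]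
  norm_num

/-- `15/720 + 1/240 + 1/360 = 1/36`. -/
theorem facePiece_volume :
    ∑ m, 1 / ∏ j, (((facePiece m).tree.expo j : ℝ) + 1) = 1 / 36 := by
  have h (m : Fin 15) : (facePiece (Fin.castAdd 2 m)).tree = chainTree := by
    fin_cases m <;> rfl
  have h₁₆ : (facePiece 15).tree = faceTree := rfl
  have h₁₇ : (facePiece 16).tree = forkTree := rfl
  rw [Fin.sum_univ_castSucc, Fin.sum_univ_castSucc]
  rw [Finset.sum_congr rfl fun m _ => by
    rw [show (facePiece m.castSucc.castSucc).tree = chainTree from h m, chainTree_prod_expo]]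
  rw [show (facePiece (Fin.last 15).castSucc).tree = faceTree from h₁₆,
    show (facePiece (Fin.last 16)).tree = forkTree from h₁₇, faceTree_prod_expo,
    forkTree_prod_expo]
  norm_num

/-- `16/720 + 2/360 = 1/36`. -/
theorem tetraPiece_volume :
    ∑ i, 1 / ∏ j, (((tetraPiece i).tree.expo j : ℝ) + 1) = 1 / 36 := by
  have h (b : Bool) (m : Fin 8) : (tetraPiece (b, m.castSucc)).tree = chainTree := by
    cases b <;> fin_cases m <;> rfl
  have h₉ (b : Bool) : (tetraPiece (b, Fin.last 8)).tree = forkTree := by cases b <;> rfl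
  rw [Fintype.sum_prod_type, Fintype.sum_bool]
  simp only [Fin.sum_univ_castSucc (n := 8), h, h₉, chainTree_prod_expo, forkTree_prod_expo]
  norm_num

/-! ### The pieces cover the product of the reference tetrahedra -/

theorem DuffyPiece.mem_region_iff (P : DuffyPiece) (x y : Ref) :
    appendMeasurableEquiv 3 3 (x, y) ∈ P.region ↔
      (fun i => (P.B i 0 * x 0 + P.B i 1 * x 1 + P.B i 2 * x 2 + P.B i 3 * y 0 + P.B i 4 * y 1
        + P.B i 5 * y 2 : ℝ)) ∈ P.tree.region := by
  have h : (P.B.map (Int.castRingHom ℝ)).mulVec (appendMeasurableEquiv 3 3 (x, y)) =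
      fun i => (P.B i 0 * x 0 + P.B i 1 * x 1 + P.B i 2 * x 2 + P.B i 3 * y 0 + P.B i 4 * y 1
        + P.B i 5 * y 2 : ℝ) := by
    ext i
    simp only [Matrix.mulVec, dotProduct, Fin.sum_univ_six, Matrix.map_apply]
    rfl
  rw [DuffyPiece.region, mem_ofPred_eq, h]

/-- Transposed pieces need no inequalities of their own: the two points exchange roles. -/
theorem DuffyPiece.mem_swap_region_iff (P : DuffyPiece) (x y : Ref) :
    appendMeasurableEquiv 3 3 (x, y) ∈ P.swap.region ↔
      appendMeasurableEquiv 3 3 (y, x) ∈ P.region := by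
  rw [mem_region_iff, mem_region_iff]
  have h : (fun i => (P.swap.B i 0 * x 0 + P.swap.B i 1 * x 1 + P.swap.B i 2 * x 2
      + P.swap.B i 3 * y 0 + P.swap.B i 4 * y 1 + P.swap.B i 5 * y 2 : ℝ)) =
      fun i => (P.B i 0 * y 0 + P.B i 1 * y 1 + P.B i 2 * y 2 + P.B i 3 * x 0 + P.B i 4 * x 1
        + P.B i 5 * x 2 : ℝ) := by
    ext i
    have e0 : P.swap.B i 0 = P.B i 3 := rfl
    have e1 : P.swap.B i 1 = P.B i 4 := rfl
    have e2 : P.swap.B i 2 = P.B i 5 := rfl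
    have e3 : P.swap.B i 3 = P.B i 0 := rfl
    have e4 : P.swap.B i 4 = P.B i 1 := rfl
    have e5 : P.swap.B i 5 = P.B i 2 := rfl
    rw [e0, e1, e2, e3, e4, e5]
    ring
  rw [h]
  rfl

theorem DuffyTree.mem_region_six_iff (τ : DuffyTree 6) (w : Fin 6 → ℝ) :
    w ∈ τ.region ↔ w 0 ≤ 1 ∧ (0 ≤ w 0 ∧ 0 ≤ w 1 ∧ 0 ≤ w 2 ∧ 0 ≤ w 3 ∧ 0 ≤ w 4 ∧ 0 ≤ w 5) ∧
      w 1 ≤ w (τ.parent 1) ∧ w 2 ≤ w (τ.parent 2) ∧ w 3 ≤ w (τ.parent 3) ∧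
      w 4 ≤ w (τ.parent 4) ∧ w 5 ≤ w (τ.parent 5) := by
  simp [DuffyTree.region, Fin.forall_fin_succ]

/-! ### Order relations that place a pair of points in a given piece -/

/-- Here and in the analogues below, the inequalities defining the region follow linearly from the
two memberships in `refTet` and the listed comparisons of the two points. -/
theorem mem_vertexPiece₁ {x y : Ref} (hx : x ∈ refTet) (hy : y ∈ refTet)
    (h1 : y 0 ≤ x 0) :
    appendMeasurableEquiv 3 3 (x, y) ∈ vertexPiece₁.region := by
  obtain ⟨hx1, hx2, hx3, hx4⟩ := hx
  obtain ⟨hy1, hy2, hy3, hy4⟩ := hy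
  rw [DuffyPiece.mem_region_iff, DuffyTree.mem_region_six_iff]
  simp only [vertexPiece₁, vertexTree, Matrix.of_apply, Matrix.cons_val, Int.cast_zero,
    Int.cast_one]
  refine ⟨?_, ⟨?_, ?_, ?_, ?_, ?_, ?_⟩, ?_, ?_, ?_, ?_, ?_⟩ <;> linarith

theorem mem_edgePiece₁ {x y : Ref} (hx : x ∈ refTet) (hy : y ∈ refTet)
    (h1 : y 0 ≤ x 0) (h2 : x 0 - x 1 - x 2 ≤ y 0 - y 1 - y 2) :
    appendMeasurableEquiv 3 3 (x, y) ∈ edgePiece₁.region := by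
  obtain ⟨hx1, hx2, hx3, hx4⟩ := hx
  obtain ⟨hy1, hy2, hy3, hy4⟩ := hy
  rw [DuffyPiece.mem_region_iff, DuffyTree.mem_region_six_iff]
  simp only [edgePiece₁, edgeTree₁, Matrix.of_apply, Matrix.cons_val, Int.cast_zero, Int.cast_one,
    Int.cast_neg]
  refine ⟨?_, ⟨?_, ?_, ?_, ?_, ?_, ?_⟩, ?_, ?_, ?_, ?_, ?_⟩ <;> linarith

theorem mem_edgePiece₂ {x y : Ref} (hx : x ∈ refTet) (hy : y ∈ refTet)
    (h1 : y 0 ≤ x 0) (h2 : y 0 - y 1 - y 2 ≤ x 0 - x 1 - x 2) :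
    appendMeasurableEquiv 3 3 (x, y) ∈ edgePiece₂.region := by
  obtain ⟨hx1, hx2, hx3, hx4⟩ := hx
  obtain ⟨hy1, hy2, hy3, hy4⟩ := hy
  rw [DuffyPiece.mem_region_iff, DuffyTree.mem_region_six_iff]
  simp only [edgePiece₂, edgeTree₂, Matrix.of_apply, Matrix.cons_val, Int.cast_zero, Int.cast_one,
    Int.cast_neg]
  refine ⟨?_, ⟨?_, ?_, ?_, ?_, ?_, ?_⟩, ?_, ?_, ?_, ?_, ?_⟩ <;> linarith

theorem mem_facePiece₁ {x y : Ref} (hx : x ∈ refTet) (hy : y ∈ refTet)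
    (h1 : y 0 ≤ x 0) (h3 : y 1 ≤ x 1) (h4 : x 0 - y 0 + y 2 ≤ x 1 - y 1) :
    appendMeasurableEquiv 3 3 (x, y) ∈ facePiece₁.region := by
  obtain ⟨hx1, hx2, hx3, hx4⟩ := hx
  obtain ⟨hy1, hy2, hy3, hy4⟩ := hy
  rw [DuffyPiece.mem_region_iff, DuffyTree.mem_region_six_iff]
  simp only [facePiece₁, chainTree, Matrix.of_apply, Matrix.cons_val, Int.cast_zero, Int.cast_one,
    Int.cast_neg]
  refine ⟨?_, ⟨?_, ?_, ?_, ?_, ?_, ?_⟩, ?_, ?_, ?_, ?_, ?_⟩ <;> linarith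

theorem mem_facePiece₂ {x y : Ref} (hx : x ∈ refTet) (hy : y ∈ refTet)
    (h1 : y 0 ≤ x 0) (h2 : y 0 - y 1 - y 2 ≤ x 0 - x 1 - x 2) (h3 : y 1 ≤ x 1)
    (h4 : x 0 - y 0 ≤ x 1 - y 1) :
    appendMeasurableEquiv 3 3 (x, y) ∈ facePiece₂.region := by
  obtain ⟨hx1, hx2, hx3, hx4⟩ := hx
  obtain ⟨hy1, hy2, hy3, hy4⟩ := hy
  rw [DuffyPiece.mem_region_iff, DuffyTree.mem_region_six_iff]
  simp only [facePiece₂, chainTree, Matrix.of_apply, Matrix.cons_val, Int.cast_zero, Int.cast_one,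
    Int.cast_neg]
  refine ⟨?_, ⟨?_, ?_, ?_, ?_, ?_, ?_⟩, ?_, ?_, ?_, ?_, ?_⟩ <;> linarith

theorem mem_facePiece₃ {x y : Ref} (hx : x ∈ refTet) (hy : y ∈ refTet)
    (h1 : y 0 ≤ x 0) (h2 : x 0 - x 1 - x 2 ≤ y 0 - y 1 - y 2) (h3 : y 1 ≤ x 1)
    (h4 : x 0 - y 0 ≤ x 1 - y 1) (h5 : x 1 - y 1 ≤ x 0 - y 0 + y 2) :
    appendMeasurableEquiv 3 3 (x, y) ∈ facePiece₃.region := by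
  obtain ⟨hx1, hx2, hx3, hx4⟩ := hx
  obtain ⟨hy1, hy2, hy3, hy4⟩ := hy
  rw [DuffyPiece.mem_region_iff, DuffyTree.mem_region_six_iff]
  simp only [facePiece₃, chainTree, Matrix.of_apply, Matrix.cons_val, Int.cast_zero, Int.cast_one,
    Int.cast_neg]
  refine ⟨?_, ⟨?_, ?_, ?_, ?_, ?_, ?_⟩, ?_, ?_, ?_, ?_, ?_⟩ <;> linarith

theorem mem_facePiece₄ {x y : Ref} (hx : x ∈ refTet) (hy : y ∈ refTet)
    (h1 : y 0 ≤ x 0) (h2 : y 0 - y 1 - y 2 ≤ x 0 - x 1 - x 2) (h3 : y 1 ≤ x 1)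
    (h4 : x 1 - y 1 + x 2 ≤ x 0 - y 0) :
    appendMeasurableEquiv 3 3 (x, y) ∈ facePiece₄.region := by
  obtain ⟨hx1, hx2, hx3, hx4⟩ := hx
  obtain ⟨hy1, hy2, hy3, hy4⟩ := hy
  rw [DuffyPiece.mem_region_iff, DuffyTree.mem_region_six_iff]
  simp only [facePiece₄, chainTree, Matrix.of_apply, Matrix.cons_val, Int.cast_zero, Int.cast_one,
    Int.cast_neg]
  refine ⟨?_, ⟨?_, ?_, ?_, ?_, ?_, ?_⟩, ?_, ?_, ?_, ?_, ?_⟩ <;> linarith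

theorem mem_facePiece₅ {x y : Ref} (hx : x ∈ refTet) (hy : y ∈ refTet)
    (h1 : y 0 ≤ x 0) (h2 : y 0 - y 1 - y 2 ≤ x 0 - x 1 - x 2) (h3 : y 1 ≤ x 1)
    (h4 : x 1 - y 1 ≤ x 0 - y 0) (h5 : x 0 - y 0 ≤ x 1 - y 1 + x 2) :
    appendMeasurableEquiv 3 3 (x, y) ∈ facePiece₅.region := by
  obtain ⟨hx1, hx2, hx3, hx4⟩ := hx
  obtain ⟨hy1, hy2, hy3, hy4⟩ := hy
  rw [DuffyPiece.mem_region_iff, DuffyTree.mem_region_six_iff]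
  simp only [facePiece₅, chainTree, Matrix.of_apply, Matrix.cons_val, Int.cast_zero, Int.cast_one,
    Int.cast_neg]
  refine ⟨?_, ⟨?_, ?_, ?_, ?_, ?_, ?_⟩, ?_, ?_, ?_, ?_, ?_⟩ <;> linarith

theorem mem_facePiece₆ {x y : Ref} (hx : x ∈ refTet) (hy : y ∈ refTet)
    (h1 : y 0 ≤ x 0) (h2 : x 0 - x 1 - x 2 ≤ y 0 - y 1 - y 2) (h3 : y 1 ≤ x 1)
    (h4 : x 1 - y 1 ≤ x 0 - y 0) :
    appendMeasurableEquiv 3 3 (x, y) ∈ facePiece₆.region := by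
  obtain ⟨hx1, hx2, hx3, hx4⟩ := hx
  obtain ⟨hy1, hy2, hy3, hy4⟩ := hy
  rw [DuffyPiece.mem_region_iff, DuffyTree.mem_region_six_iff]
  simp only [facePiece₆, chainTree, Matrix.of_apply, Matrix.cons_val, Int.cast_zero, Int.cast_one,
    Int.cast_neg]
  refine ⟨?_, ⟨?_, ?_, ?_, ?_, ?_, ?_⟩, ?_, ?_, ?_, ?_, ?_⟩ <;> linarith

theorem mem_facePiece₇ {x y : Ref} (hx : x ∈ refTet) (hy : y ∈ refTet)
    (h1 : y 0 ≤ x 0) (h2 : x 0 - x 1 - x 2 ≤ y 0 - y 1 - y 2) (h3 : x 1 ≤ y 1) :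
    appendMeasurableEquiv 3 3 (x, y) ∈ facePiece₇.region := by
  obtain ⟨hx1, hx2, hx3, hx4⟩ := hx
  obtain ⟨hy1, hy2, hy3, hy4⟩ := hy
  rw [DuffyPiece.mem_region_iff, DuffyTree.mem_region_six_iff]
  simp only [facePiece₇, chainTree, Matrix.of_apply, Matrix.cons_val, Int.cast_zero, Int.cast_one,
    Int.cast_neg]
  refine ⟨?_, ⟨?_, ?_, ?_, ?_, ?_, ?_⟩, ?_, ?_, ?_, ?_, ?_⟩ <;> linarith

theorem mem_facePiece₁₅ {x y : Ref} (hx : x ∈ refTet) (hy : y ∈ refTet)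
    (h1 : x 0 ≤ y 0) (h2 : x 0 - x 1 - x 2 ≤ y 0 - y 1 - y 2) (h3 : y 1 ≤ x 1)
    (h4 : y 0 - x 0 + (x 1 - y 1) ≤ y 2) :
    appendMeasurableEquiv 3 3 (x, y) ∈ facePiece₁₅.region := by
  obtain ⟨hx1, hx2, hx3, hx4⟩ := hx
  obtain ⟨hy1, hy2, hy3, hy4⟩ := hy
  rw [DuffyPiece.mem_region_iff, DuffyTree.mem_region_six_iff]
  simp only [facePiece₁₅, chainTree, Matrix.of_apply, Matrix.cons_val, Int.cast_zero, Int.cast_one,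
    Int.cast_neg]
  refine ⟨?_, ⟨?_, ?_, ?_, ?_, ?_, ?_⟩, ?_, ?_, ?_, ?_, ?_⟩ <;> linarith

theorem mem_facePiece₁₆ {x y : Ref} (hx : x ∈ refTet) (hy : y ∈ refTet)
    (h1 : y 0 ≤ x 0) (h2 : y 0 - y 1 - y 2 ≤ x 0 - x 1 - x 2) (h3 : x 1 ≤ y 1) :
    appendMeasurableEquiv 3 3 (x, y) ∈ facePiece₁₆.region := by
  obtain ⟨hx1, hx2, hx3, hx4⟩ := hx
  obtain ⟨hy1, hy2, hy3, hy4⟩ := hy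
  rw [DuffyPiece.mem_region_iff, DuffyTree.mem_region_six_iff]
  simp only [facePiece₁₆, faceTree, Matrix.of_apply, Matrix.cons_val, Int.cast_zero, Int.cast_one,
    Int.cast_neg]
  refine ⟨?_, ⟨?_, ?_, ?_, ?_, ?_, ?_⟩, ?_, ?_, ?_, ?_, ?_⟩ <;> linarith

theorem mem_facePiece₁₇ {x y : Ref} (hx : x ∈ refTet) (hy : y ∈ refTet)
    (h1 : x 0 ≤ y 0) (h3 : y 1 ≤ x 1) (h4 : y 2 ≤ y 0 - x 0 + (x 1 - y 1)) :
    appendMeasurableEquiv 3 3 (x, y) ∈ facePiece₁₇.region := by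
  obtain ⟨hx1, hx2, hx3, hx4⟩ := hx
  obtain ⟨hy1, hy2, hy3, hy4⟩ := hy
  rw [DuffyPiece.mem_region_iff, DuffyTree.mem_region_six_iff]
  simp only [facePiece₁₇, forkTree, Matrix.of_apply, Matrix.cons_val, Int.cast_zero, Int.cast_one,
    Int.cast_neg]
  refine ⟨?_, ⟨?_, ?_, ?_, ?_, ?_, ?_⟩, ?_, ?_, ?_, ?_, ?_⟩ <;> linarith

theorem mem_tetraPiece₁ {x y : Ref} (hx : x ∈ refTet) (hy : y ∈ refTet)
    (h1 : y 0 ≤ x 0) (h2 : x 0 - x 1 - x 2 ≤ y 0 - y 1 - y 2) (h3 : y 1 ≤ x 1) (h4 : y 2 ≤ x 2)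
    (h5 : x 0 - y 0 ≤ x 1 - y 1) :
    appendMeasurableEquiv 3 3 (x, y) ∈ tetraPiece₁.region := by
  obtain ⟨hx1, hx2, hx3, hx4⟩ := hx
  obtain ⟨hy1, hy2, hy3, hy4⟩ := hy
  rw [DuffyPiece.mem_region_iff, DuffyTree.mem_region_six_iff]
  simp only [tetraPiece₁, chainTree, Matrix.of_apply, Matrix.cons_val, Int.cast_zero, Int.cast_one,
    Int.cast_neg]
  refine ⟨?_, ⟨?_, ?_, ?_, ?_, ?_, ?_⟩, ?_, ?_, ?_, ?_, ?_⟩ <;> linarith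

theorem mem_tetraPiece₂ {x y : Ref} (hx : x ∈ refTet) (hy : y ∈ refTet)
    (h1 : y 0 ≤ x 0) (h2 : x 0 - x 1 - x 2 ≤ y 0 - y 1 - y 2) (h3 : y 1 ≤ x 1) (h4 : x 2 ≤ y 2) :
    appendMeasurableEquiv 3 3 (x, y) ∈ tetraPiece₂.region := by
  obtain ⟨hx1, hx2, hx3, hx4⟩ := hx
  obtain ⟨hy1, hy2, hy3, hy4⟩ := hy
  rw [DuffyPiece.mem_region_iff, DuffyTree.mem_region_six_iff]
  simp only [tetraPiece₂, chainTree, Matrix.of_apply, Matrix.cons_val, Int.cast_zero, Int.cast_one,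
    Int.cast_neg]
  refine ⟨?_, ⟨?_, ?_, ?_, ?_, ?_, ?_⟩, ?_, ?_, ?_, ?_, ?_⟩ <;> linarith

theorem mem_tetraPiece₃ {x y : Ref} (hx : x ∈ refTet) (hy : y ∈ refTet)
    (h1 : y 0 ≤ x 0) (h2 : y 0 - y 1 - y 2 ≤ x 0 - x 1 - x 2) (h3 : y 1 ≤ x 1)
    (h5 : x 0 - y 0 ≤ x 1 - y 1) :
    appendMeasurableEquiv 3 3 (x, y) ∈ tetraPiece₃.region := by
  obtain ⟨hx1, hx2, hx3, hx4⟩ := hx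
  obtain ⟨hy1, hy2, hy3, hy4⟩ := hy
  rw [DuffyPiece.mem_region_iff, DuffyTree.mem_region_six_iff]
  simp only [tetraPiece₃, chainTree, Matrix.of_apply, Matrix.cons_val, Int.cast_zero, Int.cast_one,
    Int.cast_neg]
  refine ⟨?_, ⟨?_, ?_, ?_, ?_, ?_, ?_⟩, ?_, ?_, ?_, ?_, ?_⟩ <;> linarith

theorem mem_tetraPiece₄ {x y : Ref} (hx : x ∈ refTet) (hy : y ∈ refTet)
    (h1 : y 0 ≤ x 0) (h2 : x 0 - x 1 - x 2 ≤ y 0 - y 1 - y 2) (h3 : y 1 ≤ x 1)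
    (h5 : x 1 - y 1 ≤ x 0 - y 0) :
    appendMeasurableEquiv 3 3 (x, y) ∈ tetraPiece₄.region := by
  obtain ⟨hx1, hx2, hx3, hx4⟩ := hx
  obtain ⟨hy1, hy2, hy3, hy4⟩ := hy
  rw [DuffyPiece.mem_region_iff, DuffyTree.mem_region_six_iff]
  simp only [tetraPiece₄, chainTree, Matrix.of_apply, Matrix.cons_val, Int.cast_zero, Int.cast_one,
    Int.cast_neg]
  refine ⟨?_, ⟨?_, ?_, ?_, ?_, ?_, ?_⟩, ?_, ?_, ?_, ?_, ?_⟩ <;> linarith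

theorem mem_tetraPiece₅ {x y : Ref} (hx : x ∈ refTet) (hy : y ∈ refTet)
    (h1 : y 0 ≤ x 0) (h2 : y 0 - y 1 - y 2 ≤ x 0 - x 1 - x 2) (h3 : y 1 ≤ x 1) (h4 : y 2 ≤ x 2) :
    appendMeasurableEquiv 3 3 (x, y) ∈ tetraPiece₅.region := by
  obtain ⟨hx1, hx2, hx3, hx4⟩ := hx
  obtain ⟨hy1, hy2, hy3, hy4⟩ := hy
  rw [DuffyPiece.mem_region_iff, DuffyTree.mem_region_six_iff]
  simp only [tetraPiece₅, chainTree, Matrix.of_apply, Matrix.cons_val, Int.cast_zero, Int.cast_one,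
    Int.cast_neg]
  refine ⟨?_, ⟨?_, ?_, ?_, ?_, ?_, ?_⟩, ?_, ?_, ?_, ?_, ?_⟩ <;> linarith

theorem mem_tetraPiece₆ {x y : Ref} (hx : x ∈ refTet) (hy : y ∈ refTet)
    (h1 : y 0 ≤ x 0) (h2 : y 0 - y 1 - y 2 ≤ x 0 - x 1 - x 2) (h3 : y 1 ≤ x 1) (h4 : x 2 ≤ y 2)
    (h5 : x 1 - y 1 ≤ x 0 - y 0) :
    appendMeasurableEquiv 3 3 (x, y) ∈ tetraPiece₆.region := by
  obtain ⟨hx1, hx2, hx3, hx4⟩ := hx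
  obtain ⟨hy1, hy2, hy3, hy4⟩ := hy
  rw [DuffyPiece.mem_region_iff, DuffyTree.mem_region_six_iff]
  simp only [tetraPiece₆, chainTree, Matrix.of_apply, Matrix.cons_val, Int.cast_zero, Int.cast_one,
    Int.cast_neg]
  refine ⟨?_, ⟨?_, ?_, ?_, ?_, ?_, ?_⟩, ?_, ?_, ?_, ?_, ?_⟩ <;> linarith

theorem mem_tetraPiece₇ {x y : Ref} (hx : x ∈ refTet) (hy : y ∈ refTet)
    (h1 : y 0 ≤ x 0) (h2 : x 0 - x 1 - x 2 ≤ y 0 - y 1 - y 2) (h3 : x 1 ≤ y 1) :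
    appendMeasurableEquiv 3 3 (x, y) ∈ tetraPiece₇.region := by
  obtain ⟨hx1, hx2, hx3, hx4⟩ := hx
  obtain ⟨hy1, hy2, hy3, hy4⟩ := hy
  rw [DuffyPiece.mem_region_iff, DuffyTree.mem_region_six_iff]
  simp only [tetraPiece₇, chainTree, Matrix.of_apply, Matrix.cons_val, Int.cast_zero, Int.cast_one,
    Int.cast_neg]
  refine ⟨?_, ⟨?_, ?_, ?_, ?_, ?_, ?_⟩, ?_, ?_, ?_, ?_, ?_⟩ <;> linarith

theorem mem_tetraPiece₈ {x y : Ref} (hx : x ∈ refTet) (hy : y ∈ refTet)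
    (h1 : y 0 ≤ x 0) (h2 : y 0 - y 1 - y 2 ≤ x 0 - x 1 - x 2) (h3 : x 1 ≤ y 1) (h4 : x 2 ≤ y 2) :
    appendMeasurableEquiv 3 3 (x, y) ∈ tetraPiece₈.region := by
  obtain ⟨hx1, hx2, hx3, hx4⟩ := hx
  obtain ⟨hy1, hy2, hy3, hy4⟩ := hy
  rw [DuffyPiece.mem_region_iff, DuffyTree.mem_region_six_iff]
  simp only [tetraPiece₈, chainTree, Matrix.of_apply, Matrix.cons_val, Int.cast_zero, Int.cast_one,
    Int.cast_neg]
  refine ⟨?_, ⟨?_, ?_, ?_, ?_, ?_, ?_⟩, ?_, ?_, ?_, ?_, ?_⟩ <;> linarith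

theorem mem_tetraPiece₉ {x y : Ref} (hx : x ∈ refTet) (hy : y ∈ refTet)
    (h1 : y 0 ≤ x 0) (h2 : y 0 - y 1 - y 2 ≤ x 0 - x 1 - x 2) (h3 : x 1 ≤ y 1) (h4 : y 2 ≤ x 2) :
    appendMeasurableEquiv 3 3 (x, y) ∈ tetraPiece₉.region := by
  obtain ⟨hx1, hx2, hx3, hx4⟩ := hx
  obtain ⟨hy1, hy2, hy3, hy4⟩ := hy
  rw [DuffyPiece.mem_region_iff, DuffyTree.mem_region_six_iff]
  simp only [tetraPiece₉, forkTree, Matrix.of_apply, Matrix.cons_val, Int.cast_zero, Int.cast_one,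
    Int.cast_neg]
  refine ⟨?_, ⟨?_, ?_, ?_, ?_, ?_, ?_⟩, ?_, ?_, ?_, ?_, ?_⟩ <;> linarith

/-! ### Case distinctions for the four coverings -/

theorem vertexPiece_cover (x : Ref) (hx : x ∈ refTet) (y : Ref) (hy : y ∈ refTet) :
    ∃ i, appendMeasurableEquiv 3 3 (x, y) ∈ (vertexPiece i).region := by
  rcases le_total (y 0) (x 0) with h | h
  · exact ⟨0, mem_vertexPiece₁ hx hy h⟩
  · exact ⟨1, (vertexPiece₁.mem_swap_region_iff x y).2 (mem_vertexPiece₁ hy hx h)⟩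

theorem edgePiece_cover (x : Ref) (hx : x ∈ refTet) (y : Ref) (hy : y ∈ refTet) :
    ∃ i, appendMeasurableEquiv 3 3 (x, y) ∈ (edgePiece i).region := by
  rcases le_total (y 0) (x 0) with h | h <;>
  rcases le_total (x 0 - x 1 - x 2) (y 0 - y 1 - y 2) with h' | h'
  · exact ⟨0, mem_edgePiece₁ hx hy h h'⟩
  · exact ⟨1, mem_edgePiece₂ hx hy h h'⟩
  · exact ⟨3, (edgePiece₂.mem_swap_region_iff x y).2 (mem_edgePiece₂ hy hx h h')⟩
  · exact ⟨2, (edgePiece₁.mem_swap_region_iff x y).2 (mem_edgePiece₁ hy hx h h')⟩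

/-- The barycentric coordinates of a reference point `x` are `1 - x₀, x₀ - x₁ - x₂, x₁, x₂`.
Comparing the first three of them between the two points gives eight cases; most are subdivided by
ordering the tree coordinates that are still unordered. -/
theorem facePiece_cover (x : Ref) (hx : x ∈ refTet) (y : Ref) (hy : y ∈ refTet) :
    ∃ i, appendMeasurableEquiv 3 3 (x, y) ∈ (facePiece i).region := by
  rcases le_total (y 0) (x 0) with ha | ha <;>
  rcases le_total (x 0 - x 1 - x 2) (y 0 - y 1 - y 2) with hb | hb <;>
  rcases le_total (x 1) (y 1) with hc | hc
  · exact ⟨6, mem_facePiece₇ hx hy ha hb hc⟩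
  · rcases le_total (x 0 - y 0) (x 1 - y 1) with h | h
    · rcases le_total (x 1 - y 1) (x 0 - y 0 + y 2) with h' | h'
      · exact ⟨2, mem_facePiece₃ hx hy ha hb hc h h'⟩
      · exact ⟨0, mem_facePiece₁ hx hy ha hc h'⟩
    · exact ⟨5, mem_facePiece₆ hx hy ha hb hc h⟩
  · exact ⟨15, mem_facePiece₁₆ hx hy ha hb hc⟩
  · rcases le_total (x 0 - y 0) (x 1 - y 1) with h | h
    · exact ⟨1, mem_facePiece₂ hx hy ha hb hc h⟩
    · rcases le_total (x 0 - y 0) (x 1 - y 1 + x 2) with h' | h'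
      · exact ⟨4, mem_facePiece₅ hx hy ha hb hc h h'⟩
      · exact ⟨3, mem_facePiece₄ hx hy ha hb hc h'⟩
  · rcases le_total (y 0 - x 0) (y 1 - x 1) with h | h
    · exact ⟨8, (facePiece₂.mem_swap_region_iff x y).2 (mem_facePiece₂ hy hx ha hb hc h)⟩
    · rcases le_total (y 0 - x 0) (y 1 - x 1 + y 2) with h' | h'
      · exact ⟨11, (facePiece₅.mem_swap_region_iff x y).2 (mem_facePiece₅ hy hx ha hb hc h h')⟩
      · exact ⟨10, (facePiece₄.mem_swap_region_iff x y).2 (mem_facePiece₄ hy hx ha hb hc h')⟩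
  -- This is the mirror image of the case covered by piece `16`. Instead of the transpose of that
  -- piece two others cover it, of the same total volume: `1/720 + 1/360 = 1/240`.
  · rcases le_total (y 0 - x 0 + (x 1 - y 1)) (y 2) with h | h
    · exact ⟨14, mem_facePiece₁₅ hx hy ha hb hc h⟩
    · exact ⟨16, mem_facePiece₁₇ hx hy ha hc h⟩
  · rcases le_total (y 0 - x 0) (y 1 - x 1) with h | h
    · rcases le_total (y 1 - x 1) (y 0 - x 0 + x 2) with h' | h'
      · exact ⟨9, (facePiece₃.mem_swap_region_iff x y).2 (mem_facePiece₃ hy hx ha hb hc h h')⟩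
      · exact ⟨7, (facePiece₁.mem_swap_region_iff x y).2 (mem_facePiece₁ hy hx ha hc h')⟩
    · exact ⟨12, (facePiece₆.mem_swap_region_iff x y).2 (mem_facePiece₆ hy hx ha hb hc h)⟩
  · exact ⟨13, (facePiece₇.mem_swap_region_iff x y).2 (mem_facePiece₇ hy hx ha hb hc)⟩

theorem tetraHalfPiece_cover {x y : Ref} (hx : x ∈ refTet) (hy : y ∈ refTet) (ha : y 0 ≤ x 0) :
    ∃ m, appendMeasurableEquiv 3 3 (x, y) ∈ (tetraHalfPiece m).region := by
  rcases le_total (x 0 - x 1 - x 2) (y 0 - y 1 - y 2) with hb | hb <;>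
  rcases le_total (x 1) (y 1) with hc | hc <;>
  rcases le_total (x 2) (y 2) with hd | hd
  -- All four barycentric coordinates are ordered the same way and both families sum to one, so the
  -- points coincide and the reverse inequality is available too.
  · exact ⟨7, mem_tetraPiece₈ hx hy ha (by linarith) hc hd⟩
  · exact ⟨6, mem_tetraPiece₇ hx hy ha hb hc⟩
  · exact ⟨1, mem_tetraPiece₂ hx hy ha hb hc hd⟩
  · rcases le_total (x 0 - y 0) (x 1 - y 1) with h | h
    · exact ⟨0, mem_tetraPiece₁ hx hy ha hb hc hd h⟩
    · exact ⟨3, mem_tetraPiece₄ hx hy ha hb hc h⟩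
  · exact ⟨7, mem_tetraPiece₈ hx hy ha hb hc hd⟩
  · exact ⟨8, mem_tetraPiece₉ hx hy ha hb hc hd⟩
  · rcases le_total (x 0 - y 0) (x 1 - y 1) with h | h
    · exact ⟨2, mem_tetraPiece₃ hx hy ha hb hc h⟩
    · exact ⟨5, mem_tetraPiece₆ hx hy ha hb hc hd h⟩
  · exact ⟨4, mem_tetraPiece₅ hx hy ha hb hc hd⟩

theorem tetraPiece_cover (x : Ref) (hx : x ∈ refTet) (y : Ref) (hy : y ∈ refTet) :
    ∃ i, appendMeasurableEquiv 3 3 (x, y) ∈ (tetraPiece i).region := by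
  rcases le_total (y 0) (x 0) with h | h
  · obtain ⟨m, hm⟩ := tetraHalfPiece_cover hx hy h
    exact ⟨(false, m), hm⟩
  · obtain ⟨m, hm⟩ := tetraHalfPiece_cover hy hx h
    exact ⟨(true, m), ((tetraHalfPiece m).mem_swap_region_iff x y).2 hm⟩

/-! ### The parametrization of a tetrahedron -/

namespace Tet

variable (t : Tet)

/-- The linear part `x ↦ M_t x` of `χ_t`. -/
noncomputable def lin : Ref →ₗ[ℝ] E3 :=
  (WithLp.linearEquiv 2 ℝ (Fin 3 → ℝ)).symm.toLinearMap ∘ₗ Matrix.toLin' t.matrix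

theorem chi_eq (x : Ref) : t.chi x = t.lin x + t.points 0 := rfl

theorem lin_apply (x : Ref) :
    t.lin x = x 0 • (t.points 1 - t.points 0) + x 1 • (t.points 2 - t.points 1) +
      x 2 • (t.points 3 - t.points 1) := by
  ext i
  simp [lin, Tet.matrix, Matrix.mulVec, dotProduct, Fin.sum_univ_three]
  ring

/-- The weights are the barycentric coordinates; `refTet` is exactly the set where all four are
nonnegative. -/
theorem chi_eq_sum (x : Ref) :
    t.chi x = ∑ i, ![1 - x 0, x 0 - x 1 - x 2, x 1, x 2] i • t.points i := by
  rw [chi_eq, lin_apply, Fin.sum_univ_four]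
  simp only [Matrix.cons_val]
  module

theorem continuous_chi : Continuous t.chi := by
  have h : Continuous t.lin := LinearMap.continuous_of_finiteDimensional _
  exact h.add continuous_const

/-- `M_t x` is a combination of the vertices with weights `-x₀, x₀ - x₁ - x₂, x₁, x₂` of sum zero,
and affine independence makes such weights vanish. -/
theorem lin_injective : Function.Injective t.lin := by
  rw [← LinearMap.ker_eq_bot, LinearMap.ker_eq_bot']
  intro x hx
  have h := t.independent.eq_zero_of_sum_eq_zero (s := Finset.univ)
    (w := ![- x 0, x 0 - x 1 - x 2, x 1, x 2]) (by simp [Fin.sum_univ_four]; ring)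
    (by
      rw [← hx, lin_apply, Fin.sum_univ_four]
      simp only [Matrix.cons_val]
      module)
  have h0 := h 0 (Finset.mem_univ _)
  have h1 := h 2 (Finset.mem_univ _)
  have h2 := h 3 (Finset.mem_univ _)
  simp only [Matrix.cons_val, neg_eq_zero] at h0 h1 h2
  ext i
  fin_cases i
  exacts [h0, h1, h2]

theorem chi_injective : Function.Injective t.chi := fun _ _ h =>
  t.lin_injective (add_right_cancel (b := t.points 0) h)

theorem det_ne_zero : t.matrix.det ≠ 0 := by
  have h : Function.Injective t.matrix.mulVec := fun x y hxy =>
    t.lin_injective (congrArg (WithLp.toLp 2) hxy)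
  exact ((Matrix.isUnit_iff_isUnit_det _).1 (Matrix.mulVec_injective_iff_isUnit.1 h)).ne_zero

theorem chi_mem_body {x : Ref} (hx : x ∈ refTet) : t.chi x ∈ t.body := by
  obtain ⟨h1, h2, h3, h4⟩ := hx
  rw [chi_eq_sum]
  refine (convex_convexHull ℝ _).sum_mem (fun i _ => ?_) ?_ fun i _ =>
    subset_convexHull ℝ _ (mem_range_self i)
  · fin_cases i <;> simp <;> linarith
  · simp [Fin.sum_univ_four]; ring

/-- For the harder inclusion: the image is convex and contains the vertices, as images of `(0,0,0)`,
`(1,0,0)`, `(1,1,0)` and `(1,0,1)`. -/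
theorem image_chi_refTet : t.chi '' refTet = t.body := by
  refine Subset.antisymm (image_subset_iff.2 fun x hx => t.chi_mem_body hx) ?_
  refine convexHull_min ?_ ?_
  · rintro _ ⟨i, rfl⟩
    have key : ∀ x : Ref, x ∈ refTet → t.chi x = t.points i → t.points i ∈ t.chi '' refTet :=
      fun x hx h => ⟨x, hx, h⟩
    fin_cases i
    · exact key ![0, 0, 0] (by simp [refTet]) (by simp [chi_eq_sum, Fin.sum_univ_four])
    · exact key ![1, 0, 0] (by simp [refTet]) (by simp [chi_eq_sum, Fin.sum_univ_four])
    · exact key ![1, 1, 0] (by simp [refTet]) (by simp [chi_eq_sum, Fin.sum_univ_four])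
    · exact key ![1, 0, 1] (by simp [refTet]) (by simp [chi_eq_sum, Fin.sum_univ_four])
  · rintro _ ⟨x, ⟨x1, x2, x3, x4⟩, rfl⟩ _ ⟨y, ⟨y1, y2, y3, y4⟩, rfl⟩ a b ha hb hab
    refine ⟨a • x + b • y, ⟨?_, ?_, ?_, ?_⟩, ?_⟩
    · simp only [Pi.add_apply, Pi.smul_apply, smul_eq_mul]; positivity
    · simp only [Pi.add_apply, Pi.smul_apply, smul_eq_mul]; positivity
    · simp only [Pi.add_apply, Pi.smul_apply, smul_eq_mul]
      nlinarith [mul_le_mul_of_nonneg_left x3 ha, mul_le_mul_of_nonneg_left y3 hb]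
    · simp only [Pi.add_apply, Pi.smul_apply, smul_eq_mul]
      nlinarith [mul_le_mul_of_nonneg_left x4 ha, mul_le_mul_of_nonneg_left y4 hb]
    · rw [chi_eq, chi_eq, chi_eq, map_add, map_smul, map_smul, smul_add, smul_add,
        add_add_add_comm, ← add_smul, hab, one_smul]

theorem measurableEmbedding_chi : MeasurableEmbedding t.chi :=
  t.continuous_chi.measurableEmbedding t.chi_injective

theorem map_chi_volume :
    (volume : Measure Ref).map t.chi = ENNReal.ofReal |t.matrix.det⁻¹| • volume := by
  -- A linear map, then the volume-preserving passage to the Euclidean norm, then a translation;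
  -- only the first rescales the measure.
  have h : t.chi = (fun v : E3 => v + t.points 0) ∘ (WithLp.toLp 2) ∘ Matrix.toLin' t.matrix := rfl
  have hl : Measurable (Matrix.toLin' t.matrix) :=
    (LinearMap.continuous_of_finiteDimensional _).measurable
  have hp := PiLp.volume_preserving_toLp (Fin 3)
  rw [h, ← Measure.map_map (by fun_prop) (hp.measurable.comp hl),
    ← Measure.map_map hp.measurable hl,
    Real.map_matrix_volume_pi_eq_smul_volume_pi t.det_ne_zero, Measure.map_smul, hp.map_eq,
    Measure.map_smul, map_add_right_eq_self]

end Tet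

/-- Change of variables in both arguments. -/
theorem map_chi_prod_volume (t₁ t₂ : Tet) :
    (volume : Measure (Ref × Ref)).map (Prod.map t₁.chi t₂.chi) =
      ENNReal.ofReal (|t₁.matrix.det| * |t₂.matrix.det|)⁻¹ • volume := by
  rw [Measure.volume_eq_prod, ← Measure.map_prod_map _ _ t₁.continuous_chi.measurable
    t₂.continuous_chi.measurable, t₁.map_chi_volume, t₂.map_chi_volume, Measure.prod_smul_left,
    Measure.prod_smul_right, smul_smul, ← ENNReal.ofReal_mul (abs_nonneg _), abs_inv, abs_inv,
    mul_inv, Measure.volume_eq_prod]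

theorem measurable_kTilde (s : ℝ) (φ₁ φ₂ ψ₁ ψ₂ : E3 →ᵃ[ℝ] ℝ) (t₁ t₂ : Tet) :
    Measurable (kTilde s φ₁ φ₂ ψ₁ ψ₂ t₁ t₂) := by
  have h₁ := t₁.continuous_chi
  have h₂ := t₂.continuous_chi
  have a₁ : Continuous φ₁ := φ₁.continuous_of_finiteDimensional
  have a₂ : Continuous φ₂ := φ₂.continuous_of_finiteDimensional
  have b₁ : Continuous ψ₁ := ψ₁.continuous_of_finiteDimensional
  have b₂ : Continuous ψ₂ := ψ₂.continuous_of_finiteDimensional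
  unfold kTilde
  refine Measurable.mul_const (Measurable.mul_const (Measurable.div ?_ ?_) _) _
  · exact Continuous.measurable (by fun_prop)
  · exact (Continuous.measurable (by fun_prop)).pow_const _

/-- Integrability and value of the singular integral in reference coordinates. -/
theorem integrableOn_and_singularIntegral_eq (s : ℝ) (t₁ t₂ : Tet) (φ ψ : E3 → ℝ)
    (φ₁ φ₂ ψ₁ ψ₂ : E3 →ᵃ[ℝ] ℝ)
    (hφ₁ : EqOn φ φ₁ t₁.body) (hφ₂ : EqOn φ φ₂ t₂.body)
    (hψ₁ : EqOn ψ ψ₁ t₁.body) (hψ₂ : EqOn ψ ψ₂ t₂.body)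
    (hint : IntegrableOn (kTilde s φ₁ φ₂ ψ₁ ψ₂ t₁ t₂) (refTet ×ˢ refTet)) :
    IntegrableOn (fun p : E3 × E3 => k1 s φ ψ p.1 p.2) (t₁.body ×ˢ t₂.body) ∧
      singularIntegral s φ ψ t₁ t₂ =
        ∫ p in refTet ×ˢ refTet, kTilde s φ₁ φ₂ ψ₁ ψ₂ t₁ t₂ p := by
  set c := |t₁.matrix.det| * |t₂.matrix.det| with hc
  have hc0 : 0 < c := mul_pos (abs_pos.2 t₁.det_ne_zero) (abs_pos.2 t₂.det_ne_zero)
  have hemb : MeasurableEmbedding (Prod.map t₁.chi t₂.chi) :=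
    t₁.measurableEmbedding_chi.prodMap t₂.measurableEmbedding_chi
  have hpre : Prod.map t₁.chi t₂.chi ⁻¹' (t₁.body ×ˢ t₂.body) = refTet ×ˢ refTet := by
    rw [← t₁.image_chi_refTet, ← t₂.image_chi_refTet, ← prodMap_image_prod]
    exact preimage_image_eq _ hemb.injective
  -- On the reference product `φ` and `ψ` may be replaced by their affine representations, so the
  -- kernels differ only by the constant Jacobian `c`.
  have hk : EqOn (fun p : Ref × Ref => k1 s φ ψ (t₁.chi p.1) (t₂.chi p.2))
      (fun p => c⁻¹ * kTilde s φ₁ φ₂ ψ₁ ψ₂ t₁ t₂ p) (refTet ×ˢ refTet) := by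
    rintro ⟨x, y⟩ ⟨hx, hy⟩
    have hx := t₁.chi_mem_body hx
    have hy := t₂.chi_mem_body hy
    simp only [k1, kTilde, hφ₁ hx, hφ₂ hy, hψ₁ hx, hψ₂ hy]
    rw [mul_assoc _ |t₁.matrix.det|, ← hc]
    field_simp
  have hmeas : MeasurableSet (refTet ×ˢ refTet) :=
    isClosed_refTet.measurableSet.prod isClosed_refTet.measurableSet
  have hvol : (volume : Measure (E3 × E3)) =
      ENNReal.ofReal c • (volume : Measure (Ref × Ref)).map (Prod.map t₁.chi t₂.chi) := by
    rw [map_chi_prod_volume, smul_smul, ← ENNReal.ofReal_mul hc0.le, mul_inv_cancel₀ hc0.ne',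
      ENNReal.ofReal_one, one_smul]
  have hi : IntegrableOn (fun p : E3 × E3 => k1 s φ ψ p.1 p.2) (t₁.body ×ˢ t₂.body) := by
    rw [hvol, IntegrableOn, Measure.restrict_smul]
    refine Integrable.smul_measure ?_ ENNReal.ofReal_ne_top
    rw [← IntegrableOn, hemb.integrableOn_map_iff, hpre]
    exact (integrableOn_congr_fun hk hmeas).2 (hint.const_mul _)
  refine ⟨hi, ?_⟩
  rw [singularIntegral, ← setIntegral_prod _ hi, ← Measure.volume_eq_prod, hvol,
    Measure.restrict_smul, integral_smul_measure, hemb.setIntegral_map, hpre]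
  refine (congrArg _ (setIntegral_congr_fun hmeas hk)).trans ?_
  rw [integral_const_mul, ENNReal.toReal_ofReal hc0.le, smul_eq_mul, mul_inv_cancel_left₀ hc0.ne']

open scoped ContDiff

/-! ### The structure of the pulled back kernel -/

/-- The linear map `(x, y) ↦ M_{t₁} x - M_{t₂} y`. -/
noncomputable def diffMap (t₁ t₂ : Tet) : Ref × Ref →ₗ[ℝ] E3 := t₁.lin.coprod (-t₂.lin)

/-- The linear form `(x, y) ↦ φ₁'(M_{t₁} x) - φ₂'(M_{t₂} y)`. -/
noncomputable def diffForm (t₁ t₂ : Tet) (φ₁ φ₂ : E3 →ᵃ[ℝ] ℝ) : Ref × Ref →ₗ[ℝ] ℝ :=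
  (φ₁.linear ∘ₗ t₁.lin).coprod (-(φ₂.linear ∘ₗ t₂.lin))

theorem diffMap_apply (t₁ t₂ : Tet) (p : Ref × Ref) :
    diffMap t₁ t₂ p = t₁.lin p.1 - t₂.lin p.2 := by
  simp [diffMap, sub_eq_add_neg]

theorem diffForm_apply (t₁ t₂ : Tet) (φ₁ φ₂ : E3 →ᵃ[ℝ] ℝ) (p : Ref × Ref) :
    diffForm t₁ t₂ φ₁ φ₂ p = φ₁.linear (t₁.lin p.1) - φ₂.linear (t₂.lin p.2) := by
  simp [diffForm, sub_eq_add_neg]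

theorem chi_sub_chi {t₁ t₂ : Tet} (h : t₁.points 0 = t₂.points 0) (p : Ref × Ref) :
    t₁.chi p.1 - t₂.chi p.2 = diffMap t₁ t₂ p := by
  rw [diffMap_apply, Tet.chi_eq, Tet.chi_eq, h, add_sub_add_right_eq_sub]

theorem affine_chi_sub {t₁ t₂ : Tet} {φ₁ φ₂ : E3 →ᵃ[ℝ] ℝ}
    (hφ : φ₁ (t₁.points 0) = φ₂ (t₂.points 0)) (p : Ref × Ref) :
    φ₁ (t₁.chi p.1) - φ₂ (t₂.chi p.2) = diffForm t₁ t₂ φ₁ φ₂ p := by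
  have h (φ : E3 →ᵃ[ℝ] ℝ) (t : Tet) (x : Ref) :
      φ (t.chi x) = φ.linear (t.lin x) + φ (t.points 0) := by
    rw [Tet.chi_eq, ← vadd_eq_add, AffineMap.map_vadd, vadd_eq_add]
  rw [h, h, diffForm_apply, hφ, add_sub_add_right_eq_sub]

/-- Hypotheses under which `k̃₁` is homogeneous: the first vertices and the values of the basis
functions there agree. -/
structure Compatible (t₁ t₂ : Tet) (φ₁ φ₂ ψ₁ ψ₂ : E3 →ᵃ[ℝ] ℝ) : Prop where
  points : t₁.points 0 = t₂.points 0
  left : φ₁ (t₁.points 0) = φ₂ (t₂.points 0)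
  right : ψ₁ (t₁.points 0) = ψ₂ (t₂.points 0)

section Kernel

variable {s : ℝ} {t₁ t₂ : Tet} {φ₁ φ₂ ψ₁ ψ₂ : E3 →ᵃ[ℝ] ℝ}

theorem Compatible.kTilde_eq (h : Compatible t₁ t₂ φ₁ φ₂ ψ₁ ψ₂) (p : Ref × Ref) :
    kTilde s φ₁ φ₂ ψ₁ ψ₂ t₁ t₂ p =
      diffForm t₁ t₂ φ₁ φ₂ p * diffForm t₁ t₂ ψ₁ ψ₂ p / ‖diffMap t₁ t₂ p‖ ^ (3 + 2 * s) *
        |t₁.matrix.det| * |t₂.matrix.det| := by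
  rw [kTilde, affine_chi_sub h.left, affine_chi_sub h.right, chi_sub_chi h.points]

/-- Two linear forms contribute degree `2`, the denominator `-(3 + 2s)`. -/
theorem Compatible.kTilde_smul (h : Compatible t₁ t₂ φ₁ φ₂ ψ₁ ψ₂) {r : ℝ} (hr : 0 < r)
    (p : Ref × Ref) :
    kTilde s φ₁ φ₂ ψ₁ ψ₂ t₁ t₂ (r • p) = r ^ (-1 - 2 * s) * kTilde s φ₁ φ₂ ψ₁ ψ₂ t₁ t₂ p := by
  have e : r ^ (-1 - 2 * s) = r * r / r ^ (3 + 2 * s) := by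
    rw [show -1 - 2 * s = (2 : ℕ) - (3 + 2 * s) by push_cast; ring, Real.rpow_sub hr,
      Real.rpow_natCast, sq]
  rw [h.kTilde_eq, h.kTilde_eq, map_smul, map_smul, map_smul, norm_smul, Real.norm_of_nonneg hr.le,
    Real.mul_rpow hr.le (norm_nonneg _), e, smul_eq_mul, smul_eq_mul]
  rw [mul_mul_mul_comm, mul_div_mul_comm]
  ring

/-- `k̃₁` is invariant under translations in the direction of `v` if `M_{t₁} v = M_{t₂} v` and the
basis functions vary equally in this direction. -/
theorem Compatible.kTilde_add (h : Compatible t₁ t₂ φ₁ φ₂ ψ₁ ψ₂) {v : Ref}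
    (hv : t₁.lin v = t₂.lin v) (hφ : φ₁.linear (t₁.lin v) = φ₂.linear (t₁.lin v))
    (hψ : ψ₁.linear (t₁.lin v) = ψ₂.linear (t₁.lin v)) (p : Ref × Ref) :
    kTilde s φ₁ φ₂ ψ₁ ψ₂ t₁ t₂ ((v, v) + p) = kTilde s φ₁ φ₂ ψ₁ ψ₂ t₁ t₂ p := by
  have h1 : diffForm t₁ t₂ φ₁ φ₂ (v, v) = 0 := by
    rw [diffForm_apply, ← hv, hφ, sub_self]
  have h2 : diffForm t₁ t₂ ψ₁ ψ₂ (v, v) = 0 := by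
    rw [diffForm_apply, ← hv, hψ, sub_self]
  have h3 : diffMap t₁ t₂ (v, v) = 0 := by
    rw [diffMap_apply, ← hv, sub_self]
  rw [h.kTilde_eq, h.kTilde_eq, map_add, map_add, map_add, h1, h2, h3, zero_add, zero_add,
    zero_add]

/-- The Euclidean norm is analytic off the origin, and so are its nonzero real powers. The
smoothness exponent `ω` stands for analyticity. -/
theorem Compatible.contDiffAt_kTilde (h : Compatible t₁ t₂ φ₁ φ₂ ψ₁ ψ₂) {p : Ref × Ref}
    (hp : diffMap t₁ t₂ p ≠ 0) : ContDiffAt ℝ ω (kTilde s φ₁ φ₂ ψ₁ ψ₂ t₁ t₂) p := by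
  have e : kTilde s φ₁ φ₂ ψ₁ ψ₂ t₁ t₂ = _ := funext h.kTilde_eq
  rw [e]
  have hφ : ContDiffAt ℝ ω (diffForm t₁ t₂ φ₁ φ₂) p :=
    (diffForm t₁ t₂ φ₁ φ₂).toContinuousLinearMap.contDiff.contDiffAt
  have hψ : ContDiffAt ℝ ω (diffForm t₁ t₂ ψ₁ ψ₂) p :=
    (diffForm t₁ t₂ ψ₁ ψ₂).toContinuousLinearMap.contDiff.contDiffAt
  have hz : ContDiffAt ℝ ω (diffMap t₁ t₂) p :=
    (diffMap t₁ t₂).toContinuousLinearMap.contDiff.contDiffAt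
  have hn : ‖diffMap t₁ t₂ p‖ ≠ 0 := norm_ne_zero_iff.2 hp
  have hpow : ‖diffMap t₁ t₂ p‖ ^ (3 + 2 * s) ≠ 0 :=
    (Real.rpow_pos_of_pos (norm_pos_iff.2 hp) _).ne'
  exact (((hφ.mul hψ).div ((hz.norm ℝ hp).rpow_const_of_ne hn) hpow).mul contDiffAt_const).mul
    contDiffAt_const

/-- The reduced integrands are analytic where the two points stay apart. -/
theorem Compatible.contDiffAt_kTilde_comp (h : Compatible t₁ t₂ φ₁ φ₂ ψ₁ ψ₂) {n : ℕ}
    {D : (Fin n → ℝ) → Ref × Ref} {J : (Fin n → ℝ) → ℝ} (hD : ContDiff ℝ ω D) (hJ : ContDiff ℝ ω J)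
    {η : Fin n → ℝ} (hη : diffMap t₁ t₂ (D η) ≠ 0) :
    ContDiffAt ℝ ω (fun η => kTilde s φ₁ φ₂ ψ₁ ψ₂ t₁ t₂ (D η) * J η) η :=
  ((h.contDiffAt_kTilde hη).comp η hD.contDiffAt).mul hJ.contDiffAt

theorem contDiff_ref {n : ℕ} {a b c : (Fin n → ℝ) → ℝ} (ha : ContDiff ℝ ω a)
    (hb : ContDiff ℝ ω b) (hc : ContDiff ℝ ω c) :
    ContDiff ℝ ω fun η => (![a η, b η, c η] : Ref) := by
  rw [contDiff_pi]
  intro i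
  fin_cases i
  exacts [ha, hb, hc]

end Kernel

/-! ### Analyticity of the parametrizations and Jacobians -/

theorem contDiff_swap {n : ℕ} {D : (Fin n → ℝ) → Ref × Ref} (hD : ContDiff ℝ ω D) :
    ContDiff ℝ ω fun η => (D η).swap := hD.snd.prodMk hD.fst

theorem contDiff_vertexMap (m : Fin 2) : ContDiff ℝ ω fun η => vertexMap η m := by
  fin_cases m <;>
  exact (contDiff_ref (by fun_prop) (by fun_prop) (by fun_prop)).prodMk
    (contDiff_ref (by fun_prop) (by fun_prop) (by fun_prop))

theorem contDiff_edgeHalf (m : Fin 2) : ContDiff ℝ ω fun η => edgeHalf η m := by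
  fin_cases m <;>
  exact (contDiff_ref (by fun_prop) (by fun_prop) (by fun_prop)).prodMk
    (contDiff_ref (by fun_prop) (by fun_prop) (by fun_prop))

theorem contDiff_edgeMap (m : Fin 4) : ContDiff ℝ ω fun η => edgeMap η m := by
  fin_cases m
  exacts [contDiff_edgeHalf 0, contDiff_edgeHalf 1, contDiff_swap (contDiff_edgeHalf 0),
    contDiff_swap (contDiff_edgeHalf 1)]

theorem contDiff_edgeJac (m : Fin 4) : ContDiff ℝ ω fun η => edgeJac η m := by
  have h₁ : ContDiff ℝ ω fun η : Fin 4 → ℝ => η 1 ^ 2 * η 2 := by fun_prop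
  have h₂ : ContDiff ℝ ω fun η : Fin 4 → ℝ => η 0 * η 2 := by fun_prop
  fin_cases m
  exacts [h₁, h₂, h₁, h₂]

theorem contDiff_faceHalf (m : Fin 7) : ContDiff ℝ ω fun η => faceHalf η m := by
  fin_cases m <;>
  exact (contDiff_ref (by fun_prop) (by fun_prop) (by fun_prop)).prodMk
    (contDiff_ref (by fun_prop) (by fun_prop) (by fun_prop))

theorem contDiff_faceMap (m : Fin 17) : ContDiff ℝ ω fun η => faceMap η m := by
  fin_cases m
  · exact contDiff_faceHalf 0
  · exact contDiff_faceHalf 1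
  · exact contDiff_faceHalf 2
  · exact contDiff_faceHalf 3
  · exact contDiff_faceHalf 4
  · exact contDiff_faceHalf 5
  · exact contDiff_faceHalf 6
  · exact contDiff_swap (contDiff_faceHalf 0)
  · exact contDiff_swap (contDiff_faceHalf 1)
  · exact contDiff_swap (contDiff_faceHalf 2)
  · exact contDiff_swap (contDiff_faceHalf 3)
  · exact contDiff_swap (contDiff_faceHalf 4)
  · exact contDiff_swap (contDiff_faceHalf 5)
  · exact contDiff_swap (contDiff_faceHalf 6)
  · exact (contDiff_ref (by fun_prop) (by fun_prop) (by fun_prop)).prodMk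
      (contDiff_ref (by fun_prop) (by fun_prop) (by fun_prop))
  · exact (contDiff_ref contDiff_const contDiff_const (by fun_prop)).prodMk
      (contDiff_ref (by fun_prop) (by fun_prop) (by fun_prop))
  · exact (contDiff_ref (by fun_prop) (by fun_prop) (by fun_prop)).prodMk
      (contDiff_ref contDiff_const contDiff_const (by fun_prop))

theorem contDiff_faceJac (m : Fin 17) : ContDiff ℝ ω fun η => faceJac η m := by
  unfold faceJac
  split_ifs <;> fun_prop

theorem contDiff_tetraHalf (m : Fin 9) : ContDiff ℝ ω fun η => tetraHalf η m := by
  fin_cases m <;>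
  exact (contDiff_ref (by fun_prop) (by fun_prop) (by fun_prop)).prodMk
    (contDiff_ref (by fun_prop) (by fun_prop) (by fun_prop))

theorem contDiff_tetraMap (i : Bool × Fin 9) : ContDiff ℝ ω fun η => tetraMap η i := by
  obtain ⟨b, m⟩ := i
  cases b
  · exact contDiff_tetraHalf m
  · exact contDiff_swap (contDiff_tetraHalf m)

theorem contDiff_tetraJac (m : Fin 9) : ContDiff ℝ ω fun η => tetraJac η m := by
  unfold tetraJac
  split_ifs <;> fun_prop

theorem contDiff_vertexJac : ContDiff ℝ ω vertexJac := by
  unfold vertexJac; fun_prop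

/-! ### The points stay apart on the reduced cubes -/

/-- If the tetrahedra meet only in the image of `W`, on which both parametrizations agree, then
points of the reference tetrahedra with the same image coincide and lie in `W`. -/
theorem mem_and_eq_of_diffMap_eq_zero {t₁ t₂ : Tet} (h0 : t₁.points 0 = t₂.points 0) {W : Set Ref}
    (hW : ∀ w ∈ W, t₁.lin w = t₂.lin w) (hinter : t₁.body ∩ t₂.body ⊆ t₁.chi '' W)
    {x y : Ref} (hx : x ∈ refTet) (hy : y ∈ refTet) (h : diffMap t₁ t₂ (x, y) = 0) :
    x ∈ W ∧ x = y := by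
  have hxy : t₁.chi x = t₂.chi y := sub_eq_zero.1 ((chi_sub_chi h0 (x, y)).trans h)
  obtain ⟨w, hw, hwx⟩ := hinter ⟨t₁.chi_mem_body hx, hxy ▸ t₂.chi_mem_body hy⟩
  have e1 : w = x := t₁.chi_injective hwx
  have e2 : t₂.chi w = t₂.chi y := by
    rw [← hxy, ← hwx, Tet.chi_eq, Tet.chi_eq, hW w hw, h0]
  exact ⟨e1 ▸ hw, e1.symm.trans (t₂.chi_injective e2)⟩

theorem lin_eq_lin_of_edge {t₁ t₂ : Tet} (h0 : t₁.points 0 = t₂.points 0)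
    (h1 : t₁.points 1 = t₂.points 1) {w : Ref} (hw : w 1 = 0 ∧ w 2 = 0) :
    t₁.lin w = t₂.lin w := by
  rw [Tet.lin_apply, Tet.lin_apply, hw.1, hw.2, h0, h1]
  simp

theorem lin_eq_lin_of_face {t₁ t₂ : Tet} (h0 : t₁.points 0 = t₂.points 0)
    (h1 : t₁.points 1 = t₂.points 1) (h2 : t₁.points 2 = t₂.points 2) {w : Ref} (hw : w 2 = 0) :
    t₁.lin w = t₂.lin w := by
  rw [Tet.lin_apply, Tet.lin_apply, hw, h0, h1, h2]
  simp

theorem segment_subset_image_chi (t : Tet) :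
    segment ℝ (t.points 0) (t.points 1) ⊆ t.chi '' {w | w 1 = 0 ∧ w 2 = 0} := by
  rintro _ ⟨a, b, -, -, hab, rfl⟩
  refine ⟨![b, 0, 0], ⟨rfl, rfl⟩, ?_⟩
  rw [Tet.chi_eq_sum, Fin.sum_univ_four, ← hab]
  simp

theorem convexHull_subset_image_chi (t : Tet) :
    convexHull ℝ {t.points 0, t.points 1, t.points 2} ⊆ t.chi '' {w | w 2 = 0} := by
  refine convexHull_min ?_ ?_
  · rintro _ (rfl | rfl | rfl)
    · exact ⟨![0, 0, 0], rfl, by simp [Tet.chi_eq_sum, Fin.sum_univ_four]⟩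
    · exact ⟨![1, 0, 0], rfl, by simp [Tet.chi_eq_sum, Fin.sum_univ_four]⟩
    · exact ⟨![1, 1, 0], rfl, by simp [Tet.chi_eq_sum, Fin.sum_univ_four]⟩
  · rintro _ ⟨x, hx, rfl⟩ _ ⟨y, hy, rfl⟩ a b - - hab
    have hx : x 2 = 0 := hx
    have hy : y 2 = 0 := hy
    refine ⟨a • x + b • y, by simp [hx, hy], ?_⟩
    rw [Tet.chi_eq, Tet.chi_eq, Tet.chi_eq, map_add, map_smul, map_smul, smul_add, smul_add,
      add_add_add_comm, ← add_smul, hab, one_smul]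

/-- The shifted pair lies in the product of the reference tetrahedra, and the pair does not consist
of two equal points of `W`. -/
def Separated (v : Ref) (W : Set Ref) (p : Ref × Ref) : Prop :=
  (v + p.1 ∈ refTet ∧ v + p.2 ∈ refTet) ∧ ¬(p.1 = p.2 ∧ p.1 ∈ W)

theorem Separated.swap {v : Ref} {W : Set Ref} {p : Ref × Ref} (h : Separated v W p) :
    Separated v W p.swap :=
  ⟨h.1.symm, fun ⟨h1, h2⟩ =>
    h.2 ⟨h1.symm, (show p.2 = p.1 from h1) ▸ (show p.2 ∈ W from h2)⟩⟩

/-- The shift by `v` moves both points into `refTet` without altering `diffMap`. If this vanished,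
the shifted points would coincide and lie in `W`; removing the shift keeps them in `W` by `hvW`,
which `Separated` forbids. -/
theorem Separated.diffMap_ne_zero {v : Ref} {W : Set Ref} {p : Ref × Ref} (h : Separated v W p)
    {t₁ t₂ : Tet} (h0 : t₁.points 0 = t₂.points 0) (hv : t₁.lin v = t₂.lin v)
    (hW : ∀ w ∈ W, t₁.lin w = t₂.lin w) (hinter : t₁.body ∩ t₂.body ⊆ t₁.chi '' W)
    (hvW : ∀ w, v + w ∈ W → w ∈ W) : diffMap t₁ t₂ p ≠ 0 := by
  intro hp
  have hz : diffMap t₁ t₂ (v + p.1, v + p.2) = 0 := by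
    rw [show (v + p.1, v + p.2) = (v, v) + p from rfl, map_add, hp, add_zero, diffMap_apply, hv,
      sub_self]
  obtain ⟨h1, h2⟩ := mem_and_eq_of_diffMap_eq_zero h0 hW hinter h.1.1 h.1.2 hz
  exact h.2 ⟨add_left_cancel h2, hvW _ h1⟩

/-- Bounds for the monomials in `η`, which let `linarith` treat them as independent variables
afterwards. -/
theorem mul_mem_Icc {a b : ℝ} (ha : 0 ≤ a) (hb : 0 ≤ b) (hb' : b ≤ 1) :
    0 ≤ a * b ∧ a * b ≤ a :=
  ⟨mul_nonneg ha hb, mul_le_of_le_one_right ha hb'⟩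

theorem refTet_vec_iff (a b c : ℝ) :
    (![a, b, c] : Ref) ∈ refTet ↔ 0 ≤ b ∧ 0 ≤ c ∧ b + c ≤ a ∧ a ≤ 1 := Iff.rfl

theorem vec_eq_iff (a b c a' b' c' : ℝ) :
    (![a, b, c] : Ref) = ![a', b', c'] ↔ a = a' ∧ b = b' ∧ c = c' := by
  simp [Matrix.vecCons_inj]

theorem e1_add_vec (a b c : ℝ) : (![1, 0, 0] : Ref) + ![a, b, c] = ![1 + a, b, c] := by
  ext i; fin_cases i <;> simp

theorem separated_vertexMap {η : Fin 5 → ℝ} (hη : η ∈ Icc 0 1) (m : Fin 2) :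
    Separated 0 {0} (vertexMap η m) := by
  have h0 (i : Fin 5) : 0 ≤ η i := hη.1 i
  have h1 (i : Fin 5) : η i ≤ 1 := hη.2 i
  obtain ⟨a0, a1⟩ := mul_mem_Icc (h0 0) (h0 1) (h1 1)
  obtain ⟨b0, b1⟩ := mul_mem_Icc (h0 2) (h0 3) (h1 3)
  obtain ⟨c0, c1⟩ := mul_mem_Icc b0 (h0 4) (h1 4)
  have h : Separated 0 {0} (vertexMap η 0) := by
    refine ⟨⟨?_, ?_⟩, fun h => ?_⟩
    · rw [zero_add]
      refine (refTet_vec_iff _ _ _).2 ⟨?_, ?_, ?_, ?_⟩ <;> linarith [h1 0]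
    · rw [zero_add]
      refine (refTet_vec_iff _ _ _).2 ⟨?_, ?_, ?_, ?_⟩ <;> linarith [h1 2]
    -- The first point has first coordinate `1`, so it is never the common vertex.
    · have h2 : (vertexMap η 0).1 = 0 := h.2
      exact one_ne_zero (congrFun h2 0)
  fin_cases m
  exacts [h, h.swap]

/-- The first components of `𝒟_m` lie in `[-1, 0]`, so the shift by `e₁` brings both points into
`refTet`. Equality of the two points together with membership in the edge is contradictory by linear
arithmetic in the monomials. -/
theorem separated_edgeMap {η : Fin 4 → ℝ} (hη : η ∈ Icc 0 1) (m : Fin 4) :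
    Separated ![1, 0, 0] {w | w 1 = 0 ∧ w 2 = 0} (edgeMap η m) := by
  have h0 (i : Fin 4) : 0 ≤ η i := hη.1 i
  have h1 (i : Fin 4) : η i ≤ 1 := hη.2 i
  obtain ⟨a0, a1⟩ := mul_mem_Icc (h0 0) (h0 1) (h1 1)
  obtain ⟨b0, b1⟩ := mul_mem_Icc (h0 1) (h0 2) (h1 2)
  obtain ⟨c0, c1⟩ := mul_mem_Icc b0 (h0 3) (h1 3)
  obtain ⟨d0, d1⟩ := mul_mem_Icc (h0 2) (h0 3) (h1 3)
  have key (a b c a' b' c' : ℝ) (h : 0 ≤ b ∧ 0 ≤ c ∧ b + c ≤ 1 + a ∧ 1 + a ≤ 1)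
      (h' : 0 ≤ b' ∧ 0 ≤ c' ∧ b' + c' ≤ 1 + a' ∧ 1 + a' ≤ 1)
      (hne : a = a' → b = b' → c = c' → b = 0 → c = 0 → False) :
      Separated ![1, 0, 0] {w | w 1 = 0 ∧ w 2 = 0} (![a, b, c], ![a', b', c']) := by
    refine ⟨⟨?_, ?_⟩, fun ⟨e, f⟩ => ?_⟩
    · rw [e1_add_vec]; exact h
    · rw [e1_add_vec]; exact h'
    · obtain ⟨e0, e1, e2⟩ := (vec_eq_iff _ _ _ _ _ _).1 e
      exact hne e0 e1 e2 f.1 f.2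
  have h (m : Fin 2) : Separated ![1, 0, 0] {w | w 1 = 0 ∧ w 2 = 0} (edgeHalf η m) := by
    fin_cases m <;>
    · refine key _ _ _ _ _ _ ⟨?_, ?_, ?_, ?_⟩ ⟨?_, ?_, ?_, ?_⟩ fun e0 e1 e2 f f' => ?_ <;>
      linarith [h0 0, h0 1, h0 2, h1 0, h1 1, h1 2]
  fin_cases m
  exacts [h 0, h 1, (h 0).swap, (h 1).swap]

theorem separated_faceMap {η : Fin 3 → ℝ} (hη : η ∈ Icc 0 1) (m : Fin 17) :
    Separated ![1, 0, 0] {w | w 2 = 0} (faceMap η m) := by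
  have h0 (i : Fin 3) : 0 ≤ η i := hη.1 i
  have h1 (i : Fin 3) : η i ≤ 1 := hη.2 i
  obtain ⟨a0, a1⟩ := mul_mem_Icc (h0 0) (h0 1) (h1 1)
  obtain ⟨b0, b1⟩ := mul_mem_Icc a0 (h0 2) (h1 2)
  obtain ⟨c0, c1⟩ := mul_mem_Icc (h0 0) (h0 2) (h1 2)
  have key (a b c a' b' c' : ℝ) (h : 0 ≤ b ∧ 0 ≤ c ∧ b + c ≤ 1 + a ∧ 1 + a ≤ 1)
      (h' : 0 ≤ b' ∧ 0 ≤ c' ∧ b' + c' ≤ 1 + a' ∧ 1 + a' ≤ 1)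
      (hne : a = a' → b = b' → c = c' → c = 0 → False) :
      Separated ![1, 0, 0] {w | w 2 = 0} (![a, b, c], ![a', b', c']) := by
    refine ⟨⟨?_, ?_⟩, fun ⟨e, f⟩ => ?_⟩
    · rw [e1_add_vec]; exact h
    · rw [e1_add_vec]; exact h'
    · obtain ⟨e0, e1, e2⟩ := (vec_eq_iff _ _ _ _ _ _).1 e
      exact hne e0 e1 e2 f
  have h (m : Fin 7) : Separated ![1, 0, 0] {w | w 2 = 0} (faceHalf η m) := by
    fin_cases m <;>
    · refine key _ _ _ _ _ _ ⟨?_, ?_, ?_, ?_⟩ ⟨?_, ?_, ?_, ?_⟩ fun e0 e1 e2 f => ?_ <;>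
      linarith [h0 0, h1 0, h0 1, h1 1, h0 2, h1 2]
  fin_cases m
  · exact h 0
  · exact h 1
  · exact h 2
  · exact h 3
  · exact h 4
  · exact h 5
  · exact h 6
  · exact (h 0).swap
  · exact (h 1).swap
  · exact (h 2).swap
  · exact (h 3).swap
  · exact (h 4).swap
  · exact (h 5).swap
  · exact (h 6).swap
  all_goals
    refine key _ _ _ _ _ _ ⟨?_, ?_, ?_, ?_⟩ ⟨?_, ?_, ?_, ?_⟩ fun e0 e1 e2 f => ?_ <;>
    linarith [h0 0, h1 0, h0 1, h1 1, h0 2, h1 2]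

/-- For a single tetrahedron `M_t` is injective, so distinct reference points suffice and no shift
into `refTet` is needed. -/
theorem tetraHalf_fst_ne_snd {η : Fin 2 → ℝ} (hη : η ∈ Icc 0 1) (m : Fin 9) :
    (tetraHalf η m).1 ≠ (tetraHalf η m).2 := by
  have h0 (i : Fin 2) : 0 ≤ η i := hη.1 i
  have h1 (i : Fin 2) : η i ≤ 1 := hη.2 i
  obtain ⟨a0, a1⟩ := mul_mem_Icc (h0 0) (h0 1) (h1 1)
  intro h
  fin_cases m <;>
  · obtain ⟨e0, e1, e2⟩ := (vec_eq_iff _ _ _ _ _ _).1 h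
    linarith [h0 0, h1 0, h0 1, h1 1]

theorem diffMap_tetraMap_ne_zero (t : Tet) {η : Fin 2 → ℝ} (hη : η ∈ Icc 0 1)
    (i : Bool × Fin 9) : diffMap t t (tetraMap η i) ≠ 0 := by
  rw [diffMap_apply, sub_ne_zero, t.lin_injective.ne_iff]
  obtain ⟨b, m⟩ := i
  cases b
  · exact tetraHalf_fst_ne_snd hη m
  · exact (tetraHalf_fst_ne_snd hη m).symm

/-! ### Assembling the cases -/

/-- Homogeneity is available only for positive factors; the faces of the cube where some `ξ_j`
vanishes are null. -/
theorem ae_pos_of_Icc (n : ℕ) :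
    ∀ᵐ ξ ∂(volume : Measure (Fin n → ℝ)).restrict (Icc 0 1), ∀ j, 0 < ξ j := by
  have h0 : ∀ᵐ ξ ∂(volume : Measure (Fin n → ℝ)), ∀ j, ξ j ≠ 0 := by
    rw [ae_all_iff]
    intro j
    exact measure_eq_zero_iff_ae_notMem.1
      (Measure.pi_hyperplane (fun _ : Fin n => (volume : Measure ℝ)) j (0 : ℝ))
  filter_upwards [ae_restrict_of_ae h0, ae_restrict_mem measurableSet_Icc] with ξ h1 h2 j
  exact lt_of_le_of_ne (h2.1 j) (h1 j).symm

theorem rpow_mul_pow_eq {x : ℝ} (hx : 0 < x) {a b : ℝ} (k : ℕ) (h : a + k = b) :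
    x ^ b = x ^ a * x ^ k := by
  rw [← Real.rpow_natCast, ← Real.rpow_add hx, h]

/-- Each `ξ_j` enters the scaling factor of `kTilde` once and the Jacobian with power `5 - j`. The
bound on `j` makes the natural subtraction the true one. -/
theorem rpow_weight_eq {n : ℕ} {ξ : Fin n → ℝ} (hξ : ∀ j, 0 < ξ j) (s : ℝ) (j : Fin n)
    (hj : (j : ℕ) ≤ 5) :
    ξ j ^ (4 - (j : ℝ) - 2 * s) = ξ j ^ (-1 - 2 * s) * ξ j ^ (5 - (j : ℕ)) :=
  rpow_mul_pow_eq (hξ j) _ (by push_cast [hj]; ring)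

/-- The reduction formulas for a family of pieces which covers the product of the reference
tetrahedra and on which the pulled back kernel splits. -/
theorem singularIntegral_of_pieces {ι : Type*} [Fintype ι] (P : ι → DuffyPiece)
    (hcover : ∀ x ∈ refTet, ∀ y ∈ refTet, ∃ i, appendMeasurableEquiv 3 3 (x, y) ∈ (P i).region)
    (hmass : ∑ i, 1 / ∏ j, (((P i).tree.expo j : ℝ) + 1) = 1 / 36)
    {X Y : Type*} [MeasureSpace X] [MeasureSpace Y] [SFinite (volume : Measure X)]
    [SFinite (volume : Measure Y)] (e : X × Y ≃ᵐ (Fin 6 → ℝ)) (he : MeasurePreserving e)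
    {U : Set X} {V : Set Y} (hUV : e ⁻¹' Icc 0 1 = U ×ˢ V) (hV : MeasurableSet V)
    {s : ℝ} {t₁ t₂ : Tet} {φ ψ : E3 → ℝ} {φ₁ φ₂ ψ₁ ψ₂ : E3 →ᵃ[ℝ] ℝ}
    (hφ₁ : EqOn φ φ₁ t₁.body) (hφ₂ : EqOn φ φ₂ t₂.body)
    (hψ₁ : EqOn ψ ψ₁ t₁.body) (hψ₂ : EqOn ψ ψ₂ t₂.body)
    {g : X → ℝ} {h : ι → Y → ℝ} (hg : IntegrableOn g U) (hh : ∀ i, IntegrableOn (h i) V)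
    {f : ι → X → Y → ℝ} (hf : ∀ i ξ η, f i ξ η =
      kTilde s φ₁ φ₂ ψ₁ ψ₂ t₁ t₂ ((P i).toRef (e (ξ, η))) * (P i).tree.jac (e (ξ, η)))
    (heq : ∀ᵐ ξ ∂(volume.restrict U), ∀ i, ∀ η ∈ V, f i ξ η = g ξ * h i η) :
    IntegrableOn (fun p : E3 × E3 => k1 s φ ψ p.1 p.2) (t₁.body ×ˢ t₂.body) ∧
      singularIntegral s φ ψ t₁ t₂ = ∫ ξ in U, ∫ η in V, ∑ i, f i ξ η ∧
      singularIntegral s φ ψ t₁ t₂ = (∫ ξ in U, g ξ) * ∫ η in V, ∑ i, h i η := by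
  obtain ⟨hint, hval⟩ := integrableOn_and_setIntegral_of_pieces P hcover hmass e he hUV hV
    (measurable_kTilde s φ₁ φ₂ ψ₁ ψ₂ t₁ t₂) hg hh (by simpa only [hf] using heq)
  obtain ⟨hk, hI⟩ := integrableOn_and_singularIntegral_eq s t₁ t₂ φ ψ φ₁ φ₂ ψ₁ ψ₂ hφ₁ hφ₂ hψ₁ hψ₂
    hint
  have hsum : ∑ i, ∫ η in V, h i η = ∫ η in V, ∑ i, h i η :=
    (integral_finsetSum _ fun i _ => hh i).symm
  rw [hval, hsum] at hI
  refine ⟨hk, ?_, hI⟩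
  rw [hI, ← integral_mul_const]
  refine integral_congr_ae ?_
  filter_upwards [heq] with ξ hξ
  rw [← integral_const_mul]
  -- For almost every `ξ` the inner integrand is `g ξ` times the reduced sum, on all of `V`.
  refine setIntegral_congr_fun hV fun η hη => ?_
  simp only [hξ _ η hη, Finset.mul_sum]

theorem analyticOnNhd_of_contDiffAt {n : ℕ} {f : (Fin n → ℝ) → ℝ} {s : Set (Fin n → ℝ)}
    (h : ∀ η ∈ s, ContDiffAt ℝ ω f η) : AnalyticOnNhd ℝ f s := fun η hη => (h η hη).analyticAt

theorem integrableOn_of_contDiffAt {n : ℕ} {f : (Fin n → ℝ) → ℝ}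
    (h : ∀ η ∈ Icc (0 : Fin n → ℝ) 1, ContDiffAt ℝ ω f η) : IntegrableOn f (Icc 0 1) :=
  ContinuousOn.integrableOn_compact isCompact_Icc
    fun η hη => (h η hη).continuousAt.continuousWithinAt

theorem linear_sub_eq {φ₁ φ₂ : E3 →ᵃ[ℝ] ℝ} {p q : E3} (hp : φ₁ p = φ₂ p) (hq : φ₁ q = φ₂ q) :
    φ₁.linear (q - p) = φ₂.linear (q - p) := by
  rw [← vsub_eq_sub, AffineMap.linearMap_vsub, AffineMap.linearMap_vsub, hp, hq]

theorem Tet.points_mem_body (t : Tet) (i : Fin 4) : t.points i ∈ t.body :=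
  subset_convexHull ℝ _ (mem_range_self i)

theorem eq_at_common_point {t₁ t₂ : Tet} {φ : E3 → ℝ} {φ₁ φ₂ : E3 →ᵃ[ℝ] ℝ}
    (hφ₁ : EqOn φ φ₁ t₁.body) (hφ₂ : EqOn φ φ₂ t₂.body) {i : Fin 4}
    (h : t₁.points i = t₂.points i) : φ₁ (t₁.points i) = φ₂ (t₁.points i) := by
  rw [← hφ₁ (t₁.points_mem_body i), h, ← hφ₂ (t₂.points_mem_body i)]

theorem Tet.lin_e1 (t : Tet) : t.lin ![1, 0, 0] = t.points 1 - t.points 0 := by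
  simp [Tet.lin_apply]

theorem Tet.lin_e2 (t : Tet) : t.lin ![0, 1, 0] = t.points 2 - t.points 1 := by
  simp [Tet.lin_apply]

/-! ### The four configurations -/

section Cases

variable {s : ℝ} {t₁ t₂ : Tet} {φ ψ : E3 → ℝ} {φ₁ φ₂ ψ₁ ψ₂ : E3 →ᵃ[ℝ] ℝ}

theorem compatible_of_eqOn (hφ₁ : EqOn φ φ₁ t₁.body) (hφ₂ : EqOn φ φ₂ t₂.body)
    (hψ₁ : EqOn ψ ψ₁ t₁.body) (hψ₂ : EqOn ψ ψ₂ t₂.body) (h0 : t₁.points 0 = t₂.points 0) :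
    Compatible t₁ t₂ φ₁ φ₂ ψ₁ ψ₂ :=
  ⟨h0, by rw [eq_at_common_point hφ₁ hφ₂ h0, h0], by rw [eq_at_common_point hψ₁ hψ₂ h0, h0]⟩

/-- Both matrices send `e₁` to the common edge vector `b - a`, and the affine functions agree at its
two ends, so they vary equally along it. -/
theorem kTilde_add_e1 (hφ₁ : EqOn φ φ₁ t₁.body) (hφ₂ : EqOn φ φ₂ t₂.body)
    (hψ₁ : EqOn ψ ψ₁ t₁.body) (hψ₂ : EqOn ψ ψ₂ t₂.body) (h0 : t₁.points 0 = t₂.points 0)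
    (h1 : t₁.points 1 = t₂.points 1) (c : ℝ) (p : Ref × Ref) :
    kTilde s φ₁ φ₂ ψ₁ ψ₂ t₁ t₂ (c • pairE1 + p) = kTilde s φ₁ φ₂ ψ₁ ψ₂ t₁ t₂ p := by
  refine (compatible_of_eqOn hφ₁ hφ₂ hψ₁ hψ₂ h0).kTilde_add (v := c • ![1, 0, 0]) ?_ ?_ ?_ p
  · rw [map_smul, map_smul, Tet.lin_e1, Tet.lin_e1, h0, h1]
  · rw [map_smul, Tet.lin_e1, map_smul, map_smul, linear_sub_eq (eq_at_common_point hφ₁ hφ₂ h0)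
      (eq_at_common_point hφ₁ hφ₂ h1)]
  · rw [map_smul, Tet.lin_e1, map_smul, map_smul, linear_sub_eq (eq_at_common_point hψ₁ hψ₂ h0)
      (eq_at_common_point hψ₁ hψ₂ h1)]

theorem kTilde_add_e2 (hφ₁ : EqOn φ φ₁ t₁.body) (hφ₂ : EqOn φ φ₂ t₂.body)
    (hψ₁ : EqOn ψ ψ₁ t₁.body) (hψ₂ : EqOn ψ ψ₂ t₂.body) (h0 : t₁.points 0 = t₂.points 0)
    (h1 : t₁.points 1 = t₂.points 1) (h2 : t₁.points 2 = t₂.points 2) (c : ℝ) (p : Ref × Ref) :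
    kTilde s φ₁ φ₂ ψ₁ ψ₂ t₁ t₂ (c • pairE2 + p) = kTilde s φ₁ φ₂ ψ₁ ψ₂ t₁ t₂ p := by
  refine (compatible_of_eqOn hφ₁ hφ₂ hψ₁ hψ₂ h0).kTilde_add (v := c • ![0, 1, 0]) ?_ ?_ ?_ p
  · rw [map_smul, map_smul, Tet.lin_e2, Tet.lin_e2, h1, h2]
  · rw [map_smul, Tet.lin_e2, map_smul, map_smul, linear_sub_eq (eq_at_common_point hφ₁ hφ₂ h1)
      (eq_at_common_point hφ₁ hφ₂ h2)]
  · rw [map_smul, Tet.lin_e2, map_smul, map_smul, linear_sub_eq (eq_at_common_point hψ₁ hψ₂ h1)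
      (eq_at_common_point hψ₁ hψ₂ h2)]

theorem singularIntegral_commonVertex (hs1 : s < 1) (hφ₁ : EqOn φ φ₁ t₁.body)
    (hφ₂ : EqOn φ φ₂ t₂.body) (hψ₁ : EqOn ψ ψ₁ t₁.body) (hψ₂ : EqOn ψ ψ₂ t₂.body)
    (h0 : t₁.points 0 = t₂.points 0) (hinter : t₁.body ∩ t₂.body = {t₁.points 0}) :
    IntegrableOn (fun p : E3 × E3 => k1 s φ ψ p.1 p.2) (t₁.body ×ˢ t₂.body) ∧
      singularIntegral s φ ψ t₁ t₂ =
        ∫ ξ in Icc (0 : ℝ) 1, ∫ η in Icc (0 : Fin 5 → ℝ) 1,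
          (kTilde s φ₁ φ₂ ψ₁ ψ₂ t₁ t₂ (vertexMapFull ξ η 0) +
            kTilde s φ₁ φ₂ ψ₁ ψ₂ t₁ t₂ (vertexMapFull ξ η 1)) * vertexJacFull ξ η ∧
      singularIntegral s φ ψ t₁ t₂ =
        1 / (5 - 2 * s) *
          ∫ η in Icc (0 : Fin 5 → ℝ) 1, kV (kTilde s φ₁ φ₂ ψ₁ ψ₂ t₁ t₂) η ∧
      AnalyticOnNhd ℝ (kV (kTilde s φ₁ φ₂ ψ₁ ψ₂ t₁ t₂)) (Icc 0 1) := by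
  have hc := compatible_of_eqOn hφ₁ hφ₂ hψ₁ hψ₂ h0
  have hD (m : Fin 2) (η : Fin 5 → ℝ) (hη : η ∈ Icc 0 1) : ContDiffAt ℝ ω
      (fun η => kTilde s φ₁ φ₂ ψ₁ ψ₂ t₁ t₂ (vertexMap η m) * vertexJac η) η :=
    hc.contDiffAt_kTilde_comp (contDiff_vertexMap m) contDiff_vertexJac
      ((separated_vertexMap hη m).diffMap_ne_zero h0 (by simp) (by simp)
        (by rw [hinter]; simp [Tet.chi_eq]) (by simp))
  have hkV : kV (kTilde s φ₁ φ₂ ψ₁ ψ₂ t₁ t₂) = fun η =>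
      ∑ m, kTilde s φ₁ φ₂ ψ₁ ψ₂ t₁ t₂ (vertexMap η m) * vertexJac η := by
    ext η
    rw [kV, Fin.sum_univ_two, add_mul]
  -- Here `ξ` is a single real number, so the coordinate `0` is split off instead of concatenating
  -- two vectors.
  let e : ℝ × (Fin 5 → ℝ) ≃ᵐ (Fin 6 → ℝ) :=
    (MeasurableEquiv.piFinSuccAbove (fun _ : Fin 6 => ℝ) 0).symm
  have he : MeasurePreserving e := (volume_preserving_piFinSuccAbove (fun _ : Fin 6 => ℝ) 0).symm
  have heq0 (ξ : ℝ) (η : Fin 5 → ℝ) : e (ξ, η) 0 = ξ := rfl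
  have heqs (ξ : ℝ) (η : Fin 5 → ℝ) : ![e (ξ, η) 1, e (ξ, η) 2, e (ξ, η) 3, e (ξ, η) 4,
      e (ξ, η) 5] = η := by
    ext i; fin_cases i <;> rfl
  have hUV : e ⁻¹' Icc 0 1 = Icc (0 : ℝ) 1 ×ˢ Icc (0 : Fin 5 → ℝ) 1 := by
    ext ⟨ξ, η⟩
    have h (i : Fin 5) : e (ξ, η) i.succ = η i := by fin_cases i <;> rfl
    simp only [mem_preimage, mem_prod, mem_Icc, Pi.le_def, Fin.forall_fin_succ (n := 5), heq0, h,
      Pi.zero_apply, Pi.one_apply]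
    tauto
  have hpos : ∀ᵐ ξ ∂(volume.restrict (Icc (0 : ℝ) 1)), 0 < ξ := by
    have h1 : ∀ᵐ ξ : ℝ, ξ ≠ 0 := Measure.ae_ne volume 0
    filter_upwards [ae_restrict_of_ae h1, ae_restrict_mem measurableSet_Icc] with ξ h1 h2
    exact lt_of_le_of_ne h2.1 h1.symm
  obtain ⟨r1, r2, r3⟩ := singularIntegral_of_pieces vertexPiece vertexPiece_cover
    vertexPiece_volume e he hUV measurableSet_Icc hφ₁ hφ₂ hψ₁ hψ₂
    (g := fun ξ => ξ ^ (4 - 2 * s))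
    (h := fun m η => kTilde s φ₁ φ₂ ψ₁ ψ₂ t₁ t₂ (vertexMap η m) * vertexJac η)
    (integrableOn_rpow_Icc (by linarith)) (fun m => integrableOn_of_contDiffAt (hD m))
    (f := fun m ξ η => kTilde s φ₁ φ₂ ψ₁ ψ₂ t₁ t₂ (vertexMapFull ξ η m) * vertexJacFull ξ η)
    (fun m ξ η => by rw [vertexPiece_toRef, vertexPiece_jac, heq0, heqs])
    (by
      filter_upwards [hpos] with ξ hξ m η _
      rw [vertexMapFull, hc.kTilde_smul hξ, vertexJacFull,
        rpow_mul_pow_eq hξ (a := -1 - 2 * s) (b := 4 - 2 * s) 5 (by push_cast; ring)]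
      ring)
  refine ⟨r1, ?_, ?_, ?_⟩
  · simpa only [Fin.sum_univ_two, ← add_mul] using r2
  · rw [hkV, r3, setIntegral_rpow_Icc (by linarith)]
    congr 2; ring
  · rw [hkV]
    exact analyticOnNhd_of_contDiffAt fun η hη => ContDiffAt.sum fun m _ => hD m η hη

theorem singularIntegral_commonEdge (hs1 : s < 1) (hφ₁ : EqOn φ φ₁ t₁.body)
    (hφ₂ : EqOn φ φ₂ t₂.body) (hψ₁ : EqOn ψ ψ₁ t₁.body) (hψ₂ : EqOn ψ ψ₂ t₂.body)
    (h0 : t₁.points 0 = t₂.points 0) (h1 : t₁.points 1 = t₂.points 1)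
    (hinter : t₁.body ∩ t₂.body = segment ℝ (t₁.points 0) (t₁.points 1)) :
    IntegrableOn (fun p : E3 × E3 => k1 s φ ψ p.1 p.2) (t₁.body ×ˢ t₂.body) ∧
      singularIntegral s φ ψ t₁ t₂ =
        ∫ ξ in Icc (0 : Fin 2 → ℝ) 1, ∫ η in Icc (0 : Fin 4 → ℝ) 1,
          ∑ m : Fin 4, kTilde s φ₁ φ₂ ψ₁ ψ₂ t₁ t₂ (edgeMapFull ξ η m) * edgeJacFull ξ η m ∧
      singularIntegral s φ ψ t₁ t₂ =
        1 / (5 - 2 * s) * (1 / (4 - 2 * s)) *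
          ∫ η in Icc (0 : Fin 4 → ℝ) 1, kE (kTilde s φ₁ φ₂ ψ₁ ψ₂ t₁ t₂) η ∧
      AnalyticOnNhd ℝ (kE (kTilde s φ₁ φ₂ ψ₁ ψ₂ t₁ t₂)) (Icc 0 1) := by
  have hc := compatible_of_eqOn hφ₁ hφ₂ hψ₁ hψ₂ h0
  have hD (m : Fin 4) (η : Fin 4 → ℝ) (hη : η ∈ Icc 0 1) : ContDiffAt ℝ ω
      (fun η => kTilde s φ₁ φ₂ ψ₁ ψ₂ t₁ t₂ (edgeMap η m) * edgeJac η m) η :=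
    hc.contDiffAt_kTilde_comp (contDiff_edgeMap m) (contDiff_edgeJac m)
      ((separated_edgeMap hη m).diffMap_ne_zero h0 (by rw [Tet.lin_e1, Tet.lin_e1, h0, h1])
        (fun w hw => lin_eq_lin_of_edge h0 h1 hw)
        (by rw [hinter]; exact segment_subset_image_chi t₁)
        fun w hw => ⟨(zero_add (w 1)).symm.trans hw.1, (zero_add (w 2)).symm.trans hw.2⟩)
  have he0 (ξ : Fin 2 → ℝ) (η : Fin 4 → ℝ) :
      ![appendMeasurableEquiv 2 4 (ξ, η) 0, appendMeasurableEquiv 2 4 (ξ, η) 1] = ξ := by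
    ext i; fin_cases i <;> rfl
  have he1 (ξ : Fin 2 → ℝ) (η : Fin 4 → ℝ) :
      ![appendMeasurableEquiv 2 4 (ξ, η) 2, appendMeasurableEquiv 2 4 (ξ, η) 3,
        appendMeasurableEquiv 2 4 (ξ, η) 4, appendMeasurableEquiv 2 4 (ξ, η) 5] = η := by
    ext i; fin_cases i <;> rfl
  have hexp (j : Fin 2) : -1 < 4 - (j : ℝ) - 2 * s := by
    fin_cases j <;> norm_num <;> linarith
  obtain ⟨r1, r2, r3⟩ := singularIntegral_of_pieces edgePiece edgePiece_cover
    edgePiece_volume (appendMeasurableEquiv 2 4) (measurePreserving_append 2 4)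
    (append_preimage_Icc 2 4) measurableSet_Icc hφ₁ hφ₂ hψ₁ hψ₂
    (g := fun ξ => ∏ j, ξ j ^ (4 - (j : ℝ) - 2 * s))
    (h := fun m η => kTilde s φ₁ φ₂ ψ₁ ψ₂ t₁ t₂ (edgeMap η m) * edgeJac η m)
    (integrableOn_prod_rpow hexp) (fun m => integrableOn_of_contDiffAt (hD m))
    (f := fun m ξ η => kTilde s φ₁ φ₂ ψ₁ ψ₂ t₁ t₂ (edgeMapFull ξ η m) * edgeJacFull ξ η m)
    (fun m ξ η => by rw [edgePiece_toRef, edgePiece_jac, he0, he1])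
    (by
      filter_upwards [ae_pos_of_Icc 2] with ξ hξ m η _
      have hw0 : ξ 0 ^ (4 - ((((0 : Fin 2) : ℕ)) : ℝ) - 2 * s) = ξ 0 ^ (-1 - 2 * s) * ξ 0 ^ 5 :=
        rpow_weight_eq hξ s 0 (by decide)
      have hw1 : ξ 1 ^ (4 - ((((1 : Fin 2) : ℕ)) : ℝ) - 2 * s) = ξ 1 ^ (-1 - 2 * s) * ξ 1 ^ 4 :=
        rpow_weight_eq hξ s 1 (by decide)
      rw [edgeMapFull, kTilde_add_e1 hφ₁ hφ₂ hψ₁ hψ₂ h0 h1,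
        hc.kTilde_smul (mul_pos (hξ 0) (hξ 1)), edgeJacFull,
        Real.mul_rpow (hξ 0).le (hξ 1).le, Fin.prod_univ_two,
        hw0,
        hw1]
      ring)
  refine ⟨r1, r2, ?_, ?_⟩
  · rw [r3, setIntegral_prod_rpow hexp, Fin.prod_univ_two]
    congr 3 <;> norm_num <;> ring
  · exact analyticOnNhd_of_contDiffAt fun η hη => ContDiffAt.sum fun m _ => hD m η hη

theorem singularIntegral_commonFace (hs1 : s < 1) (hφ₁ : EqOn φ φ₁ t₁.body)
    (hφ₂ : EqOn φ φ₂ t₂.body) (hψ₁ : EqOn ψ ψ₁ t₁.body) (hψ₂ : EqOn ψ ψ₂ t₂.body)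
    (h0 : t₁.points 0 = t₂.points 0) (h1 : t₁.points 1 = t₂.points 1)
    (h2 : t₁.points 2 = t₂.points 2)
    (hinter : t₁.body ∩ t₂.body = convexHull ℝ {t₁.points 0, t₁.points 1, t₁.points 2}) :
    IntegrableOn (fun p : E3 × E3 => k1 s φ ψ p.1 p.2) (t₁.body ×ˢ t₂.body) ∧
      singularIntegral s φ ψ t₁ t₂ =
        ∫ ξ in Icc (0 : Fin 3 → ℝ) 1, ∫ η in Icc (0 : Fin 3 → ℝ) 1,
          ∑ m : Fin 17, kTilde s φ₁ φ₂ ψ₁ ψ₂ t₁ t₂ (faceMapFull ξ η m) * faceJacFull ξ η m ∧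
      singularIntegral s φ ψ t₁ t₂ =
        (∏ j ∈ Finset.range 3, 1 / (5 - (j : ℝ) - 2 * s)) *
          ∫ η in Icc (0 : Fin 3 → ℝ) 1, kF (kTilde s φ₁ φ₂ ψ₁ ψ₂ t₁ t₂) η ∧
      AnalyticOnNhd ℝ (kF (kTilde s φ₁ φ₂ ψ₁ ψ₂ t₁ t₂)) (Icc 0 1) := by
  have hc := compatible_of_eqOn hφ₁ hφ₂ hψ₁ hψ₂ h0
  have hD (m : Fin 17) (η : Fin 3 → ℝ) (hη : η ∈ Icc 0 1) : ContDiffAt ℝ ω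
      (fun η => kTilde s φ₁ φ₂ ψ₁ ψ₂ t₁ t₂ (faceMap η m) * faceJac η m) η :=
    hc.contDiffAt_kTilde_comp (contDiff_faceMap m) (contDiff_faceJac m)
      ((separated_faceMap hη m).diffMap_ne_zero h0 (by rw [Tet.lin_e1, Tet.lin_e1, h0, h1])
        (fun w hw => lin_eq_lin_of_face h0 h1 h2 hw)
        (by rw [hinter]; exact convexHull_subset_image_chi t₁)
        fun w hw => (zero_add (w 2)).symm.trans hw)
  have he0 (ξ η : Fin 3 → ℝ) :
      ![appendMeasurableEquiv 3 3 (ξ, η) 0, appendMeasurableEquiv 3 3 (ξ, η) 1,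
        appendMeasurableEquiv 3 3 (ξ, η) 2] = ξ := by
    ext i; fin_cases i <;> rfl
  have he1 (ξ η : Fin 3 → ℝ) :
      ![appendMeasurableEquiv 3 3 (ξ, η) 3, appendMeasurableEquiv 3 3 (ξ, η) 4,
        appendMeasurableEquiv 3 3 (ξ, η) 5] = η := by
    ext i; fin_cases i <;> rfl
  have hexp (j : Fin 3) : -1 < 4 - (j : ℝ) - 2 * s := by
    fin_cases j <;> norm_num <;> linarith
  obtain ⟨r1, r2, r3⟩ := singularIntegral_of_pieces facePiece facePiece_cover
    facePiece_volume (appendMeasurableEquiv 3 3) (measurePreserving_append 3 3)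
    (append_preimage_Icc 3 3) measurableSet_Icc hφ₁ hφ₂ hψ₁ hψ₂
    (g := fun ξ => ∏ j, ξ j ^ (4 - (j : ℝ) - 2 * s))
    (h := fun m η => kTilde s φ₁ φ₂ ψ₁ ψ₂ t₁ t₂ (faceMap η m) * faceJac η m)
    (integrableOn_prod_rpow hexp) (fun m => integrableOn_of_contDiffAt (hD m))
    (f := fun m ξ η => kTilde s φ₁ φ₂ ψ₁ ψ₂ t₁ t₂ (faceMapFull ξ η m) * faceJacFull ξ η m)
    (fun m ξ η => by rw [facePiece_toRef, facePiece_jac, he0, he1])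
    (by
      filter_upwards [ae_pos_of_Icc 3] with ξ hξ m η _
      have hw0 : ξ 0 ^ (4 - ((((0 : Fin 3) : ℕ)) : ℝ) - 2 * s) = ξ 0 ^ (-1 - 2 * s) * ξ 0 ^ 5 :=
        rpow_weight_eq hξ s 0 (by decide)
      have hw1 : ξ 1 ^ (4 - ((((1 : Fin 3) : ℕ)) : ℝ) - 2 * s) = ξ 1 ^ (-1 - 2 * s) * ξ 1 ^ 4 :=
        rpow_weight_eq hξ s 1 (by decide)
      have hw2 : ξ 2 ^ (4 - ((((2 : Fin 3) : ℕ)) : ℝ) - 2 * s) = ξ 2 ^ (-1 - 2 * s) * ξ 2 ^ 3 :=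
        rpow_weight_eq hξ s 2 (by decide)
      have h01 := mul_pos (hξ 0) (hξ 1)
      -- The translations along `e₁` and `e₂` drop out one after the other; what remains is the
      -- scaling by `ξ₁ ξ₂ ξ₃`.
      rw [faceMapFull, add_assoc, kTilde_add_e1 hφ₁ hφ₂ hψ₁ hψ₂ h0 h1,
        kTilde_add_e2 hφ₁ hφ₂ hψ₁ hψ₂ h0 h1 h2, hc.kTilde_smul (mul_pos h01 (hξ 2)), faceJacFull,
        Real.mul_rpow h01.le (hξ 2).le, Real.mul_rpow (hξ 0).le (hξ 1).le, Fin.prod_univ_three,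
        hw0,
        hw1,
        hw2]
      ring)
  refine ⟨r1, r2, ?_, ?_⟩
  · rw [r3, setIntegral_prod_rpow hexp, Finset.prod_range]
    congr 1
    exact Finset.prod_congr rfl fun j _ => by congr 1; ring
  · exact analyticOnNhd_of_contDiffAt fun η hη => ContDiffAt.sum fun m _ => hD m η hη

/-- Both differences in the numerator change sign. Hence transposed pieces contribute equally, which
is the source of the factor `2`. -/
theorem kTilde_swap {t : Tet} (p : Ref × Ref) :
    kTilde s φ₁ φ₁ ψ₁ ψ₁ t t p.swap = kTilde s φ₁ φ₁ ψ₁ ψ₁ t t p := by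
  simp only [kTilde, Prod.fst_swap, Prod.snd_swap]
  rw [norm_sub_rev]
  ring

theorem singularIntegral_identical {t : Tet} (hs1 : s < 1) (hφ : EqOn φ φ₁ t.body)
    (hψ : EqOn ψ ψ₁ t.body) :
    IntegrableOn (fun p : E3 × E3 => k1 s φ ψ p.1 p.2) (t.body ×ˢ t.body) ∧
      singularIntegral s φ ψ t t =
        ∫ ξ in Icc (0 : Fin 4 → ℝ) 1, ∫ η in Icc (0 : Fin 2 → ℝ) 1,
          ∑ i : Bool × Fin 9,
            kTilde s φ₁ φ₁ ψ₁ ψ₁ t t (tetraMapFull ξ η i) * tetraJacFull ξ η i ∧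
      singularIntegral s φ ψ t t =
        2 * (∏ l ∈ Finset.range 4, 1 / (5 - (l : ℝ) - 2 * s)) *
          ∫ η in Icc (0 : Fin 2 → ℝ) 1, kT (kTilde s φ₁ φ₁ ψ₁ ψ₁ t t) η ∧
      AnalyticOnNhd ℝ (kT (kTilde s φ₁ φ₁ ψ₁ ψ₁ t t)) (Icc 0 1) := by
  have hc : Compatible t t φ₁ φ₁ ψ₁ ψ₁ := ⟨rfl, rfl, rfl⟩
  have hD (i : Bool × Fin 9) (η : Fin 2 → ℝ) (hη : η ∈ Icc 0 1) : ContDiffAt ℝ ω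
      (fun η => kTilde s φ₁ φ₁ ψ₁ ψ₁ t t (tetraMap η i) * tetraJac η i.2) η :=
    hc.contDiffAt_kTilde_comp (contDiff_tetraMap i) (contDiff_tetraJac i.2)
      (diffMap_tetraMap_ne_zero t hη i)
  have he0 (ξ : Fin 4 → ℝ) (η : Fin 2 → ℝ) :
      ![appendMeasurableEquiv 4 2 (ξ, η) 0, appendMeasurableEquiv 4 2 (ξ, η) 1,
        appendMeasurableEquiv 4 2 (ξ, η) 2, appendMeasurableEquiv 4 2 (ξ, η) 3] = ξ := by
    ext i; fin_cases i <;> rfl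
  have he1 (ξ : Fin 4 → ℝ) (η : Fin 2 → ℝ) :
      ![appendMeasurableEquiv 4 2 (ξ, η) 4, appendMeasurableEquiv 4 2 (ξ, η) 5] = η := by
    ext i; fin_cases i <;> rfl
  -- For `j = 3` the condition is `-1 < 1 - 2s`, that is `s < 1`.
  have hexp (j : Fin 4) : -1 < 4 - (j : ℝ) - 2 * s := by
    fin_cases j <;> norm_num <;> linarith
  obtain ⟨r1, r2, r3⟩ := singularIntegral_of_pieces tetraPiece tetraPiece_cover
    tetraPiece_volume (appendMeasurableEquiv 4 2) (measurePreserving_append 4 2)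
    (append_preimage_Icc 4 2) measurableSet_Icc hφ hφ hψ hψ
    (g := fun ξ => ∏ j, ξ j ^ (4 - (j : ℝ) - 2 * s))
    (h := fun i η => kTilde s φ₁ φ₁ ψ₁ ψ₁ t t (tetraMap η i) * tetraJac η i.2)
    (integrableOn_prod_rpow hexp) (fun i => integrableOn_of_contDiffAt (hD i))
    (f := fun i ξ η => kTilde s φ₁ φ₁ ψ₁ ψ₁ t t (tetraMapFull ξ η i) * tetraJacFull ξ η i)
    (fun i ξ η => by
      obtain ⟨v, hv⟩ := tetraPiece_toRef (appendMeasurableEquiv 4 2 (ξ, η)) i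
      rw [hv, tetraPiece_jac, he0, he1, hc.kTilde_add rfl rfl rfl])
    (by
      filter_upwards [ae_pos_of_Icc 4] with ξ hξ m η _
      have hw0 : ξ 0 ^ (4 - ((((0 : Fin 4) : ℕ)) : ℝ) - 2 * s) = ξ 0 ^ (-1 - 2 * s) * ξ 0 ^ 5 :=
        rpow_weight_eq hξ s 0 (by decide)
      have hw1 : ξ 1 ^ (4 - ((((1 : Fin 4) : ℕ)) : ℝ) - 2 * s) = ξ 1 ^ (-1 - 2 * s) * ξ 1 ^ 4 :=
        rpow_weight_eq hξ s 1 (by decide)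
      have hw2 : ξ 2 ^ (4 - ((((2 : Fin 4) : ℕ)) : ℝ) - 2 * s) = ξ 2 ^ (-1 - 2 * s) * ξ 2 ^ 3 :=
        rpow_weight_eq hξ s 2 (by decide)
      have hw3 : ξ 3 ^ (4 - ((((3 : Fin 4) : ℕ)) : ℝ) - 2 * s) = ξ 3 ^ (-1 - 2 * s) * ξ 3 ^ 2 :=
        rpow_weight_eq hξ s 3 (by decide)
      have h01 := mul_pos (hξ 0) (hξ 1)
      have h012 := mul_pos h01 (hξ 2)
      rw [tetraMapFull, hc.kTilde_smul (mul_pos h012 (hξ 3)), tetraJacFull,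
        Real.mul_rpow h012.le (hξ 3).le, Real.mul_rpow h01.le (hξ 2).le,
        Real.mul_rpow (hξ 0).le (hξ 1).le, Fin.prod_univ_four,
        hw0,
        hw1,
        hw2,
        hw3]
      ring)
  -- The eighteen terms fold into twice the nine of `kT`.
  have hsum (η : Fin 2 → ℝ) :
      ∑ i : Bool × Fin 9, kTilde s φ₁ φ₁ ψ₁ ψ₁ t t (tetraMap η i) * tetraJac η i.2 =
        2 * kT (kTilde s φ₁ φ₁ ψ₁ ψ₁ t t) η := by
    rw [Fintype.sum_prod_type, Fintype.sum_bool, two_mul]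
    simp only [tetraMap, kTilde_swap, if_true, Bool.false_eq_true, if_false, kT]
  refine ⟨r1, r2, ?_, ?_⟩
  · simp only [hsum] at r3
    rw [r3, setIntegral_prod_rpow hexp, Finset.prod_range, integral_const_mul]
    rw [← mul_assoc, mul_comm _ (2 : ℝ)]
    congr 2
    exact Finset.prod_congr rfl fun j _ => by congr 1; ring
  · exact analyticOnNhd_of_contDiffAt fun η hη => ContDiffAt.sum fun m _ => hD (false, m) η hη

end Cases

theorem mainTheorem5 (s : ℝ) (hs0 : 0 < s) (hs1 : s < 1) (t₁ t₂ : Tet) (φ ψ : E3 → ℝ)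
    (φ₁ φ₂ ψ₁ ψ₂ : E3 →ᵃ[ℝ] ℝ)
    (hφ₁ : EqOn φ φ₁ t₁.body) (hφ₂ : EqOn φ φ₂ t₂.body)
    (hψ₁ : EqOn ψ ψ₁ t₁.body) (hψ₂ : EqOn ψ ψ₂ t₂.body) :
    -- common vertex
    (t₁.points 0 = t₂.points 0 → t₁.body ∩ t₂.body = {t₁.points 0} →
      IntegrableOn (fun p : E3 × E3 => k1 s φ ψ p.1 p.2) (t₁.body ×ˢ t₂.body) ∧
      singularIntegral s φ ψ t₁ t₂ =
        ∫ ξ in Icc (0 : ℝ) 1, ∫ η in Icc (0 : Fin 5 → ℝ) 1,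
          (kTilde s φ₁ φ₂ ψ₁ ψ₂ t₁ t₂ (vertexMapFull ξ η 0) +
            kTilde s φ₁ φ₂ ψ₁ ψ₂ t₁ t₂ (vertexMapFull ξ η 1)) * vertexJacFull ξ η ∧
      singularIntegral s φ ψ t₁ t₂ =
        1 / (5 - 2 * s) *
          ∫ η in Icc (0 : Fin 5 → ℝ) 1, kV (kTilde s φ₁ φ₂ ψ₁ ψ₂ t₁ t₂) η ∧
      AnalyticOnNhd ℝ (kV (kTilde s φ₁ φ₂ ψ₁ ψ₂ t₁ t₂)) (Icc 0 1)) ∧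
    -- common edge
    (t₁.points 0 = t₂.points 0 → t₁.points 1 = t₂.points 1 →
      t₁.body ∩ t₂.body = segment ℝ (t₁.points 0) (t₁.points 1) →
      IntegrableOn (fun p : E3 × E3 => k1 s φ ψ p.1 p.2) (t₁.body ×ˢ t₂.body) ∧
      singularIntegral s φ ψ t₁ t₂ =
        ∫ ξ in Icc (0 : Fin 2 → ℝ) 1, ∫ η in Icc (0 : Fin 4 → ℝ) 1,
          ∑ m : Fin 4, kTilde s φ₁ φ₂ ψ₁ ψ₂ t₁ t₂ (edgeMapFull ξ η m) * edgeJacFull ξ η m ∧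
      singularIntegral s φ ψ t₁ t₂ =
        1 / (5 - 2 * s) * (1 / (4 - 2 * s)) *
          ∫ η in Icc (0 : Fin 4 → ℝ) 1, kE (kTilde s φ₁ φ₂ ψ₁ ψ₂ t₁ t₂) η ∧
      AnalyticOnNhd ℝ (kE (kTilde s φ₁ φ₂ ψ₁ ψ₂ t₁ t₂)) (Icc 0 1)) ∧
    -- common face
    (t₁.points 0 = t₂.points 0 → t₁.points 1 = t₂.points 1 → t₁.points 2 = t₂.points 2 →
      t₁.body ∩ t₂.body = convexHull ℝ {t₁.points 0, t₁.points 1, t₁.points 2} →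
      IntegrableOn (fun p : E3 × E3 => k1 s φ ψ p.1 p.2) (t₁.body ×ˢ t₂.body) ∧
      singularIntegral s φ ψ t₁ t₂ =
        ∫ ξ in Icc (0 : Fin 3 → ℝ) 1, ∫ η in Icc (0 : Fin 3 → ℝ) 1,
          ∑ m : Fin 17, kTilde s φ₁ φ₂ ψ₁ ψ₂ t₁ t₂ (faceMapFull ξ η m) * faceJacFull ξ η m ∧
      singularIntegral s φ ψ t₁ t₂ =
        (∏ j ∈ Finset.range 3, 1 / (5 - (j : ℝ) - 2 * s)) *
          ∫ η in Icc (0 : Fin 3 → ℝ) 1, kF (kTilde s φ₁ φ₂ ψ₁ ψ₂ t₁ t₂) η ∧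
      AnalyticOnNhd ℝ (kF (kTilde s φ₁ φ₂ ψ₁ ψ₂ t₁ t₂)) (Icc 0 1)) ∧
    -- identical tetrahedra
    (IntegrableOn (fun p : E3 × E3 => k1 s φ ψ p.1 p.2) (t₁.body ×ˢ t₁.body) ∧
      singularIntegral s φ ψ t₁ t₁ =
        ∫ ξ in Icc (0 : Fin 4 → ℝ) 1, ∫ η in Icc (0 : Fin 2 → ℝ) 1,
          ∑ i : Bool × Fin 9,
            kTilde s φ₁ φ₁ ψ₁ ψ₁ t₁ t₁ (tetraMapFull ξ η i) * tetraJacFull ξ η i ∧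
      singularIntegral s φ ψ t₁ t₁ =
        2 * (∏ l ∈ Finset.range 4, 1 / (5 - (l : ℝ) - 2 * s)) *
          ∫ η in Icc (0 : Fin 2 → ℝ) 1, kT (kTilde s φ₁ φ₁ ψ₁ ψ₁ t₁ t₁) η ∧
      AnalyticOnNhd ℝ (kT (kTilde s φ₁ φ₁ ψ₁ ψ₁ t₁ t₁)) (Icc 0 1)) := by
  exact ⟨fun h0 hi => singularIntegral_commonVertex hs1 hφ₁ hφ₂ hψ₁ hψ₂ h0 hi,
    fun h0 h1 hi => singularIntegral_commonEdge hs1 hφ₁ hφ₂ hψ₁ hψ₂ h0 h1 hi,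
    fun h0 h1 h2 hi => singularIntegral_commonFace hs1 hφ₁ hφ₂ hψ₁ hψ₂ h0 h1 h2 hi,
    singularIntegral_identical hs1 hφ₁ hψ₁⟩
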